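/- Conventions. Let $\mathbb F$ be a field and $\preceq$ a linear order on a set of variables. A noncommutative formula is a binary tree whose leaves are labelled by variables or elements of $\mathbb F$ and whose inner nodes are labelled by $+$ or $\times$; it computes a polynomial in the noncommutative polynomial ring in these variables, the order of the children of a $\times$ node being the order of multiplication. For a commutative polynomial $p$ let $[\![p]\!]$ be the noncommutative polynomial obtained by writing every monomial of $p$ as the product of its variables in $\preceq$-nondecreasing order; the polynomials $[\![p]\!]$ are called ordered. An ordered formula is a noncommutative formula all of whose subformulas compute ordered polynomials, and it computes the commutative polynomial $p$ if it computes $[\![p]\!]$. A PC proof of $g$ from $Q_1,\dots,Q_m$ is a sequence of commutative polynomials $p_1,\dots,p_\ell$ with $p_\ell=g$ such that each $p_i$ is one of the $Q_j$, or $x\cdot(1-x)$ for a variable $x$, or $x\cdot p_j$ for a variable $x$ and some $j<i$, or $a p_j+b p_k$ with $a,b\in\mathbb F$ and $j,k<i$. An OFPC proof of $g$ from $Q_1,\dots,Q_m$ is a sequence of ordered formulas $f_1,\dots,f_\ell$ computing the lines of a PC proof $p_1,\dots,p_\ell$ of $g$ from $Q_1,\dots,Q_m$; it is a refutation if $g=1$.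 A proof system for a language $L$ is a polynomial-time decidable set $R$ of pairs $(x,\pi)$ of strings such that $x\in L$ if and only if $(x,\pi)\in R$ for some $\pi$. Variables $x_i$ are encoded with $i$ in unary. Say that $\mathbb F$ is efficiently represented by an injective encoding of its elements if valid codes can be recognised and $+,\cdot,-,{}^{-1}$ can be computed on codes in polynomial time, and if the code of $P(a_1,\dots,a_k)$, for a polynomial $P$ over $\mathbb Z$ of total degree at most $d$ with coefficients of absolute value at most $2^b$ and $a_1,\dots,a_k\in\mathbb F$ with codes of size at most $s$, has size bounded by a fixed polynomial in $k+d+b+s$. Proposition. (1) For every field $\mathbb F$, every $n$, every linear order on $x_1,\dots,x_n$ and all $Q_1,\dots,Q_m\in\mathbb F[x_1,\dots,x_n]$: there is an OFPC refutation of $Q_1,\dots,Q_m$ if and only if $Q_1,\dots,Q_m$ have no common root in $\{0,1\}^n$. (2) Let $\mathbb F$ be efficiently represented. There is a polynomial-time algorithm that, given $n$, a linear order $\preceq$ on $x_1,\dots,x_n$ (as an $n\times n$ comparison table), formulas $Q_1,\dots,Q_m,g$ and a sequence $\pi$ of formulas in these variables over $\mathbb F$, decides whether all of them are ordered formulas with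 respect to $\preceq$ and $\pi$ is an OFPC proof of the polynomial computed by $g$ from the polynomials computed by $Q_1,\dots,Q_m$ (any other input string is rejected). (3) Let $\mathbb F$ be efficiently represented. The pairs of $(\preceq,(Q_1,\dots,Q_m))$ and an OFPC refutation, with respect to $\preceq$, of the polynomials computed by $Q_1,\dots,Q_m$ form a proof system for the language of all $(\preceq,(Q_1,\dots,Q_m))$, with $\preceq$ a linear order on some $x_1,\dots,x_n$ and $Q_1,\dots,Q_m$ ordered formulas over $\mathbb F$ in these variables, such that the polynomials computed by $Q_1,\dots,Q_m$ have no common root in $\{0,1\}^n$. (4) Let $\mathbb F$ be efficiently represented and let $\preceq$ be a linear order on the countable set of variables $x_0,x_1,\dots$ such that $x_i\preceq x_j$ can be decided in time polynomial in $i+j$. Translate a clause into the product of the polynomials $x_i-1$ for its literals $x_i$ and $x_i$ for its literals $\neg x_i$, and a CNF formula into the sequence of the translations of its clauses. Then the pairs of a CNF formula and an OFPC refutation of its translation form a proof system for the language of unsatisfiable CNF formulas. Likewise, translate a propositional formula $\varphi$ in the De Morgan basis into the translation of the CNF formula that has a new variable for each node of $\varphi$ other than variables, clauses saying that each new variable has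 the value of its node, and a clause saying that $\varphi$ has the value true. Then the pairs of a propositional formula and an OFPC refutation of its translation form a proof system for the language of unsatisfiable propositional formulas (that is, OFPC is a Cook-Reckhow system). -/

import Mathlib

noncomputable section

namespace OFPC

/-! ## The machine model

The data are binary trees (S-expressions), so that finite strings, lists, numbers and formulas are
all encoded directly. A program is a term of a small while-language. Every elementary step is charged
the full size of the datum that it reads (and of the constant that it writes), so the running time of
a program is, up to a polynomial, its running time on a multitape Turing machine. -/

/-- Binary trees, the data of the machine. -/
inductive Datum : Type
  | nil : Datum
  | node : Datum → Datum → Datum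

namespace Datum

/-- Number of nodes. -/
def size : Datum → ℕ
  | nil => 1
  | node a b => a.size + b.size + 1

def fst : Datum → Datum
  | nil => nil
  | node a _ => a

def snd : Datum → Datum
  | nil => nil
  | node _ b => b

/-- Unary numerals. -/
def ofNat : ℕ → Datum
  | 0 => nil
  | k + 1 => node nil (ofNat k)

def ofBool : Bool → Datum
  | false => nil
  | true => node nil nil

def ofList : List Datum → Datum
  | [] => nil
  | a :: l => node a (ofList l)

end Datum

/-- Programs; each one maps a datum to a datum. -/
inductive Prog : Type
  | id : Prog
  | const : Datum → Prog
  | fst : Prog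
  | snd : Prog
  /-- run both programs on the input and pair the results -/
  | pair : Prog → Prog → Prog
  /-- `comp f g` runs `g` and then `f` on the result -/
  | comp : Prog → Prog → Prog
  /-- `ite c f g` runs `c` on the input, then `f` on the input if the result of `c` is not `nil`, and
  `g` on the input otherwise -/
  | ite : Prog → Prog → Prog → Prog
  /-- while the first component of the current datum is not `nil`, apply the body to the datum -/
  | loop : Prog → Prog

/-- `Eval c v w t`: the program `c` halts on input `v` with output `w` after time exactly `t`. -/
inductive Eval : Prog → Datum → Datum → ℕ → Prop
  | id (v : Datum) : Eval .id v v v.size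
  | const (d v : Datum) : Eval (.const d) v d (v.size + d.size)
  | fst (v : Datum) : Eval .fst v v.fst v.size
  | snd (v : Datum) : Eval .snd v v.snd v.size
  | pair {f g : Prog} {v a b : Datum} {s t : ℕ} :
      Eval f v a s → Eval g v b t → Eval (.pair f g) v (.node a b) (v.size + s + t)
  | comp {f g : Prog} {v a b : Datum} {s t : ℕ} :
      Eval g v a s → Eval f a b t → Eval (.comp f g) v b (v.size + s + t)
  | ite_true {c f g : Prog} {v a b : Datum} {s t : ℕ} :
      Eval c v a s → a ≠ .nil → Eval f v b t → Eval (.ite c f g) v b (v.size + s + t)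
  | ite_false {c f g : Prog} {v b : Datum} {s t : ℕ} :
      Eval c v .nil s → Eval g v b t → Eval (.ite c f g) v b (v.size + s + t)
  | loop_done {c : Prog} {v : Datum} : v.fst = .nil → Eval (.loop c) v v v.size
  | loop_step {c : Prog} {v a b : Datum} {s t : ℕ} :
      v.fst ≠ .nil → Eval c v a s → Eval (.loop c) a b t → Eval (.loop c) v b (v.size + s + t)

/-- There is a program that, for every `x`, maps the input `inp x` to the output `out x` in time
polynomial in the size of the input. -/
def ComputableInPolyTime {α : Type*} (inp out : α → Datum) : Prop :=
  ∃ (c : Prog) (p : Polynomial ℕ), ∀ x, ∃ t ≤ p.eval (inp x).size, Eval c (inp x) (out x) t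

open Classical in
/-- The class P: some program halts on *every* datum `v` in time polynomial in the size of `v` and
answers whether `v` is in `L`. -/
def DecidableInPolyTime (L : Set Datum) : Prop :=
  ComputableInPolyTime (fun v : Datum => v) (fun v => Datum.ofBool (decide (v ∈ L)))

/-- `R` is (the set of pairs `(x, π)` accepted by) a proof system for the language `L`. -/
structure IsProofSystem (R L : Set Datum) : Prop where
  verifiable : DecidableInPolyTime R
  sound_and_complete : ∀ x, (∃ π, Datum.node x π ∈ R) ↔ x ∈ L

/-! ## Efficiently represented fields -/

/-- The field `F` is efficiently represented by the codes `enc a`: codes are unique, valid codes can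
be recognised and the field operations can be carried out in polynomial time, and codes do not blow
up when operations are iterated, that is, the value of an integer polynomial has a code of size
polynomial in the number of variables, the degree, the bit length of the coefficients and the size of
the codes of the arguments. -/
structure IsEfficientEncoding {F : Type*} [Field F] (enc : F → Datum) : Prop where
  injective : Function.Injective enc
  valid : DecidableInPolyTime (Set.range enc)
  add : ComputableInPolyTime (fun a : F × F => .node (enc a.1) (enc a.2)) (fun a => enc (a.1 + a.2))
  mul : ComputableInPolyTime (fun a : F × F => .node (enc a.1) (enc a.2)) (fun a => enc (a.1 * a.2))
  neg : ComputableInPolyTime (fun a : F => enc a) (fun a => enc (-a))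
  inv : ComputableInPolyTime (fun a : F => enc a) (fun a => enc a⁻¹)
  size_bound : ∃ B : Polynomial ℕ, ∀ (k d b s : ℕ) (P : MvPolynomial (Fin k) ℤ) (a : Fin k → F),
    P.totalDegree ≤ d → (∀ m, (P.coeff m).natAbs ≤ 2 ^ b) → (∀ i, (enc (a i)).size ≤ s) →
    (enc (MvPolynomial.aeval a P)).size ≤ B.eval (k + d + b + s)

/-! ## Noncommutative and ordered formulas -/

/-- Noncommutative formulas over `F` in the variables `σ`. -/
inductive Formula (F : Type*) (σ : Type*) : Type _
  | var : σ → Formula F σ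
  | const : F → Formula F σ
  | add : Formula F σ → Formula F σ → Formula F σ
  | mul : Formula F σ → Formula F σ → Formula F σ

section

variable {F : Type*} [Field F] {σ : Type*}

/-- The noncommutative polynomial computed by a formula. -/
def Formula.eval : Formula F σ → FreeAlgebra F σ
  | .var i => FreeAlgebra.ι F i
  | .const a => algebraMap F (FreeAlgebra F σ) a
  | .add f g => f.eval + g.eval
  | .mul f g => f.eval * g.eval

/-- `⟦p⟧`: the noncommutative polynomial obtained from `p` by writing every monomial as a product of
its variables in nondecreasing order. -/
def bracket (ord : LinearOrder σ) (p : MvPolynomial σ F) : FreeAlgebra F σ :=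
  ∑ m ∈ p.support,
    p.coeff m • ((((Finsupp.toMultiset m).sort (fun i j => ord.le i j)).map (FreeAlgebra.ι F)).prod)

/-- Ordered noncommutative polynomials. -/
def IsOrderedPoly (ord : LinearOrder σ) (h : FreeAlgebra F σ) : Prop :=
  ∃ p : MvPolynomial σ F, bracket ord p = h

/-- Ordered formulas: every subformula computes an ordered polynomial. -/
def Formula.IsOrdered (ord : LinearOrder σ) : Formula F σ → Prop
  | .var i => IsOrderedPoly ord (Formula.var i : Formula F σ).eval
  | .const a => IsOrderedPoly ord (Formula.const a : Formula F σ).eval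
  | .add f g => IsOrderedPoly ord (Formula.add f g).eval ∧ f.IsOrdered ord ∧ g.IsOrdered ord
  | .mul f g => IsOrderedPoly ord (Formula.mul f g).eval ∧ f.IsOrdered ord ∧ g.IsOrdered ord

/-- `f` is an ordered formula that computes the commutative polynomial `p`. -/
def Formula.Computes (ord : LinearOrder σ) (f : Formula F σ) (p : MvPolynomial σ F) : Prop :=
  f.IsOrdered ord ∧ f.eval = bracket ord p

/-! ## Polynomial calculus and polynomial calculus over ordered formulas -/

/-- `p` may be written as a line of a PC proof from `Q` after the lines `prev`. -/
def IsPCLine (Q prev : List (MvPolynomial σ F)) (p : MvPolynomial σ F) : Prop :=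
  p ∈ Q ∨
  (∃ i : σ, p = MvPolynomial.X i * (1 - MvPolynomial.X i)) ∨
  (∃ q ∈ prev, ∃ r : σ, p = MvPolynomial.X r * q) ∨
  (∃ q ∈ prev, ∃ q' ∈ prev, ∃ a b : F, p = MvPolynomial.C a * q + MvPolynomial.C b * q')

/-- `ps` is a PC proof of `g` from `Q`. -/
def IsPCProof (Q : List (MvPolynomial σ F)) (g : MvPolynomial σ F)
    (ps : List (MvPolynomial σ F)) : Prop :=
  ps.getLast? = some g ∧ ∀ (i : ℕ) (hi : i < ps.length), IsPCLine Q (ps.take i) ps[i]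

/-- `π` is an OFPC proof of `g` from `Q`. -/
def IsOFPCProof (ord : LinearOrder σ) (Q : List (MvPolynomial σ F)) (g : MvPolynomial σ F)
    (π : List (Formula F σ)) : Prop :=
  ∃ ps, IsPCProof Q g ps ∧ List.Forall₂ (Formula.Computes ord) π ps

/-- `π` is an OFPC refutation of `Q`. -/
def IsOFPCRefutation (ord : LinearOrder σ) (Q : List (MvPolynomial σ F))
    (π : List (Formula F σ)) : Prop :=
  IsOFPCProof ord Q 1 π

/-- The equations `q = 0`, `q ∈ Q`, have a common solution with values in `{0, 1}`. -/
def HasZeroOneSolution (Q : List (MvPolynomial σ F)) : Prop :=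
  ∃ a : σ → F, (∀ i, a i = 0 ∨ a i = 1) ∧ ∀ q ∈ Q, MvPolynomial.eval a q = 0

/-! ## Encodings -/

/-- Code of a formula, given codes of the field elements and of the variables. -/
def Formula.code (enc : F → Datum) (v : σ → Datum) : Formula F σ → Datum
  | .var i => .node (Datum.ofNat 0) (v i)
  | .const a => .node (Datum.ofNat 1) (enc a)
  | .add f g => .node (Datum.ofNat 2) (.node (f.code enc v) (g.code enc v))
  | .mul f g => .node (Datum.ofNat 3) (.node (f.code enc v) (g.code enc v))

def codeFormulas (enc : F → Datum) (v : σ → Datum) (fs : List (Formula F σ)) : Datum :=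
  Datum.ofList (fs.map (Formula.code enc v))

/-- Code of the variable `i` among finitely many variables. -/
def codeVar {n : ℕ} (i : Fin n) : Datum := Datum.ofNat i

/-- A linear order on `n` variables is given to an algorithm as its `n × n` comparison table. -/
def codeOrder {n : ℕ} (ord : LinearOrder (Fin n)) : Datum :=
  Datum.ofList (List.ofFn fun i : Fin n => Datum.ofList (List.ofFn fun j : Fin n =>
    Datum.ofBool (@decide (ord.le i j) (ord.toDecidableLE i j))))

/-! ## The languages -/

/-- All codes of `(((⪯, (Q₁, …, Qₘ)), g), π)`, for a linear order `⪯` on some `n` variables and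
sequences of ordered formulas `Q₁, …, Qₘ`, `g`, `π` in these variables, such that `π` is an OFPC proof
of the polynomial computed by `g` from the polynomials computed by `Q₁, …, Qₘ`. -/
def ofpcProofs (enc : F → Datum) : Set Datum :=
  {v | ∃ (n : ℕ) (ord : LinearOrder (Fin n)) (Qs : List (Formula F (Fin n)))
      (g : Formula F (Fin n)) (π : List (Formula F (Fin n)))
      (qs : List (MvPolynomial (Fin n) F)) (h : MvPolynomial (Fin n) F),
      v = .node (.node (.node (codeOrder ord) (codeFormulas enc codeVar Qs)) (g.code enc codeVar))
        (codeFormulas enc codeVar π) ∧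
      List.Forall₂ (Formula.Computes ord) Qs qs ∧ g.Computes ord h ∧ IsOFPCProof ord qs h π}

/-- All codes of `((⪯, (Q₁, …, Qₘ)), π)` such that `π` is an OFPC refutation, with respect to `⪯`, of
the polynomials computed by the ordered formulas `Q₁, …, Qₘ`. -/
def ofpcRefutations (enc : F → Datum) : Set Datum :=
  {v | ∃ (n : ℕ) (ord : LinearOrder (Fin n)) (Qs π : List (Formula F (Fin n)))
      (qs : List (MvPolynomial (Fin n) F)),
      v = .node (.node (codeOrder ord) (codeFormulas enc codeVar Qs)) (codeFormulas enc codeVar π) ∧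
      List.Forall₂ (Formula.Computes ord) Qs qs ∧ IsOFPCRefutation ord qs π}

/-- All codes of `(⪯, (Q₁, …, Qₘ))` such that the polynomials computed by the ordered formulas
`Q₁, …, Qₘ` have no common `0, 1` root. -/
def unsolvableSystems (enc : F → Datum) : Set Datum :=
  {v | ∃ (n : ℕ) (ord : LinearOrder (Fin n)) (Qs : List (Formula F (Fin n)))
      (qs : List (MvPolynomial (Fin n) F)),
      v = .node (codeOrder ord) (codeFormulas enc codeVar Qs) ∧
      List.Forall₂ (Formula.Computes ord) Qs qs ∧ ¬ HasZeroOneSolution qs}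

end

/-- A linear order on the countable set of variables `x₀, x₁, …` whose comparison relation is
computable in polynomial time. -/
def IsPolyTimeOrder (ord : LinearOrder ℕ) : Prop :=
  DecidableInPolyTime {v | ∃ i j : ℕ, v = .node (Datum.ofNat i) (Datum.ofNat j) ∧ ord.le i j}

/-! ## Propositional formulas and their polynomial translations -/

/-- A literal: `(i, true)` is `xᵢ` and `(i, false)` is `¬ xᵢ`. -/
abbrev Literal := ℕ × Bool

abbrev Clause := List Literal

abbrev CNF := List Clause

def CNF.Satisfiable (φ : CNF) : Prop :=
  ∃ a : ℕ → Bool, ∀ c ∈ φ, ∃ l ∈ c, a l.1 = l.2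

def CNF.code (φ : CNF) : Datum :=
  Datum.ofList (φ.map fun c => Datum.ofList (c.map fun l =>
    Datum.node (Datum.ofNat l.1) (Datum.ofBool l.2)))

/-- The polynomial translation of a clause: the product of the `xᵢ - 1` for its positive literals `xᵢ`
and of the `xᵢ` for its negative literals `¬ xᵢ`. -/
def Clause.poly (F : Type*) [Field F] (c : Clause) : MvPolynomial ℕ F :=
  (c.map fun l => MvPolynomial.X l.1 - (if l.2 then 1 else 0)).prod

/-- The polynomial translation of a CNF formula. -/
def CNF.polys (F : Type*) [Field F] (φ : CNF) : List (MvPolynomial ℕ F) :=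
  φ.map (Clause.poly F)

/-- Propositional formulas in the De Morgan basis. -/
inductive PropForm : Type
  | var : ℕ → PropForm
  | tru : PropForm
  | fls : PropForm
  | neg : PropForm → PropForm
  | and : PropForm → PropForm → PropForm
  | or : PropForm → PropForm → PropForm

namespace PropForm

def val (a : ℕ → Bool) : PropForm → Bool
  | var i => a i
  | tru => true
  | fls => false
  | neg φ => !(φ.val a)
  | and φ ψ => φ.val a && ψ.val a
  | or φ ψ => φ.val a || ψ.val a

def Satisfiable (φ : PropForm) : Prop := ∃ a : ℕ → Bool, φ.val a = true

def code : PropForm → Datum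
  | var i => .node (Datum.ofNat 0) (Datum.ofNat i)
  | tru => .node (Datum.ofNat 1) .nil
  | fls => .node (Datum.ofNat 2) .nil
  | neg φ => .node (Datum.ofNat 3) φ.code
  | and φ ψ => .node (Datum.ofNat 4) (.node φ.code ψ.code)
  | or φ ψ => .node (Datum.ofNat 5) (.node φ.code ψ.code)

/-- A strict upper bound of the variables that occur in the formula. -/
def bound : PropForm → ℕ
  | var i => i + 1
  | tru => 0
  | fls => 0
  | neg φ => φ.bound
  | and φ ψ => max φ.bound ψ.bound
  | or φ ψ => max φ.bound ψ.bound

/-- One new variable for each node of the formula other than variables. `φ.gates k` uses the new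
variables `k, k + 1, …` and returns the variable for the value of `φ`, the first unused variable, and
clauses saying that the new variables have the right values. -/
def gates : PropForm → ℕ → ℕ × ℕ × CNF
  | var i, k => (i, k, [])
  | tru, k => (k, k + 1, [[(k, true)]])
  | fls, k => (k, k + 1, [[(k, false)]])
  | neg φ, k =>
      let (u, y, C) := φ.gates k
      (y, y + 1, [(y, true), (u, true)] :: [(y, false), (u, false)] :: C)
  | and φ ψ, k =>
      let (u, l, C) := φ.gates k
      let (w, y, D) := ψ.gates l
      (y, y + 1, [(y, false), (u, true)] :: [(y, false), (w, true)] ::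
        [(y, true), (u, false), (w, false)] :: (C ++ D))
  | or φ ψ, k =>
      let (u, l, C) := φ.gates k
      let (w, y, D) := ψ.gates l
      (y, y + 1, [(y, true), (u, false)] :: [(y, true), (w, false)] ::
        [(y, false), (u, true), (w, true)] :: (C ++ D))

/-- The standard translation of a propositional formula into a CNF formula with new variables. -/
def toCNF (φ : PropForm) : CNF :=
  [((φ.gates φ.bound).1, true)] :: (φ.gates φ.bound).2.2

end PropForm

/-- Codes of unsatisfiable CNF formulas. -/
def unsatCNF : Set Datum := {v | ∃ φ : CNF, v = φ.code ∧ ¬ φ.Satisfiable}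

/-- Codes of unsatisfiable propositional formulas. -/
def unsatProp : Set Datum := {v | ∃ φ : PropForm, v = φ.code ∧ ¬ φ.Satisfiable}

/-- All pairs of a CNF formula and an OFPC refutation of its polynomial translation. -/
def cnfRefutations {F : Type*} [Field F] (enc : F → Datum) (ord : LinearOrder ℕ) : Set Datum :=
  {v | ∃ (φ : CNF) (π : List (Formula F ℕ)),
      v = .node φ.code (codeFormulas enc Datum.ofNat π) ∧ IsOFPCRefutation ord (φ.polys F) π}

/-- All pairs of a propositional formula and an OFPC refutation of its polynomial translation. -/
def propRefutations {F : Type*} [Field F] (enc : F → Datum) (ord : LinearOrder ℕ) : Set Datum :=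
  {v | ∃ (φ : PropForm) (π : List (Formula F ℕ)),
      v = .node φ.code (codeFormulas enc Datum.ofNat π) ∧ IsOFPCRefutation ord (φ.toCNF.polys F) π}

end OFPC

end

universe u v w

noncomputable section
namespace OFPC

/-! ## Polynomial-time functions between encoded types -/

/-! Soundness is evaluation of the lines at a common root. For completeness, the derivable
polynomials form an ideal that contains the `Q` and all `x (1 - x)`. If this ideal were proper, it
would lie in a maximal ideal `M`. Since `M` is prime, each variable is congruent to `0` or to `1`
modulo `M`, so the quotient map is evaluation at a point with values in `{0, 1}` and that point is a
common root (`derivable_one_of_not_hasZeroOneSolution`). Every polynomial has an ordered formula,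
namely a sum of sorted monomials, so a PC refutation can always be written as an OFPC refutation.

For verification, everything is reduced to linear relations between noncommutative polynomials. If
`f` and `g` are ordered, then `f * g` is ordered exactly when every variable of `f` is below every
variable of `g`: an unsorted product word has only one factorization into words of `f` and of `g`,
so it cannot cancel (`sortedSupport_mul_iff`). A variable `x` occurs in an ordered polynomial iff
deleting the first `x` from the words that contain `x` gives something nonzero, and there is a
formula of quadratic size for that operation. The same operation tests the rule `x * p`: one divides
by `x` instead of multiplying (`eq_X_mul_iff`). The rule for linear combinations asks whether `f`
lies in the span of two formulas.

Such questions are decided by an identity test in the style of Raz and Shpilka. A formula is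
compiled to a straight-line program whose instructions are linear combinations of registers and left
multiplications by a variable. The vector of the coefficients of `x :: w` in all registers is then a
linear function of the vector for `w`. Hence the span of all these vectors is the least subspace
that contains the vector of the empty word and is closed under one linear map for each variable. Its
dimension is at most the length of the program, and a search with row reduction finds a basis
(`search_spec`). Then `f` is a combination of `g` and `h` iff `(1, 0, 0)` is not in the span of the
triples of coefficients (`inSpan_iff`).

Over an infinite field the sizes of the field elements have to be controlled. The vectors found by
the search belong to short words, so their entries are values of integer polynomials of small degree
and small coefficients at the constants of the formulas (`Rep`). The entries of the reduced basis
are quotients of determinants of such vectors by Cramer's rule (`Echelon.exists_rep`). The bound on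
codes of polynomial values then applies to every intermediate result, however it was computed.

The running times come from a calculus of polynomial-time functions on encoded types, `PolyTime`.
Its essential rules are bounded loops and recursion on trees, each with a polynomial bound on the
intermediate values as a side condition. For CNF formulas each clause is sorted before it is
translated. The clauses for the nodes of a propositional formula are computed bottom-up with
relative variable numbers. -/

theorem _root_.Polynomial.eval_nat_mono (p : Polynomial ℕ) {a b : ℕ} (h : a ≤ b) :
    p.eval a ≤ p.eval b := by
  rw [Polynomial.eval_eq_sum, Polynomial.eval_eq_sum]
  exact Finset.sum_le_sum fun i _ => Nat.mul_le_mul_left _ (Nat.pow_le_pow_left h i)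

theorem Datum.size_pos (d : Datum) : 0 < d.size := by cases d <;> simp [Datum.size]

/-- Every step is charged at least the size of what it produces. Hence time bounds are also bounds
on the size of outputs, which is what makes polynomial bounds compose. -/
theorem Eval.size_le {c : Prog} {v w : Datum} {t : ℕ} (h : Eval c v w t) : w.size ≤ t := by
  induction h with
  | id v => exact le_rfl
  | const d v => omega
  | fst v => cases v with
    | nil => exact le_rfl
    | node a b => simp only [Datum.fst, Datum.size]; omega
  | snd v => cases v with
    | nil => exact le_rfl
    | node a b => simp only [Datum.snd, Datum.size]; omega
  | @pair f g v a b s t _ _ h1 h2 => have := v.size_pos; simp only [Datum.size]; omega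
  | loop_done _ => exact le_rfl
  | _ => omega

/-- A type whose elements are encoded by data. -/
class Enc (α : Type u) where
  code : α → Datum


def esize {α : Type u} [Enc α] (a : α) : ℕ := (Enc.code a).size

theorem esize_pos {α : Type u} [Enc α] (a : α) : 0 < esize a := Datum.size_pos _

instance : Enc Datum := ⟨fun d => d⟩
instance : Enc Unit := ⟨fun _ => .nil⟩
instance : Enc Bool := ⟨Datum.ofBool⟩
instance : Enc ℕ := ⟨Datum.ofNat⟩
instance {α : Type u} {β : Type v} [Enc α] [Enc β] : Enc (α × β) :=
  ⟨fun p => .node (Enc.code p.1) (Enc.code p.2)⟩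
instance {α : Type u} [Enc α] : Enc (List α) := ⟨fun l => Datum.ofList (l.map Enc.code)⟩
-- Elements of a subtype keep their codes, so a partial function is a function on a subtype. Case
-- distinctions use this to give each branch only the arguments it is responsible for.
instance {α : Type u} [Enc α] (p : α → Prop) : Enc (Subtype p) := ⟨fun x => Enc.code x.1⟩

@[simp] theorem esize_prod {α : Type u} {β : Type v} [Enc α] [Enc β] (a : α) (b : β) :
    esize (a, b) = esize a + esize b + 1 := rfl
@[simp] theorem esize_nil {α : Type u} [Enc α] : esize ([] : List α) = 1 := rfl
@[simp] theorem esize_cons {α : Type u} [Enc α] (a : α) (l : List α) :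
    esize (a :: l) = esize a + esize l + 1 := rfl
@[simp] theorem esize_nat (n : ℕ) : esize n = 2 * n + 1 := by
  induction n with
  | zero => rfl
  | succ n ih => change 1 + esize n + 1 = _; omega
@[simp] theorem esize_datum (d : Datum) : esize d = d.size := rfl

theorem esize_list {α : Type u} [Enc α] (l : List α) :
    esize l = (l.map esize).sum + l.length + 1 := by
  induction l with
  | nil => rfl
  | cons a l ih => simp [ih]; omega

theorem esize_append {α : Type u} [Enc α] (l l' : List α) :
    esize (l ++ l') + 1 = esize l + esize l' := by simp [esize_list]; omega

theorem esize_reverse {α : Type u} [Enc α] (l : List α) : esize l.reverse = esize l := by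
  simp [esize_list]

theorem length_lt_esize {α : Type u} [Enc α] (l : List α) : l.length < esize l := by
  rw [esize_list]; omega

theorem esize_lt_of_mem {α : Type u} [Enc α] {l : List α} {a : α} (h : a ∈ l) :
    esize a < esize l := by
  induction l with
  | nil => simp at h
  | cons b l ih =>
    rcases List.mem_cons.1 h with rfl | h
    · simp only [esize_cons]; omega
    · have := ih h; simp only [esize_cons]; omega

theorem esize_list_le {α : Type u} [Enc α] {l : List α} {m k : ℕ} (hl : l.length ≤ k)
    (h : ∀ a ∈ l, esize a ≤ m) : esize l ≤ k * (m + 1) + 1 := by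
  have : esize l ≤ l.length * (m + 1) + 1 := by
    clear hl
    induction l with
    | nil => simp
    | cons a l ih =>
      have h1 := h a (by simp)
      have h2 := ih fun b hb => h b (by simp [hb])
      simp only [esize_cons, List.length_cons]
      nlinarith
  nlinarith [Nat.mul_le_mul_right (m + 1) hl]

theorem esize_sublist {α : Type u} [Enc α] {l l' : List α} (h : l.Sublist l') :
    esize l ≤ esize l' := by
  induction h with
  | slnil => exact le_rfl
  | cons a _ ih => simp only [esize_cons]; omega
  | cons_cons a _ ih => simp only [esize_cons]; omega

@[simp] theorem esize_bool_le (b : Bool) : esize b ≤ 3 := by cases b <;> decide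

/-- `f` can be computed in polynomial time on the codes. -/
@[fun_prop]
def PolyTime {α : Type u} {β : Type v} [Enc α] [Enc β] (f : α → β) : Prop :=
  ComputableInPolyTime (Enc.code : α → Datum) (fun a => Enc.code (f a))

/-- `g` is bounded by a polynomial in the size of the code of its argument. -/
def PolyBdd {α : Type u} [Enc α] (g : α → ℕ) : Prop :=
  ∃ p : Polynomial ℕ, ∀ a, g a ≤ p.eval (esize a)

section
variable {α : Type u} {β : Type v} {γ : Type w} [Enc α] [Enc β] [Enc γ]

namespace PolyBdd

theorem mono {f g : α → ℕ} (hg : PolyBdd g) (h : ∀ a, f a ≤ g a) : PolyBdd f :=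
  let ⟨p, hp⟩ := hg
  ⟨p, fun a => (h a).trans (hp a)⟩

theorem const (c : ℕ) : PolyBdd fun _ : α => c := ⟨Polynomial.C c, fun _ => by simp⟩

theorem id : PolyBdd fun a : α => esize a := ⟨Polynomial.X, fun _ => by simp⟩

theorem add {f g : α → ℕ} (hf : PolyBdd f) (hg : PolyBdd g) : PolyBdd fun a => f a + g a :=
  let ⟨p, hp⟩ := hf
  let ⟨q, hq⟩ := hg
  ⟨p + q, fun a => by simpa using Nat.add_le_add (hp a) (hq a)⟩

theorem mul {f g : α → ℕ} (hf : PolyBdd f) (hg : PolyBdd g) : PolyBdd fun a => f a * g a :=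
  let ⟨p, hp⟩ := hf
  let ⟨q, hq⟩ := hg
  ⟨p * q, fun a => by simpa using Nat.mul_le_mul (hp a) (hq a)⟩

theorem eval (q : Polynomial ℕ) {f : α → ℕ} (hf : PolyBdd f) : PolyBdd fun a => q.eval (f a) :=
  let ⟨p, hp⟩ := hf
  ⟨q.comp p, fun a => by simpa using q.eval_nat_mono (hp a)⟩

end PolyBdd

namespace PolyTime

theorem iff_exists {f : α → β} : PolyTime f ↔ ∃ (c : Prog) (p : Polynomial ℕ), ∀ a,
    ∃ t ≤ p.eval (esize a), Eval c (Enc.code a) (Enc.code (f a)) t := Iff.rfl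

theorem size {f : α → β} (hf : PolyTime f) : PolyBdd fun a => esize (f a) :=
  let ⟨_, p, h⟩ := hf
  ⟨p, fun a => let ⟨_, ht, he⟩ := h a; he.size_le.trans ht⟩

/-- The running time depends only on the induced map on codes. Retyping arguments or results without
changing their codes is free, even when the retyping `i` is not itself computable. -/
theorem transport {α' : Type*} {β' : Type*} [Enc α'] [Enc β'] {f : α → β} (hf : PolyTime f)
    (i : α' → α) (hi : ∀ a, Enc.code (i a) = Enc.code a) {f' : α' → β'}
    (h : ∀ a, Enc.code (f (i a)) = Enc.code (f' a)) : PolyTime f' := by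
  obtain ⟨c, p, hc⟩ := iff_exists.1 hf
  refine iff_exists.2 ⟨c, p, fun a => ?_⟩
  have := hc (i a)
  rwa [esize, hi, h] at this

theorem of_code_eq {β' : Type*} [Enc β'] {f : α → β} (hf : PolyTime f) {f' : α → β'}
    (h : ∀ a, Enc.code (f a) = Enc.code (f' a)) : PolyTime f' :=
  hf.transport (fun a => a) (fun _ => rfl) h

@[fun_prop]
protected theorem id : PolyTime fun a : α => a :=
  ⟨.id, Polynomial.X, fun _ => ⟨_, by simp, Eval.id _⟩⟩

@[fun_prop]
theorem const (b : β) : PolyTime fun _ : α => b :=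
  ⟨.const (Enc.code b), Polynomial.X + Polynomial.C (Enc.code b).size,
    fun _ => ⟨_, by simp, Eval.const _ _⟩⟩

@[fun_prop]
theorem comp {g : β → γ} {f : α → β} (hg : PolyTime g) (hf : PolyTime f) :
    PolyTime fun a => g (f a) := by
  obtain ⟨c, p, hc⟩ := iff_exists.1 hf
  obtain ⟨d, q, hd⟩ := iff_exists.1 hg
  refine iff_exists.2 ⟨.comp d c, Polynomial.X + p + q.comp p, fun a => ?_⟩
  obtain ⟨s, hs, es⟩ := hc a
  obtain ⟨t, ht, et⟩ := hd (f a)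
  refine ⟨esize a + s + t, ?_, Eval.comp es et⟩
  have : q.eval (esize (f a)) ≤ q.eval (p.eval (esize a)) := q.eval_nat_mono (es.size_le.trans hs)
  simp only [Polynomial.eval_add, Polynomial.eval_X, Polynomial.eval_comp]
  omega

@[fun_prop]
theorem prodMk {f : α → β} {g : α → γ} (hf : PolyTime f) (hg : PolyTime g) :
    PolyTime fun a => (f a, g a) := by
  obtain ⟨c, p, hc⟩ := iff_exists.1 hf
  obtain ⟨d, q, hd⟩ := iff_exists.1 hg
  refine iff_exists.2 ⟨.pair c d, Polynomial.X + p + q, fun a => ?_⟩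
  obtain ⟨s, hs, es⟩ := hc a
  obtain ⟨t, ht, et⟩ := hd a
  refine ⟨esize a + s + t, ?_, Eval.pair es et⟩
  simp only [Polynomial.eval_add, Polynomial.eval_X]
  omega

theorem datum_fst : PolyTime Datum.fst := ⟨.fst, Polynomial.X, fun _ => ⟨_, by simp, Eval.fst _⟩⟩
theorem datum_snd : PolyTime Datum.snd := ⟨.snd, Polynomial.X, fun _ => ⟨_, by simp, Eval.snd _⟩⟩

theorem code : PolyTime (Enc.code : α → Datum) := PolyTime.id.of_code_eq fun _ => rfl

@[fun_prop]
theorem fst {f : α → β × γ} (hf : PolyTime f) : PolyTime fun a => (f a).1 :=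
  (datum_fst.comp (code.comp hf)).of_code_eq fun _ => rfl

@[fun_prop]
theorem snd {f : α → β × γ} (hf : PolyTime f) : PolyTime fun a => (f a).2 :=
  (datum_snd.comp (code.comp hf)).of_code_eq fun _ => rfl

/-- Case distinction. -/
theorem split {c : α → Bool} (hc : PolyTime c) {h : α → β}
    (ht : PolyTime fun x : {a // c a = true} => h x.1)
    (hf : PolyTime fun x : {a // c a = false} => h x.1) : PolyTime h := by
  obtain ⟨c', p, hc⟩ := iff_exists.1 hc
  obtain ⟨d, q, hd⟩ := iff_exists.1 ht
  obtain ⟨e, r, he⟩ := iff_exists.1 hf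
  refine iff_exists.2 ⟨.ite c' d e, Polynomial.X + p + q + r, fun a => ?_⟩
  obtain ⟨s, hs, es⟩ := hc a
  simp only [Polynomial.eval_add, Polynomial.eval_X]
  cases hca : c a with
  | true =>
    obtain ⟨t, ht, et⟩ := hd ⟨a, hca⟩
    rw [hca] at es
    change t ≤ q.eval (esize a) at ht
    refine ⟨esize a + s + t, by omega, Eval.ite_true es ?_ et⟩
    simp [Enc.code, Datum.ofBool]
  | false =>
    obtain ⟨t, ht, et⟩ := he ⟨a, hca⟩
    rw [hca] at es
    change t ≤ r.eval (esize a) at ht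
    exact ⟨esize a + s + t, by omega, Eval.ite_false es et⟩

theorem restrict {f : α → β} (hf : PolyTime f) (p : α → Prop) :
    PolyTime fun x : Subtype p => f x.1 :=
  hf.transport (fun x => x.1) (fun _ => rfl) fun _ => rfl

@[fun_prop]
theorem cond {c : α → Bool} {f g : α → β} (hc : PolyTime c) (hf : PolyTime f) (hg : PolyTime g) :
    PolyTime fun a => bif c a then f a else g a :=
  split hc ((hf.restrict _).of_code_eq fun x => by rw [x.2]; rfl)
    ((hg.restrict _).of_code_eq fun x => by rw [x.2]; rfl)

@[fun_prop]
theorem and {f g : α → Bool} (hf : PolyTime f) (hg : PolyTime g) : PolyTime fun a => f a && g a :=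
  (cond hf hg (const false)).of_code_eq fun a => by cases f a <;> rfl

@[fun_prop]
theorem or {f g : α → Bool} (hf : PolyTime f) (hg : PolyTime g) : PolyTime fun a => f a || g a :=
  (cond hf (const true) hg).of_code_eq fun a => by cases f a <;> rfl

@[fun_prop]
theorem not {f : α → Bool} (hf : PolyTime f) : PolyTime fun a => !f a :=
  (cond hf (const false) (const true)).of_code_eq fun a => by cases f a <;> rfl

/-- Testing whether the code of `a` is `nil`. -/
theorem isNil : PolyTime fun d : Datum => match d with | .nil => true | .node _ _ => false := by
  refine ⟨.ite .id (.const (Datum.ofBool false)) (.const (Datum.ofBool true)),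
    3 * Polynomial.X + 3, fun d => ?_⟩
  cases d with
  | nil => exact ⟨_, by simp [Datum.size, Datum.ofBool, Enc.code], Eval.ite_false (Eval.id _) (Eval.const _ _)⟩
  | node a b =>
    refine ⟨_, ?_, Eval.ite_true (Eval.id _) (by simp [Enc.code]) (Eval.const _ _)⟩
    simp [Datum.size, Datum.ofBool, Enc.code]
    omega

@[fun_prop]
theorem isEmpty {l : α → List β} (hl : PolyTime l) : PolyTime fun a => (l a).isEmpty :=
  (isNil.comp (code.comp hl)).of_code_eq fun a => by cases l a <;> rfl

@[fun_prop]
theorem cons {f : α → β} {l : α → List β} (hf : PolyTime f) (hl : PolyTime l) :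
    PolyTime fun a => f a :: l a :=
  (prodMk hf hl).of_code_eq fun _ => rfl

@[fun_prop]
theorem tail {l : α → List β} (hl : PolyTime l) : PolyTime fun a => (l a).tail :=
  (datum_snd.comp (code.comp hl)).of_code_eq fun a => by cases l a <;> rfl

/-- The function `k` is specified by its equations and not by a match, so that the rule applies to
any definition by cases. The nonempty case runs on a subtype, where the head exists and no default
element of `β` is needed. -/
theorem listCases {l : α → List β} (hl : PolyTime l) {k g : α → γ} {h : α → β → List β → γ}
    (hg : PolyTime g) (hh : PolyTime fun p : α × β × List β => h p.1 p.2.1 p.2.2)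
    (h1 : ∀ a, l a = [] → k a = g a) (h2 : ∀ a x t, l a = x :: t → k a = h a x t) :
    PolyTime k := by
  refine split (isEmpty hl) ?_ ?_
  · exact (hg.restrict _).of_code_eq fun x => by rw [h1 _ (by simpa using x.2)]
  · have e : PolyTime fun x : {a // (l a).isEmpty = false} =>
        (x.1, (l x.1).head (by simpa using x.2), (l x.1).tail) := by
      refine prodMk (PolyTime.id.restrict _) (prodMk ?_ ((tail hl).restrict _))
      refine ((datum_fst.comp (code.comp hl)).restrict _).of_code_eq fun x => ?_
      have key : ∀ (L : List β) (h : L ≠ []), Datum.fst (Enc.code L) = Enc.code (L.head h) := by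
        intro L h
        cases L with
        | nil => exact absurd rfl h
        | cons y t => rfl
      exact key _ _
    refine (hh.comp e).of_code_eq fun x => ?_
    obtain ⟨a, ha⟩ := x
    rw [h2 a ((l a).head (by simpa using ha)) (l a).tail (by simp)]

@[fun_prop]
theorem headD {l : α → List β} {d : α → β} (hl : PolyTime l) (hd : PolyTime d) :
    PolyTime fun a => (l a).headD (d a) :=
  listCases hl (h := fun _ x _ => x) hd (by fun_prop) (fun a h => by simp [h])
    (fun a x t h => by simp [h])

end PolyTime
end

/-! ## Loops -/

section
variable {α : Type u} {β : Type v} {γ : Type w} [Enc α] [Enc β] [Enc γ]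
variable {σ : Type*} [Enc σ]

/-- The machine can only test the first component of its datum, so the state carries the truth value
of the loop condition there. If all states on the way have size at most `M`, a run of `n` rounds
performs `n + 1` tests and `n` executions of the body. -/
theorem loop_eval {body : Bool × σ → Bool × σ} {c : Prog} {p : Polynomial ℕ}
    (hc : ∀ x, ∃ t ≤ p.eval (esize x), Eval c (Enc.code x) (Enc.code (body x)) t) (M : ℕ) :
    ∀ (n : ℕ) (x : Bool × σ), (∀ k ≤ n, esize (body^[k] x) ≤ M) →
      (∀ k < n, (body^[k] x).1 = true) → (body^[n] x).1 = false →
      ∃ t ≤ (n + 1) * (M + p.eval M), Eval (.loop c) (Enc.code x) (Enc.code (body^[n] x)) t := by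
  intro n
  induction n with
  | zero =>
    intro x hM _ h0
    have hs : esize x ≤ M := hM 0 le_rfl
    refine ⟨esize x, by omega, Eval.loop_done ?_⟩
    change Enc.code x.1 = _
    rw [show x.1 = false from h0]; rfl
  | succ n ih =>
    intro x hM h1 h0
    have hs : esize x ≤ M := hM 0 (by omega)
    obtain ⟨s, hs', es⟩ := hc x
    obtain ⟨t, ht, et⟩ := ih (body x) (fun k hk => by simpa using hM (k + 1) (by omega))
      (fun k hk => by simpa using h1 (k + 1) (by omega)) (by simpa using h0)
    refine ⟨esize x + s + t, ?_, Eval.loop_step ?_ es et⟩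
    · have := p.eval_nat_mono hs
      rw [show n + 1 + 1 = (n + 1) + 1 from rfl, Nat.succ_mul]
      omega
    · change Enc.code x.1 ≠ _
      rw [show x.1 = true from h1 0 (by omega)]
      simp [Enc.code, Datum.ofBool]

namespace PolyTime

/-- Iteration of `step` until `c` fails. -/
theorem iterate_while {init : α → σ} (hi : PolyTime init) {step : σ → σ} (hs : PolyTime step)
    {c : σ → Bool} (hc : PolyTime c) (hstep : ∀ s, c s = false → step s = s) {N : α → ℕ}
    (hN : PolyBdd N) (hfin : ∀ a, c (step^[N a] (init a)) = false)
    {B : α → ℕ} (hB : PolyBdd B) (hsize : ∀ a, ∀ k ≤ N a, esize (step^[k] (init a)) ≤ B a) :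
    PolyTime fun a => step^[N a] (init a) := by
  -- The flag for the next test is computed together with the next state.
  set body : Bool × σ → Bool × σ := fun x => (c (step x.2), step x.2) with hbody
  have hb : PolyTime body := by fun_prop
  obtain ⟨cb, p, hcb⟩ := iff_exists.1 hb
  have hini : PolyTime fun a => (c (init a), init a) := by fun_prop
  obtain ⟨ci, r, hci⟩ := iff_exists.1 hini
  have hsnd : PolyTime fun x : Bool × σ => x.2 := by fun_prop
  obtain ⟨cs, q, hcs⟩ := iff_exists.1 hsnd
  have hit : ∀ (k : ℕ) (s : σ), body^[k] (c s, s) = (c (step^[k] s), step^[k] s) := by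
    intro k
    induction k with
    | zero => intro s; rfl
    | succ k ih => intro s; rw [Function.iterate_succ_apply, hbody, ← hbody, ih]; rfl
  have hstab : ∀ (k : ℕ) (s : σ), c s = false → step^[k] s = s := by
    intro k
    induction k with
    | zero => intro s _; rfl
    | succ k ih => intro s h; rw [Function.iterate_succ_apply, hstep s h, ih s h]
  obtain ⟨pN, hpN⟩ := hN
  obtain ⟨pB, hpB⟩ := hB
  classical
  refine iff_exists.2 ⟨.comp cs (.comp (.loop cb) ci), Polynomial.X + (Polynomial.X + r +
    (pN + 1) * ((pB + 4) + p.comp (pB + 4))) + q.comp (pB + 4), fun a => ?_⟩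
  have hex : ∃ n, c (step^[n] (init a)) = false := ⟨N a, hfin a⟩
  -- The machine stops at the first `n` at which the condition fails. From then on `step` is the
  -- identity, so the state equals that after `N a` steps, and `N` itself never has to be computed.
  set n := Nat.find hex with hn
  have hnN : n ≤ N a := Nat.find_min' hex (hfin a)
  have hres : step^[N a] (init a) = step^[n] (init a) := by
    rw [show N a = (N a - n) + n by omega, Function.iterate_add_apply]
    exact hstab _ _ (Nat.find_spec hex)
  -- The constant `4` accounts for the flag, of size at most `3`, and for the node of the pair.
  have hM : ∀ k ≤ n, esize (body^[k] (c (init a), init a)) ≤ pB.eval (esize a) + 4 := by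
    intro k hk
    rw [hit, esize_prod]
    have := hsize a k (by omega)
    have := hpB a
    have := esize_bool_le (c (step^[k] (init a)))
    omega
  obtain ⟨t1, ht1, e1⟩ := hci a
  obtain ⟨t2, ht2, e2⟩ := loop_eval hcb (pB.eval (esize a) + 4) n (c (init a), init a) hM
    (fun k hk => by rw [hit]; simpa using Nat.find_min hex hk)
    (by rw [hit]; exact Nat.find_spec hex)
  obtain ⟨t3, ht3, e3⟩ := hcs (body^[n] (c (init a), init a))
  have h3 := ht3.trans (q.eval_nat_mono (hM n le_rfl))
  have h2 := ht2.trans (Nat.mul_le_mul_right _ (Nat.add_le_add_right (hnN.trans (hpN a)) 1))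
  refine ⟨esize a + (esize a + t1 + t2) + t3, ?_, ?_⟩
  · simp only [Polynomial.eval_add, Polynomial.eval_X, Polynomial.eval_mul, Polynomial.eval_comp,
      Polynomial.eval_one, Polynomial.eval_ofNat]
    omega
  · refine Eval.comp (Eval.comp e1 e2) ?_
    rw [hres]
    rw [hit] at e3 ⊢
    exact e3

/-- Folding a list. -/
theorem foldl {l : α → List β} (hl : PolyTime l) {i : α → γ} (hi : PolyTime i)
    {f : α → γ → β → γ} (hf : PolyTime fun p : α × γ × β => f p.1 p.2.1 p.2.2)
    {B : α → ℕ} (hB : PolyBdd B)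
    (hsize : ∀ a k, esize (((l a).take k).foldl (f a) (i a)) ≤ B a) :
    PolyTime fun a => (l a).foldl (f a) (i a) := by
  set step : α × List β × γ → α × List β × γ := fun s =>
    match s.2.1 with
    | [] => s
    | x :: t => (s.1, t, f s.1 s.2.2 x) with hstepdef
  have hs : PolyTime step := by
    refine listCases (l := fun s : α × List β × γ => s.2.1) (g := fun s => s)
      (h := fun s x t => (s.1, t, f s.1 s.2.2 x)) (by fun_prop) (by fun_prop) ?_ ?_ ?_
    · have := hf.comp (f := fun p : (α × List β × γ) × β × List β => (p.1.1, p.1.2.2, p.2.1))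
        (by fun_prop)
      fun_prop
    · rintro ⟨a, l, s⟩ h; simp only at h; subst h; rfl
    · rintro ⟨a, l, s⟩ x t h; simp only at h; subst h; rfl
  have hit : ∀ (k : ℕ) (a : α) (l : List β) (s : γ),
      step^[k] (a, l, s) = (a, l.drop k, (l.take k).foldl (f a) s) := by
    intro k
    induction k with
    | zero => intro a l s; simp
    | succ k ih =>
      intro a l s
      cases l with
      | nil => rw [Function.iterate_succ_apply, show step (a, [], s) = (a, [], s) from rfl, ih]; simp
      | cons x t => rw [Function.iterate_succ_apply,
          show step (a, x :: t, s) = (a, t, f a s x) from rfl, ih]; simp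
  -- The code of a list is longer than the list, so `esize (l a)` rounds exhaust it. Further rounds
  -- are idle on the empty list.
  have main := iterate_while (init := fun a => (a, l a, i a)) (by fun_prop) hs
    (c := fun s => !s.2.1.isEmpty) (by fun_prop) ?_ (N := fun a => esize (l a)) hl.size ?_
    (B := fun a => esize a + (esize (l a) + B a + 1) + 1) ?_ ?_
  · have h2 : PolyTime fun s : α × List β × γ => s.2.2 := by fun_prop
    refine (h2.comp main).of_code_eq fun a => ?_
    rw [hit, List.take_of_length_le (length_lt_esize _).le]
  · rintro ⟨a, l, s⟩ h
    cases l with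
    | nil => rfl
    | cons x t => simp at h
  · intro a
    rw [hit, List.drop_of_length_le (length_lt_esize _).le]; rfl
  · exact (PolyBdd.id.add ((hl.size.add hB).add (.const 1))).add (.const 1)
  · intro a k _
    rw [hit]
    simp only [esize_prod]
    have := hsize a k
    have := esize_sublist (List.drop_sublist k (l a))
    omega

/-- Folding a list when every step adds a bounded amount to the size. -/
theorem foldl_of_le {l : α → List β} (hl : PolyTime l) {i : α → γ} (hi : PolyTime i)
    {f : α → γ → β → γ} (hf : PolyTime fun p : α × γ × β => f p.1 p.2.1 p.2.2)
    {B : α → ℕ} (hB : PolyBdd B)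
    (hsize : ∀ a s, ∀ x ∈ l a, esize (f a s x) ≤ esize s + B a) :
    PolyTime fun a => (l a).foldl (f a) (i a) := by
  refine foldl hl hi hf (B := fun a => esize (i a) + esize (l a) * B a)
    (hi.size.add (hl.size.mul hB)) fun a k => ?_
  have key : ∀ (t : List β) (s : γ), (∀ x ∈ t, x ∈ l a) →
      esize (t.foldl (f a) s) ≤ esize s + t.length * B a := by
    intro t
    induction t with
    | nil => intro s _; simp
    | cons x t ih =>
      intro s h
      have h1 := hsize a s x (h x (by simp))
      have h2 := ih (f a s x) fun y hy => h y (by simp [hy])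
      simp only [List.foldl_cons, List.length_cons, Nat.succ_mul]
      omega
  refine (key _ _ fun x hx => List.mem_of_mem_take hx).trans ?_
  have h1 : ((l a).take k).length ≤ esize (l a) :=
    (List.length_take_le' _ _).trans (length_lt_esize (l a)).le
  exact Nat.add_le_add_left (Nat.mul_le_mul_right _ h1) _

@[fun_prop]
theorem reverse {l : α → List β} (hl : PolyTime l) : PolyTime fun a => (l a).reverse := by
  have := foldl_of_le (l := l) hl (i := fun _ => ([] : List β)) (by fun_prop)
    (f := fun _ s x => x :: s) (by fun_prop) (B := fun a => esize (l a) + 1)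
    (hl.size.add (.const 1)) fun a s x hx => by
      have := esize_lt_of_mem hx
      simp only [esize_cons]; omega
  refine this.of_code_eq fun a => ?_
  rw [List.foldl_flip_cons_eq_append']; simp

end PolyTime
end

section
variable {α : Type u} {β : Type v} {γ : Type w} [Enc α] [Enc β] [Enc γ]

namespace PolyTime

/-! ## Lists and numbers -/

/-- An element of a list has a smaller code than the list, so the size bound for `h` applies
uniformly to all elements. -/
theorem bound_mem {h : α → β → γ} (hh : PolyTime fun p : α × β => h p.1 p.2) {l : α → List β}
    (hl : PolyTime l) : ∃ B : α → ℕ, PolyBdd B ∧ ∀ a, ∀ x ∈ l a, esize (h a x) ≤ B a := by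
  obtain ⟨p, hp⟩ := hh.size
  refine ⟨fun a => p.eval (esize a + esize (l a) + 1), ((PolyBdd.id.add hl.size).add (.const 1)).eval p,
    fun a x hx => (hp (a, x)).trans (p.eval_nat_mono ?_)⟩
  have := esize_lt_of_mem hx
  rw [esize_prod]; omega

@[fun_prop]
theorem map {l : α → List β} {h : α → β → γ} (hh : PolyTime fun p : α × β => h p.1 p.2)
    (hl : PolyTime l) : PolyTime fun a => (l a).map (h a) := by
  obtain ⟨B, hB, hb⟩ := bound_mem hh hl
  have := (foldl_of_le (l := l) hl (i := fun _ => ([] : List γ)) (by fun_prop)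
    (f := fun a s x => h a x :: s)
    (cons (hh.comp (f := fun p : α × List γ × β => (p.1, p.2.2)) (by fun_prop)) (by fun_prop))
    (B := fun a => B a + 1) (hB.add (.const 1)) fun a s x hx => by
      have := hb a x hx
      simp only [esize_cons]; omega).reverse
  refine this.of_code_eq fun a => ?_
  congr 1
  simp

@[fun_prop]
theorem append {l l' : α → List β} (hl : PolyTime l) (hl' : PolyTime l') :
    PolyTime fun a => l a ++ l' a := by
  have := foldl_of_le (l := fun a => (l a).reverse) (by fun_prop) (i := l') hl'
    (f := fun _ s x => x :: s) (by fun_prop) (B := fun a => esize (l a) + 1)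
    (hl.size.add (.const 1)) fun a s x hx => by
      have := esize_lt_of_mem (List.mem_reverse.1 hx)
      simp only [esize_cons]; omega
  refine this.of_code_eq fun a => ?_
  rw [List.foldl_flip_cons_eq_append']; simp

@[fun_prop]
theorem filter {l : α → List β} {h : α → β → Bool} (hh : PolyTime fun p : α × β => h p.1 p.2)
    (hl : PolyTime l) : PolyTime fun a => (l a).filter (h a) := by
  have := (foldl_of_le (l := l) hl (i := fun _ => ([] : List β)) (by fun_prop)
    (f := fun a s x => bif h a x then x :: s else s)
    (cond (hh.comp (f := fun p : α × List β × β => (p.1, p.2.2)) (by fun_prop)) (by fun_prop)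
      (by fun_prop))
    (B := fun a => esize (l a) + 1) (hl.size.add (.const 1)) fun a s x hx => by
      have := esize_lt_of_mem hx
      cases h a x <;> simp only [cond_true, cond_false, esize_cons] <;> omega).reverse
  refine this.of_code_eq fun a => ?_
  congr 1
  generalize l a = L
  suffices ∀ s, (List.foldl (fun s x => bif h a x then x :: s else s) s L).reverse =
      s.reverse ++ L.filter (h a) by simpa using this []
  induction L with
  | nil => simp
  | cons x t ih => intro s; rw [List.foldl_cons, ih]; cases hx : h a x <;> simp [hx]

@[fun_prop]
theorem all {l : α → List β} {h : α → β → Bool} (hh : PolyTime fun p : α × β => h p.1 p.2)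
    (hl : PolyTime l) : PolyTime fun a => (l a).all (h a) := by
  have : PolyTime fun a => ((l a).filter fun x => !h a x).isEmpty := by fun_prop
  refine this.of_code_eq fun a => congrArg _ ?_
  rw [Bool.eq_iff_iff]
  simp

@[fun_prop]
theorem any {l : α → List β} {h : α → β → Bool} (hh : PolyTime fun p : α × β => h p.1 p.2)
    (hl : PolyTime l) : PolyTime fun a => (l a).any (h a) := by
  have : PolyTime fun a => !((l a).filter fun x => h a x).isEmpty := by fun_prop
  refine this.of_code_eq fun a => congrArg _ ?_
  rw [Bool.eq_iff_iff]
  simp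

@[fun_prop]
theorem flatMap {l : α → List β} {h : α → β → List γ} (hh : PolyTime fun p : α × β => h p.1 p.2)
    (hl : PolyTime l) : PolyTime fun a => (l a).flatMap (h a) := by
  obtain ⟨B, hB, hb⟩ := bound_mem hh hl
  have := foldl_of_le (l := l) hl (i := fun _ => ([] : List γ)) (by fun_prop)
    (f := fun a s x => s ++ h a x)
    (append (by fun_prop) (hh.comp (f := fun p : α × List γ × β => (p.1, p.2.2)) (by fun_prop)))
    (B := B) hB fun a s x hx => by
      have := hb a x hx
      have := esize_append s (h a x)
      omega
  refine this.of_code_eq fun a => congrArg _ ?_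
  rw [List.flatMap_eq_foldl]

@[fun_prop]
theorem succ {f : α → ℕ} (hf : PolyTime f) : PolyTime fun a => f a + 1 :=
  (prodMk (const ()) hf).of_code_eq fun _ => rfl

@[fun_prop]
theorem length {l : α → List β} (hl : PolyTime l) : PolyTime fun a => (l a).length := by
  -- A list of units has the same code as the unary numeral of its length.
  have : PolyTime fun a => (l a).map fun _ => () := by fun_prop
  refine this.of_code_eq fun a => ?_
  induction l a with
  | nil => rfl
  | cons x t ih => exact congrArg (Datum.node .nil) ih

/-- The two codes agree. Iteration `n` times is therefore a fold over a list, and no separate loop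
on numbers is needed. -/
theorem replicate_unit {n : α → ℕ} (hn : PolyTime n) : PolyTime fun a => List.replicate (n a) () :=
  hn.of_code_eq fun a => by
    induction n a with
    | zero => rfl
    | succ n ih => exact congrArg (Datum.node .nil) ih

theorem iterate {n : α → ℕ} (hn : PolyTime n) {i : α → γ} (hi : PolyTime i)
    {f : α → γ → γ} (hf : PolyTime fun p : α × γ => f p.1 p.2)
    {B : α → ℕ} (hB : PolyBdd B) (hsize : ∀ a, ∀ k ≤ n a, esize ((f a)^[k] (i a)) ≤ B a) :
    PolyTime fun a => (f a)^[n a] (i a) := by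
  have key : ∀ a k (s : γ), (List.replicate k ()).foldl (fun s _ => f a s) s = (f a)^[k] s := by
    intro a k
    induction k with
    | zero => intro s; rfl
    | succ k ih => intro s; rw [List.replicate_succ, List.foldl_cons, ih]; rfl
  refine (foldl (replicate_unit hn) hi (f := fun a s _ => f a s)
    (hf.comp (f := fun p : α × γ × Unit => (p.1, p.2.1)) (by fun_prop)) hB fun a k => ?_).of_code_eq
      fun a => congrArg _ (key _ _ _)
  rw [List.take_replicate, key]
  exact hsize a _ (min_le_right _ _)

@[fun_prop]
theorem drop {n : α → ℕ} {l : α → List β} (hn : PolyTime n) (hl : PolyTime l) :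
    PolyTime fun a => (l a).drop (n a) := by
  have key : ∀ k (s : List β), List.tail^[k] s = s.drop k := by
    intro k
    induction k with
    | zero => intro s; rfl
    | succ k ih => intro s; rw [Function.iterate_succ_apply, ih]; cases s <;> simp
  refine (iterate hn hl (f := fun _ s => s.tail) (by fun_prop) (B := fun a => esize (l a)) hl.size
    fun a k _ => ?_).of_code_eq fun a => congrArg _ (key _ _)
  rw [key]
  exact esize_sublist (List.drop_sublist _ _)

@[fun_prop]
theorem take {n : α → ℕ} {l : α → List β} (hn : PolyTime n) (hl : PolyTime l) :
    PolyTime fun a => (l a).take (n a) := by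
  -- Dropping as many elements from the end as remain after dropping `n a` from the front leaves the
  -- first `n a`.
  have : PolyTime fun a => ((l a).reverse.drop ((l a).drop (n a)).length).reverse := by fun_prop
  refine this.of_code_eq fun a => congrArg _ ?_
  rw [List.drop_reverse, List.reverse_reverse, List.length_drop]
  rcases le_total (n a) (l a).length with h | h
  · rw [Nat.sub_sub_self h]
  · rw [Nat.sub_eq_zero_of_le h, Nat.sub_zero, List.take_length, List.take_of_length_le h]

@[fun_prop]
theorem getD {n : α → ℕ} {l : α → List β} {d : α → β} (hn : PolyTime n) (hl : PolyTime l)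
    (hd : PolyTime d) : PolyTime fun a => (l a).getD (n a) (d a) := by
  have : PolyTime fun a => ((l a).drop (n a)).headD (d a) := by fun_prop
  refine this.of_code_eq fun a => congrArg _ ?_
  rw [List.headD_eq_head?_getD, List.head?_drop, List.getD_eq_getElem?_getD]

@[fun_prop]
theorem range {n : α → ℕ} (hn : PolyTime n) : PolyTime fun a => List.range (n a) := by
  have key : ∀ k, (fun s : List ℕ => s.length :: s)^[k] [] = (List.range k).reverse := by
    intro k
    induction k with
    | zero => rfl
    | succ k ih => rw [Function.iterate_succ_apply', ih, List.range_succ]; simp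
  have := (iterate hn (i := fun _ => ([] : List ℕ)) (by fun_prop)
    (f := fun _ s => s.length :: s) (by fun_prop)
    (B := fun a => esize (n a) * (esize (n a) + 1) + 1)
    ((hn.size.mul (hn.size.add (.const 1))).add (.const 1)) fun a k hk => ?_).reverse
  · refine this.of_code_eq fun a => congrArg _ ?_
    rw [key, List.reverse_reverse]
  · rw [key]
    refine esize_list_le (by simp; omega) fun b hb => ?_
    simp at hb
    simp; omega

@[fun_prop]
theorem zip {l : α → List β} {l' : α → List γ} (hl : PolyTime l) (hl' : PolyTime l') :
    PolyTime fun a => (l a).zip (l' a) := by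
  -- The entry at a position is read as a list of length at most one, so that `β` and `γ` need no
  -- default elements.
  have h1 : PolyTime fun p : α × ℕ => ((l p.1).drop p.2).take 1 := by fun_prop
  have h2 : PolyTime fun p : α × ℕ => ((l' p.1).drop p.2).take 1 := by fun_prop
  have h3 : PolyTime fun p : α × ℕ => (((l p.1).drop p.2).take 1).flatMap fun x =>
      (((l' p.1).drop p.2).take 1).map fun y => (x, y) := by fun_prop
  have : PolyTime fun a => (List.range (l a).length).flatMap fun i =>
    (((l a).drop i).take 1).flatMap fun x => (((l' a).drop i).take 1).map fun y => (x, y) := by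
    fun_prop
  refine this.of_code_eq fun a => congrArg _ ?_
  generalize l a = L
  generalize l' a = L'
  induction L generalizing L' with
  | nil => simp
  | cons x t ih =>
    rw [List.length_cons, List.range_succ_eq_map, List.flatMap_cons, List.flatMap_map]
    cases L' with
    | nil => simp
    | cons y t' => simpa using ih t'

theorem foldr_of_le {l : α → List β} (hl : PolyTime l) {i : α → γ} (hi : PolyTime i)
    {f : α → β → γ → γ} (hf : PolyTime fun p : α × β × γ => f p.1 p.2.1 p.2.2)
    {B : α → ℕ} (hB : PolyBdd B)
    (hsize : ∀ a s, ∀ x ∈ l a, esize (f a x s) ≤ esize s + B a) :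
    PolyTime fun a => (l a).foldr (f a) (i a) :=
  (foldl_of_le (l := fun a => (l a).reverse) (by fun_prop) hi (f := fun a s x => f a x s)
    (hf.comp (f := fun p : α × γ × β => (p.1, p.2.2, p.2.1)) (by fun_prop)) hB
    fun a s x hx => hsize a s x (List.mem_reverse.1 hx)).of_code_eq fun a => by
      rw [List.foldl_reverse]

/-! ## Recursion on trees -/

section tree

variable {τ : Type*} [Enc τ] (children : τ → List τ)
  (hdec : ∀ t, ((children t).map esize).sum < esize t)

/-- The nodes of a forest in preorder. -/
def _root_.OFPC.preorder (hdec : ∀ t, ((children t).map esize).sum < esize t) : List τ → List τ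
  | [] => []
  | t :: w => t :: preorder hdec (children t ++ w)
termination_by w => (w.map esize).sum
decreasing_by simp; exact hdec t

/-- Replacing a node by its children strictly decreases the total size of the forest. The total size
therefore bounds both the number of visited nodes and each of their sizes. -/
theorem _root_.OFPC.preorder_invariant {children : τ → List τ}
    {hdec : ∀ t, ((children t).map esize).sum < esize t} (w : List τ) :
    ((preorder children hdec w).length ≤ (w.map esize).sum) ∧
      ∀ t ∈ preorder children hdec w, esize t ≤ (w.map esize).sum := by
  induction w using preorder.induct children hdec with
  | case1 => simp [preorder]
  | case2 t w ih =>
    rw [preorder]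
    have := hdec t
    simp only [List.map_append, List.sum_append, List.map_cons, List.sum_cons, List.length_cons,
      List.mem_cons, forall_eq_or_imp] at ih ⊢
    refine ⟨by omega, by omega, fun s hs => (ih.2 s hs).trans (by omega)⟩

/-- A stack of pending nodes and a list of visited nodes are kept. The total size of the stack drops
in every round, so the stack is empty after as many rounds as the size of the input. -/
theorem preorder {children : τ → List τ} (hc : PolyTime children)
    (hdec : ∀ t, ((children t).map esize).sum < esize t) {w : α → List τ} (hw : PolyTime w) :
    PolyTime fun a => OFPC.preorder children hdec (w a) := by
  set step : List τ × List τ → List τ × List τ := fun s =>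
    match s.1 with
    | [] => s
    | t :: w => (children t ++ w, t :: s.2) with hstepdef
  have hs : PolyTime step := by
    refine listCases (l := fun s : List τ × List τ => s.1) (g := fun s => s)
      (h := fun s t w => (children t ++ w, t :: s.2)) (by fun_prop) (by fun_prop) ?_ ?_ ?_
    · fun_prop
    · rintro ⟨l, s⟩ h; simp only at h; subst h; rfl
    · rintro ⟨l, s⟩ x t h; simp only at h; subst h; rfl
  -- The loop invariant: the visited nodes followed by the preorder of the pending ones do not
  -- change, and the pending size has dropped by at least `k` unless it has reached `0`.
  have hit : ∀ (k : ℕ) (w o : List τ),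
      (step^[k] (w, o)).2.reverse ++ OFPC.preorder children hdec (step^[k] (w, o)).1 =
        o.reverse ++ OFPC.preorder children hdec w ∧
      ((step^[k] (w, o)).1.map esize).sum ≤ (w.map esize).sum - k := by
    intro k
    induction k with
    | zero => intro w o; simp
    | succ k ih =>
      intro w o
      cases w with
      | nil =>
        rw [Function.iterate_succ_apply, show step ([], o) = ([], o) from rfl]
        have := ih [] o
        refine ⟨this.1, this.2.trans (by simp)⟩
      | cons t w =>
        rw [Function.iterate_succ_apply, show step (t :: w, o) = (children t ++ w, t :: o) from rfl]
        have := ih (children t ++ w) (t :: o)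
        refine ⟨this.1.trans ?_, this.2.trans ?_⟩
        · conv_rhs => rw [OFPC.preorder]
          simp
        · have := hdec t
          simp only [List.map_append, List.sum_append, List.map_cons, List.sum_cons]
          omega
  have hsum : ∀ w : List τ, (w.map esize).sum < esize w := fun w => by rw [esize_list]; omega
  have hnil : ∀ a, (step^[esize (w a)] (w a, [])).1 = [] := by
    intro a
    have h := (hit (esize (w a)) (w a) []).2
    have := hsum (w a)
    cases h0 : (step^[esize (w a)] (w a, [])).1 with
    | nil => rfl
    | cons t w' =>
      rw [h0] at h
      have := esize_pos t
      simp only [List.map_cons, List.sum_cons] at h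
      omega
  have main := iterate_while (init := fun a => (w a, ([] : List τ))) (by fun_prop) hs
    (c := fun s => !s.1.isEmpty) (by fun_prop) ?_ (N := fun a => esize (w a)) hw.size ?_
    (B := fun a => (esize (w a) * (esize (w a) + 1) + 1) + (esize (w a) * (esize (w a) + 1) + 1) + 1)
    ?_ ?_
  · refine main.snd.reverse.of_code_eq fun a => congrArg _ ?_
    have := (hit (esize (w a)) (w a) []).1
    rw [hnil] at this
    simpa [OFPC.preorder] using this
  · rintro ⟨l, s⟩ h
    cases l with
    | nil => rfl
    | cons x t => simp at h
  · intro a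
    simp only [hnil]; rfl
  · exact (((hw.size.mul (hw.size.add (.const 1))).add (.const 1)).add
      ((hw.size.mul (hw.size.add (.const 1))).add (.const 1))).add (.const 1)
  · intro a k _
    obtain ⟨h1, h2⟩ := hit k (w a) []
    have h3 := hsum (w a)
    obtain ⟨h4, h5⟩ := preorder_invariant (hdec := hdec) (w a)
    rw [List.reverse_nil, List.nil_append] at h1
    rw [← h1] at h4 h5
    set s := step^[k] (w a, ([] : List τ))
    have e1 : esize s.1 ≤ esize (w a) * (esize (w a) + 1) + 1 := by
      have hl : s.1.length ≤ (s.1.map esize).sum := by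
        clear_value s
        induction s.1 with
        | nil => simp
        | cons t l ih => have := esize_pos t; simp; omega
      have h6 := esize_list s.1
      have h7 := Nat.le_mul_self (esize (w a))
      rw [Nat.mul_succ]
      omega
    have e2 : esize s.2 ≤ esize (w a) * (esize (w a) + 1) + 1 := by
      refine esize_list_le ?_ fun t ht => (h5 t (by simp [ht])).trans h3.le
      rw [List.length_append, List.length_reverse] at h4
      omega
    change esize s.1 + esize s.2 + 1 ≤ _
    omega

/-- Structural recursion on trees. -/
theorem treeFold {children : τ → List τ} (hc : PolyTime children)
    (hdec : ∀ t, ((children t).map esize).sum < esize t)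
    {node : α → τ → List β → β} (hn : PolyTime fun p : α × τ × List β => node p.1 p.2.1 p.2.2)
    {val : α → τ → β} (hval : ∀ a t, val a t = node a t ((children t).map (val a)))
    (hB : PolyBdd fun p : α × τ => esize (val p.1 p.2)) :
    PolyTime fun p : α × τ => val p.1 p.2 := by
  -- The preorder is read from right to left with a stack of values. When a node is reached, the
  -- values of its children are on top of the stack.
  set step : α → τ → List β → List β := fun a t st =>
    node a t (st.take (children t).length) :: st.drop (children t).length with hstep
  have hfold : ∀ a w, (OFPC.preorder children hdec w).foldr (step a) [] = w.map (val a) := by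
    intro a w
    induction w using preorder.induct children hdec with
    | case1 => simp [OFPC.preorder]
    | case2 t w ih =>
      rw [OFPC.preorder, List.foldr_cons, ih, List.map_append, hstep]
      simp [hval a t]
  -- Every suffix of a preorder is the preorder of some forest `w'` whose roots occur in the suffix.
  -- Hence every intermediate stack is the list of the values at nodes of the tree, and the bound on
  -- `val` controls its size.
  have hsuf : ∀ w (s : List τ), s <:+ OFPC.preorder children hdec w →
      ∃ w', s = OFPC.preorder children hdec w' ∧ w'.length ≤ s.length ∧ ∀ t ∈ w', t ∈ s := by
    intro w
    induction w using preorder.induct children hdec with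
    | case1 => intro s h; exact ⟨[], by simpa [OFPC.preorder] using h, by simp, by simp⟩
    | case2 t w ih =>
      intro s h
      rw [OFPC.preorder, List.suffix_cons_iff] at h
      rcases h with rfl | h
      · have hsub : ∀ w : List τ, w.Sublist (OFPC.preorder children hdec w) := by
          intro w
          induction w using preorder.induct children hdec with
          | case1 => simp
          | case2 t w ih =>
            rw [OFPC.preorder]
            exact ((List.sublist_append_right _ _).trans ih).cons_cons t
        refine ⟨t :: w, by rw [OFPC.preorder], ?_, fun x hx => ?_⟩
        · have := (hsub (t :: w)).length_le
          rwa [OFPC.preorder] at this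
        · have := (hsub (t :: w)).subset hx
          rwa [OFPC.preorder] at this
      · exact ih s h
  obtain ⟨q, hq⟩ := hB
  have hpre : PolyTime fun p : α × τ => (OFPC.preorder children hdec [p.2]).reverse :=
    reverse (preorder hc hdec (by fun_prop))
  have main := foldl (l := fun p : α × τ => (OFPC.preorder children hdec [p.2]).reverse)
    hpre (i := fun _ => ([] : List β)) (by fun_prop) (f := fun p st t => step p.1 t st) ?_
    (B := fun p => esize p * (q.eval (esize p) + 1) + 1)
    ((PolyBdd.id.mul ((PolyBdd.id.eval q).add (.const 1))).add (.const 1)) ?_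
  · have h0 : PolyTime fun p : α × τ => ([] : List β) := by fun_prop
    -- The final stack has one entry. Reading it off the code avoids a default element of `β`.
    refine ((datum_fst.comp (code.comp main))).of_code_eq fun p => ?_
    rw [List.foldl_reverse, hfold]
    rfl
  · have : PolyTime fun p : (α × τ) × List β × τ =>
        node p.1.1 p.2.2 (p.2.1.take (children p.2.2).length) :=
      hn.comp (f := fun p : (α × τ) × List β × τ =>
        (p.1.1, p.2.2, p.2.1.take (children p.2.2).length)) (by fun_prop)
    fun_prop
  · intro p k
    rw [List.take_reverse, List.foldl_reverse]
    obtain ⟨w', h1, h2, h3⟩ := hsuf [p.2] _ (List.drop_suffix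
      ((OFPC.preorder children hdec [p.2]).length - k) _)
    obtain ⟨h4, h5⟩ := preorder_invariant (children := children) (hdec := hdec) [p.2]
    rw [h1, hfold]
    simp only [List.map_cons, List.map_nil, List.sum_cons, List.sum_nil, Nat.add_zero] at h4 h5
    have hp : esize p = esize p.1 + esize p.2 + 1 := rfl
    refine esize_list_le ?_ ?_
    · rw [List.length_map]
      have : (List.drop ((OFPC.preorder children hdec [p.2]).length - k)
        (OFPC.preorder children hdec [p.2])).length ≤ (OFPC.preorder children hdec [p.2]).length := by
        simp
      omega
    · intro b hb
      obtain ⟨t, ht, rfl⟩ := List.mem_map.1 hb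
      refine (hq (p.1, t)).trans (q.eval_nat_mono ?_)
      have := h5 t ((List.drop_suffix _ _).subset (h3 t ht))
      rw [esize_prod]
      omega

end tree

end PolyTime
end

/-! ## Equality tests, recognition of codes -/

open Classical in
/-- Boolean equality. -/
def eqb {α : Type u} (x y : α) : Bool := decide (x = y)

@[simp] theorem eqb_iff {α : Type u} {x y : α} : eqb x y = true ↔ x = y := by simp [eqb]
@[simp] theorem eqb_eq_false {α : Type u} {x y : α} : eqb x y = false ↔ x ≠ y := by simp [eqb]

section
variable {α : Type u} {β : Type v} {γ : Type w} [Enc α] [Enc β] [Enc γ]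

def Datum.isNil : Datum → Bool
  | .nil => true
  | .node _ _ => false

@[fun_prop]
theorem PolyTime.datumFst {f : α → Datum} (hf : PolyTime f) : PolyTime fun a => (f a).fst :=
  datum_fst.comp hf

@[fun_prop]
theorem PolyTime.datumSnd {f : α → Datum} (hf : PolyTime f) : PolyTime fun a => (f a).snd :=
  datum_snd.comp hf

@[fun_prop]
theorem PolyTime.datumIsNil {f : α → Datum} (hf : PolyTime f) : PolyTime fun a => (f a).isNil :=
  (isNil.comp hf).of_code_eq fun a => by cases f a <;> rfl

@[fun_prop]
theorem PolyTime.encCode {f : α → β} (hf : PolyTime f) :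
    PolyTime fun a => Enc.code (f a) := code.comp hf

theorem PolyTime.bool_bdd (f : α → Bool) : PolyBdd fun a => esize (f a) :=
  (PolyBdd.const 3).mono fun a => esize_bool_le (f a)


/-- Both trees are descended simultaneously until one of them is a leaf. This is a tree recursion on
pairs, because splitting two nodes into two pairs of subtrees decreases the total code size by one.
-/
theorem PolyTime.eqb_datum : PolyTime fun p : Datum × Datum => eqb p.1 p.2 := by
  set children : Datum × Datum → List (Datum × Datum) := fun p =>
    bif p.1.isNil || p.2.isNil then [] else [(p.1.fst, p.2.fst), (p.1.snd, p.2.snd)] with hc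
  have h := treeFold (α := Unit) (τ := Datum × Datum) (children := children) (by fun_prop) ?_
    (node := fun _ p bs => bif p.1.isNil || p.2.isNil then p.1.isNil && p.2.isNil else bs.all fun b => b)
    (by fun_prop) (val := fun _ p => eqb p.1 p.2) ?_ (bool_bdd _)
  · exact h.comp (f := fun p : Datum × Datum => ((), p)) (by fun_prop)
  · rintro ⟨a, b⟩
    cases a with
    | nil => simp [hc, Datum.isNil, Datum.size]
    | node a1 a2 => cases b with
      | nil => simp [hc, Datum.isNil, Datum.size]
      | node b1 b2 => simp [hc, Datum.isNil, Datum.size, Datum.fst, Datum.snd]; omega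
  · rintro _ ⟨a, b⟩
    rw [Bool.eq_iff_iff]
    cases a <;> cases b <;> simp [hc, Datum.isNil, Datum.fst, Datum.snd]

/-- Encodings are injective. -/
class LawfulEnc (α : Type u) [Enc α] : Prop where
  code_inj : Function.Injective (Enc.code : α → Datum)

@[fun_prop]
theorem PolyTime.eqb [LawfulEnc β] {f g : α → β} (hf : PolyTime f) (hg : PolyTime g) :
    PolyTime fun a => eqb (f a) (g a) := by
  have := eqb_datum.comp (f := fun a => (Enc.code (f a), Enc.code (g a))) (by fun_prop)
  refine this.of_code_eq fun a => congrArg _ ?_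
  rw [Bool.eq_iff_iff, eqb_iff, eqb_iff]
  exact LawfulEnc.code_inj.eq_iff

instance : LawfulEnc Datum := ⟨fun _ _ h => h⟩

theorem ofNat_injective : Function.Injective Datum.ofNat := by
  intro a
  induction a with
  | zero => intro b h; cases b with
    | zero => rfl
    | succ b => cases h
  | succ a ih => intro b h; cases b with
    | zero => cases h
    | succ b => injection h with _ h; rw [ih h]

instance : LawfulEnc ℕ := ⟨ofNat_injective⟩

instance : LawfulEnc Bool := ⟨fun a b h => by cases a <;> cases b <;> first | rfl | cases h⟩

instance [LawfulEnc α] [LawfulEnc β] : LawfulEnc (α × β) := ⟨by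
  rintro ⟨a, b⟩ ⟨c, d⟩ h
  injection h with h1 h2
  exact Prod.ext (LawfulEnc.code_inj h1) (LawfulEnc.code_inj h2)⟩

instance [LawfulEnc α] : LawfulEnc (List α) := ⟨by
  intro l
  induction l with
  | nil => intro l' h; cases l' with
    | nil => rfl
    | cons => cases h
  | cons x t ih => intro l' h; cases l' with
    | nil => cases h
    | cons y t' =>
      injection h with h1 h2
      rw [LawfulEnc.code_inj h1, ih h2]⟩

def Datum.children (d : Datum) : List Datum := bif d.isNil then [] else [d.fst, d.snd]

theorem Datum.children_lt (d : Datum) : ((d.children).map esize).sum < esize d := by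
  cases d <;> simp [Datum.children, Datum.isNil, Datum.size, Datum.fst, Datum.snd]

-- The size of a datum is the length of its preorder, and the unary encoding of numbers makes that
-- length an admissible output.
@[fun_prop]
theorem PolyTime.esize {f : α → β} (hf : PolyTime f) : PolyTime fun a => esize (f a) := by
  have hc : PolyTime Datum.children := by unfold Datum.children; fun_prop
  have h : PolyTime fun a => (OFPC.preorder Datum.children Datum.children_lt [Enc.code (f a)]).length :=
    length (preorder hc _ (by fun_prop))
  refine h.of_code_eq fun a => congrArg _ ?_
  have key : ∀ w, (OFPC.preorder Datum.children Datum.children_lt w).length = (w.map Datum.size).sum := by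
    intro w
    induction w using preorder.induct Datum.children Datum.children_lt with
    | case1 => simp [OFPC.preorder]
    | case2 t w ih =>
      rw [OFPC.preorder, List.length_cons, ih]
      cases t <;> simp [Datum.children, Datum.isNil, Datum.size, Datum.fst, Datum.snd] <;> omega
  rw [key]
  simp [OFPC.esize]

theorem decidableInPolyTime_iff {L : Set Datum} : DecidableInPolyTime L ↔
    ∃ r : Datum → Bool, PolyTime r ∧ ∀ d, r d = true ↔ d ∈ L := by
  classical
  constructor
  · intro h
    exact ⟨fun d => @decide (d ∈ L) (Classical.propDecidable _), h, fun d => by simp⟩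
  · rintro ⟨r, hr, h⟩
    refine PolyTime.of_code_eq (f := r) (f' := fun d => @decide (d ∈ L) (Classical.propDecidable _))
      hr fun d => congrArg _ ?_
    rw [Bool.eq_iff_iff, h]; simp

/-- The codes of the elements of `α` can be recognised in polynomial time. -/
class Recognizable (α : Type u) [Enc α] : Prop where
  exists_rec : ∃ r : Datum → Bool, PolyTime r ∧ ∀ d, r d = true ↔ ∃ a : α, Enc.code a = d

/-- Strings that are not codes are rejected first. On codes, decoding is free because it leaves the
datum unchanged, so the decision procedure for typed data can be run on it directly. -/
theorem Recognizable.decidable [Recognizable α] [LawfulEnc α] {dec : α → Bool}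
    (hd : PolyTime dec) {L : Set Datum} (hL : ∀ v, v ∈ L ↔ ∃ a, v = Enc.code a ∧ dec a = true) :
    DecidableInPolyTime L := by
  classical
  obtain ⟨r, hr, h⟩ := Recognizable.exists_rec (α := α)
  refine decidableInPolyTime_iff.2 ⟨fun d => decide (d ∈ L), ?_, fun d => by simp⟩
  refine PolyTime.split hr ?_ ?_
  · refine hd.transport (fun x : {d // r d = true} => ((h x.1).1 x.2).choose)
      (fun x => ((h x.1).1 x.2).choose_spec) fun x => congrArg _ ?_
    have hx := ((h x.1).1 x.2).choose_spec
    set a := ((h x.1).1 x.2).choose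
    rw [Bool.eq_iff_iff, decide_eq_true_iff, hL]
    constructor
    · intro ha
      exact ⟨a, hx.symm, ha⟩
    · rintro ⟨b, hb, hb'⟩
      rwa [LawfulEnc.code_inj (hx.trans hb)]
  · refine (PolyTime.const false).of_code_eq fun x => congrArg _ ?_
    symm
    rw [decide_eq_false_iff_not, hL]
    rintro ⟨a, ha, _⟩
    have := (h x.1).2 ⟨a, ha.symm⟩
    rw [x.2] at this
    cases this

instance : Recognizable ℕ := ⟨by
  set children : Datum → List Datum := fun d => bif d.isNil then [] else [d.snd] with hc
  have h := PolyTime.treeFold (α := Unit) (τ := Datum) (children := children) (by fun_prop) ?_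
    (node := fun _ d bs => d.isNil || (d.fst.isNil && bs.all fun b => b))
    (by fun_prop) (val := fun _ d => Datum.rec true (fun a _ _ ib => a.isNil && ib) d) ?_
    (PolyTime.bool_bdd _)
  · refine ⟨_, h.comp (f := fun d : Datum => ((), d)) (by fun_prop), fun d => ?_⟩
    induction d with
    | nil => simp only [true_iff]; exact ⟨0, rfl⟩
    | node a b _ ih =>
      simp only at ih ⊢
      rw [Bool.and_eq_true, ih]
      constructor
      · rintro ⟨h1, n, rfl⟩
        cases a with
        | nil => exact ⟨n + 1, rfl⟩
        | node => cases h1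
      · rintro ⟨n, hn⟩
        cases n with
        | zero => cases hn
        | succ n => injection hn with h1 h2; subst h1; exact ⟨rfl, n, h2⟩
  · intro d
    cases d with
    | nil => simp [hc, Datum.isNil, Datum.size]
    | node a b => simp [hc, Datum.isNil, Datum.size, Datum.snd]
  · intro _ d
    cases d with
    | nil => rfl
    | node a b =>
      simp only [hc, Datum.isNil, cond_false, List.map_cons, List.map_nil, List.all_cons,
        List.all_nil, Datum.fst, Datum.snd, Bool.and_true, Bool.false_or]⟩

instance : Recognizable Bool := ⟨by
  refine ⟨fun d => eqb d (Datum.ofBool true) || eqb d (Datum.ofBool false), by fun_prop, fun d => ?_⟩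
  rw [Bool.or_eq_true, eqb_iff, eqb_iff, Bool.exists_bool, or_comm]
  exact or_congr eq_comm eq_comm⟩

instance [Recognizable α] [Recognizable β] : Recognizable (α × β) := ⟨by
  obtain ⟨r, hr, h⟩ := Recognizable.exists_rec (α := α)
  obtain ⟨s, hs, k⟩ := Recognizable.exists_rec (α := β)
  refine ⟨fun d => !d.isNil && (r d.fst && s d.snd), by fun_prop, fun d => ?_⟩
  rw [Bool.and_eq_true, Bool.and_eq_true, h, k]
  constructor
  · rintro ⟨h0, ⟨a, ha⟩, ⟨b, hb⟩⟩
    cases d with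
    | nil => cases h0
    | node x y => exact ⟨(a, b), congrArg₂ Datum.node ha hb⟩
  · rintro ⟨⟨a, b⟩, rfl⟩
    exact ⟨rfl, ⟨a, rfl⟩, ⟨b, rfl⟩⟩⟩

instance [Recognizable α] : Recognizable (List α) := ⟨by
  obtain ⟨r, hr, hr'⟩ := Recognizable.exists_rec (α := α)
  set children : Datum → List Datum := fun d => bif d.isNil then [] else [d.snd] with hc
  have h := PolyTime.treeFold (α := Unit) (τ := Datum) (children := children) (by fun_prop) ?_
    (node := fun _ d bs => d.isNil || (r d.fst && bs.all fun b => b))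
    (by fun_prop) (val := fun _ d => Datum.rec true (fun a _ _ ib => r a && ib) d) ?_
    (PolyTime.bool_bdd _)
  · refine ⟨_, h.comp (f := fun d : Datum => ((), d)) (by fun_prop), fun d => ?_⟩
    induction d with
    | nil => simp only [true_iff]; exact ⟨[], rfl⟩
    | node a b _ ih =>
      simp only at ih ⊢
      rw [Bool.and_eq_true, ih, hr']
      constructor
      · rintro ⟨⟨x, rfl⟩, n, rfl⟩
        exact ⟨x :: n, rfl⟩
      · rintro ⟨n, hn⟩
        cases n with
        | nil => cases hn
        | cons x n => injection hn with h1 h2; exact ⟨⟨x, h1⟩, n, h2⟩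
  · intro d
    cases d with
    | nil => simp [hc, Datum.isNil, Datum.size]
    | node a b => simp [hc, Datum.isNil, Datum.size, Datum.snd]
  · intro _ d
    cases d <;> simp [hc, Datum.isNil, Datum.fst, Datum.snd]⟩

end

/-! ## Formulas as data -/

section
variable {F : Type*} [Enc F] {α : Type u} {β : Type v} {γ : Type w} [Enc α] [Enc β] [Enc γ]

instance : Enc (Formula F ℕ) := ⟨Formula.code Enc.code Datum.ofNat⟩

instance [LawfulEnc F] : LawfulEnc (Formula F ℕ) := ⟨by
  intro f
  induction f with
  | var i => intro g h; cases g <;> first | (injection h with _ h; rw [ofNat_injective h]) | cases h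
  | const a => intro g h; cases g <;> first | (injection h with _ h; rw [LawfulEnc.code_inj h]) | cases h
  | add f g ihf ihg =>
    intro g h; cases g <;>
      first | (injection h with _ h; injection h with h1 h2; rw [ihf h1, ihg h2]; done) | cases h
  | mul f g ihf ihg =>
    intro g h; cases g <;>
      first | (injection h with _ h; injection h with h1 h2; rw [ihf h1, ihg h2]; done) | cases h⟩

@[fun_prop]
theorem PolyTime.formulaVar {f : α → ℕ} (hf : PolyTime f) :
    PolyTime fun a => (Formula.var (f a) : Formula F ℕ) :=
  (prodMk (const 0) hf).of_code_eq fun _ => rfl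

@[fun_prop]
theorem PolyTime.formulaConst {f : α → F} (hf : PolyTime f) :
    PolyTime fun a => (Formula.const (f a) : Formula F ℕ) :=
  (prodMk (const 1) hf).of_code_eq fun _ => rfl

@[fun_prop]
theorem PolyTime.formulaAdd {f g : α → Formula F ℕ} (hf : PolyTime f) (hg : PolyTime g) :
    PolyTime fun a => Formula.add (f a) (g a) :=
  (prodMk (const 2) (prodMk hf hg)).of_code_eq fun _ => rfl

@[fun_prop]
theorem PolyTime.formulaMul {f g : α → Formula F ℕ} (hf : PolyTime f) (hg : PolyTime g) :
    PolyTime fun a => Formula.mul (f a) (g a) :=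
  (prodMk (const 3) (prodMk hf hg)).of_code_eq fun _ => rfl

/-- The tag in the first component of the code is compared with `0`, `1` and `2` in turn. In each
branch the arguments of the constructor are read off the second component. -/
theorem PolyTime.formulaCases {f : α → Formula F ℕ} (hf : PolyTime f) {k : α → γ}
    {v : α → ℕ → γ} (hv : PolyTime fun p : α × ℕ => v p.1 p.2)
    {c : α → F → γ} (hc : PolyTime fun p : α × F => c p.1 p.2)
    {s : α → Formula F ℕ → Formula F ℕ → γ}
    (hs : PolyTime fun p : α × Formula F ℕ × Formula F ℕ => s p.1 p.2.1 p.2.2)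
    {m : α → Formula F ℕ → Formula F ℕ → γ}
    (hm : PolyTime fun p : α × Formula F ℕ × Formula F ℕ => m p.1 p.2.1 p.2.2)
    (h : ∀ a, k a = match f a with
      | .var i => v a i
      | .const x => c a x
      | .add g g' => s a g g'
      | .mul g g' => m a g g') : PolyTime k := by
  have hsnd : PolyTime fun a => (Enc.code (f a)).snd := by fun_prop
  refine split (c := fun a => OFPC.eqb (Enc.code (f a)).fst (Datum.ofNat 0)) (by fun_prop) ?_
    (split (c := fun a => OFPC.eqb (Enc.code (f a.1)).fst (Datum.ofNat 1))
      ((show PolyTime fun a => OFPC.eqb (Enc.code (f a)).fst (Datum.ofNat 1) by fun_prop).restrict _) ?_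
    (split (c := fun a => OFPC.eqb (Enc.code (f a.1.1)).fst (Datum.ofNat 2))
      (((show PolyTime fun a => OFPC.eqb (Enc.code (f a)).fst (Datum.ofNat 2) by fun_prop).restrict
        _).restrict _) ?_ ?_))
  · have : PolyTime fun x : {a // OFPC.eqb (Enc.code (f a)).fst (Datum.ofNat 0) = true} =>
        (x.1, match f x.1 with | .var i => i | _ => 0) := by
      refine (PolyTime.id.restrict _).prodMk ((hsnd.restrict _).of_code_eq ?_)
      rintro ⟨a, ha⟩
      rw [eqb_iff] at ha
      dsimp only
      cases hfa : f a <;> rw [hfa] at ha <;> first | rfl | cases ha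
    refine (hv.comp this).of_code_eq ?_
    rintro ⟨a, ha⟩
    rw [eqb_iff] at ha
    dsimp only
    rw [h]
    cases hfa : f a <;> rw [hfa] at ha <;> first | rfl | cases ha
  -- The impossible branches need some element of `F`, which is not assumed nonempty. On this
  -- subtype the formula is a constant and provides one.
  · have : PolyTime fun x : {a : {a // OFPC.eqb (Enc.code (f a)).fst (Datum.ofNat 0) = false} //
        OFPC.eqb (Enc.code (f a.1)).fst (Datum.ofNat 1) = true} =>
        (x.1.1, match f x.1.1 with | .const i => i | _ => Classical.choice (by
          obtain ⟨⟨a, _⟩, ha⟩ := x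
          rw [eqb_iff] at ha
          dsimp only at ha
          cases hfa : f a with
          | const i => exact ⟨i⟩
          | _ => rw [hfa] at ha; cases ha)) := by
      refine ((PolyTime.id.restrict _).restrict _).prodMk (((hsnd.restrict _).restrict _).of_code_eq ?_)
      rintro ⟨⟨a, _⟩, ha⟩
      have ha' := ha
      rw [eqb_iff] at ha'
      dsimp only at ha' ⊢
      split
      · rename_i hfa; rw [hfa]; rfl
      · rename_i hne
        exfalso
        cases hfa : f a <;> rw [hfa] at ha' <;> first | exact hne _ hfa | cases ha'
    refine (hc.comp this).of_code_eq ?_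
    rintro ⟨⟨a, _⟩, ha⟩
    have ha' := ha
    rw [eqb_iff] at ha'
    dsimp only at ha' ⊢
    rw [h]
    split
    · rename_i hfa; rw [hfa]
    · rename_i hne
      exfalso
      cases hfa : f a <;> rw [hfa] at ha' <;> first | exact hne _ hfa | cases ha'
  · have : PolyTime fun x : {a : {a : {a // OFPC.eqb (Enc.code (f a)).fst (Datum.ofNat 0) = false} //
        OFPC.eqb (Enc.code (f a.1)).fst (Datum.ofNat 1) = false} //
        OFPC.eqb (Enc.code (f a.1.1)).fst (Datum.ofNat 2) = true} =>
        (x.1.1.1, match f x.1.1.1 with | .add g g' => (g, g') | g => (g, g)) := by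
      refine (((PolyTime.id.restrict _).restrict _).restrict _).prodMk
        ((((hsnd.restrict _).restrict _).restrict _).of_code_eq ?_)
      rintro ⟨⟨⟨a, _⟩, _⟩, ha⟩
      rw [eqb_iff] at ha
      dsimp only at ha ⊢
      cases hfa : f a <;> rw [hfa] at ha <;> first | rfl | cases ha
    refine (hs.comp this).of_code_eq ?_
    rintro ⟨⟨⟨a, _⟩, _⟩, ha⟩
    rw [eqb_iff] at ha
    dsimp only at ha ⊢
    rw [h]
    cases hfa : f a <;> rw [hfa] at ha <;> first | rfl | cases ha
  · have : PolyTime fun x : {a : {a : {a // OFPC.eqb (Enc.code (f a)).fst (Datum.ofNat 0) = false} //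
        OFPC.eqb (Enc.code (f a.1)).fst (Datum.ofNat 1) = false} //
        OFPC.eqb (Enc.code (f a.1.1)).fst (Datum.ofNat 2) = false} =>
        (x.1.1.1, match f x.1.1.1 with | .mul g g' => (g, g') | g => (g, g)) := by
      refine (((PolyTime.id.restrict _).restrict _).restrict _).prodMk
        ((((hsnd.restrict _).restrict _).restrict _).of_code_eq ?_)
      rintro ⟨⟨⟨a, h0⟩, h1⟩, h2⟩
      rw [eqb_eq_false] at h0 h1 h2
      dsimp only at h0 h1 h2 ⊢
      cases hfa : f a <;> rw [hfa] at h0 h1 h2 <;>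
        first | rfl | exact absurd rfl h0 | exact absurd rfl h1 | exact absurd rfl h2
    refine (hm.comp this).of_code_eq ?_
    rintro ⟨⟨⟨a, h0⟩, h1⟩, h2⟩
    rw [eqb_eq_false] at h0 h1 h2
    dsimp only at h0 h1 h2 ⊢
    rw [h]
    cases hfa : f a <;> rw [hfa] at h0 h1 h2 <;>
      first | rfl | exact absurd rfl h0 | exact absurd rfl h1 | exact absurd rfl h2

instance [Recognizable F] : Recognizable (Formula F ℕ) := ⟨by
  obtain ⟨rN, hrN, hN⟩ := Recognizable.exists_rec (α := ℕ)
  obtain ⟨rF, hrF, hF⟩ := Recognizable.exists_rec (α := F)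
  -- A leaf has `nil` as both of its projections. A binary node must therefore be required to have a
  -- proper pair as its second component.
  set bin : Datum → Bool := fun d =>
    (eqb d.fst (Datum.ofNat 2) || eqb d.fst (Datum.ofNat 3)) && !d.snd.isNil with hbin
  have hb : PolyTime bin := by fun_prop
  set children : Datum → List Datum := fun d => bif bin d then [d.snd.fst, d.snd.snd] else [] with hc
  have hchild : PolyTime children := by fun_prop
  have hdec : ∀ d, ((children d).map esize).sum < esize d := by
    intro d
    rcases d with _ | ⟨t, _ | ⟨x, y⟩⟩
    · simp [hc, hbin, Datum.size, Datum.fst, Datum.snd, Datum.isNil]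
    · simp [hc, hbin, Datum.size, Datum.fst, Datum.snd, Datum.isNil]
    · cases hbd : bin (Datum.node t (Datum.node x y)) <;>
        simp [hc, hbd, Datum.size, Datum.fst, Datum.snd]; omega
  -- The tag of a variable is `nil`, which is also the first component of the leaf. Hence the test
  -- that `d` is not `nil`.
  let node : Datum → List Bool → Bool := fun d bs =>
    (!d.isNil && eqb d.fst (Datum.ofNat 0) && rN d.snd) || (eqb d.fst (Datum.ofNat 1) && rF d.snd) ||
      (bin d && bs.all fun b => b)
  have hnode : PolyTime fun p : Datum × List Bool => node p.1 p.2 := by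
    simp only [node]; fun_prop
  classical
  have key : ∀ d : Datum, (∃ f : Formula F ℕ, Enc.code f = d) ↔
      node d ((children d).map fun d => decide (∃ f : Formula F ℕ, Enc.code f = d)) = true := by
    intro d
    simp only [node, Bool.or_eq_true, Bool.and_eq_true, eqb_iff, hN, hF]
    constructor
    · rintro ⟨f, rfl⟩
      cases f with
      | var i => exact Or.inl (Or.inl ⟨⟨rfl, rfl⟩, i, rfl⟩)
      | const a => exact Or.inl (Or.inr ⟨rfl, a, rfl⟩)
      | add f g =>
        have hb' : bin (Enc.code (Formula.add f g)) = true := by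
          simp [hbin, Enc.code, Formula.code, Datum.fst, Datum.snd, Datum.isNil]
        refine Or.inr ⟨hb', ?_⟩
        simp only [hc, hb', cond_true, List.map_cons, List.map_nil, List.all_cons, List.all_nil,
          Bool.and_true, Bool.and_eq_true, decide_eq_true_iff]
        exact ⟨⟨f, rfl⟩, ⟨g, rfl⟩⟩
      | mul f g =>
        have hb' : bin (Enc.code (Formula.mul f g)) = true := by
          simp [hbin, Enc.code, Formula.code, Datum.fst, Datum.snd, Datum.isNil]
        refine Or.inr ⟨hb', ?_⟩
        simp only [hc, hb', cond_true, List.map_cons, List.map_nil, List.all_cons, List.all_nil,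
          Bool.and_true, Bool.and_eq_true, decide_eq_true_iff]
        exact ⟨⟨f, rfl⟩, ⟨g, rfl⟩⟩
    · rintro ((⟨⟨h0, h1⟩, i, h2⟩ | ⟨h1, a, h2⟩) | ⟨h0, h1⟩)
      · cases d with
        | nil => cases h0
        | node t e =>
          simp only [Datum.fst, Datum.snd] at h1 h2
          subst h1 h2
          exact ⟨.var i, rfl⟩
      · cases d with
        | nil => cases h1
        | node t e =>
          simp only [Datum.fst, Datum.snd] at h1 h2
          subst h1 h2
          exact ⟨.const a, rfl⟩
      · simp only [hc, h0, cond_true, List.map_cons, List.map_nil, List.all_cons, List.all_nil,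
          Bool.and_true, Bool.and_eq_true, decide_eq_true_iff] at h1
        obtain ⟨⟨f, hf⟩, ⟨g, hg⟩⟩ := h1
        rcases d with _ | ⟨t, _ | ⟨x, y⟩⟩
        · simp [hbin, Datum.fst, Datum.snd, Datum.isNil] at h0
        · simp [hbin, Datum.fst, Datum.snd, Datum.isNil] at h0
        · simp only [hbin, Datum.fst, Datum.snd, Bool.and_eq_true, Bool.or_eq_true, eqb_iff] at h0 hf hg
          subst hf hg
          rcases h0.1 with rfl | rfl
          · exact ⟨.add f g, rfl⟩
          · exact ⟨.mul f g, rfl⟩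
  have h := PolyTime.treeFold (α := Unit) (τ := Datum) hchild hdec (node := fun _ d bs => node d bs)
    (hnode.comp (f := fun p : Unit × Datum × List Bool => p.2) (by fun_prop))
    (val := fun _ d => decide (∃ f : Formula F ℕ, Enc.code f = d))
    (fun _ d => by rw [Bool.eq_iff_iff, decide_eq_true_iff]; exact key d) (PolyTime.bool_bdd _)
  exact ⟨_, h.comp (f := fun d : Datum => ((), d)) (by fun_prop), fun d => by simp⟩⟩

def Formula.children : Formula F ℕ → List (Formula F ℕ)
  | .add f g => [f, g]
  | .mul f g => [f, g]
  | _ => []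

theorem Formula.children_lt (f : Formula F ℕ) : (f.children.map esize).sum < esize f := by
  cases f <;> simp [children, esize, Enc.code, Formula.code, Datum.size] <;> omega

theorem PolyTime.formulaChildren : PolyTime (Formula.children : Formula F ℕ → _) :=
  formulaCases (f := fun f => f) (by fun_prop) (v := fun _ _ => []) (by fun_prop)
    (c := fun _ _ => []) (by fun_prop) (s := fun _ f g => [f, g]) (by fun_prop)
    (m := fun _ f g => [f, g]) (by fun_prop) fun f => by cases f <;> rfl

end

/-! ## Words and coefficients in the free algebra -/

section
variable {F : Type*} [Field F] {σ : Type*}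

def word (w : List σ) : FreeAlgebra F σ := (w.map (FreeAlgebra.ι F)).prod

@[simp] theorem word_nil : (word [] : FreeAlgebra F σ) = 1 := rfl

@[simp] theorem word_cons (i : σ) (w : List σ) :
    (word (i :: w) : FreeAlgebra F σ) = FreeAlgebra.ι F i * word w := by simp [word]

theorem word_append (w w' : List σ) : (word (w ++ w') : FreeAlgebra F σ) = word w * word w' := by
  simp [word]

theorem equiv_word (w : List σ) : FreeAlgebra.equivMonoidAlgebraFreeMonoid (word w : FreeAlgebra F σ) =
    MonoidAlgebra.of F _ (FreeMonoid.ofList w) := by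
  induction w with
  | nil => simp; rfl
  | cons i w ih =>
    rw [word_cons, map_mul, ih, FreeMonoid.ofList_cons, map_mul]
    simp [FreeAlgebra.equivMonoidAlgebraFreeMonoid]

theorem basis_apply (w : List σ) :
    FreeAlgebra.basisFreeMonoid F σ (FreeMonoid.ofList w) = word w := by
  have : FreeAlgebra.equivMonoidAlgebraFreeMonoid
      (FreeAlgebra.basisFreeMonoid F σ (FreeMonoid.ofList w)) =
      MonoidAlgebra.of F _ (FreeMonoid.ofList w) := by
    simp [FreeAlgebra.basisFreeMonoid]
  rw [← equiv_word] at this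
  exact FreeAlgebra.equivMonoidAlgebraFreeMonoid.injective this

/-- The coefficient of the word `w`. -/
def ncoeff (w : List σ) : FreeAlgebra F σ →ₗ[F] F :=
  (FreeAlgebra.basisFreeMonoid F σ).coord (FreeMonoid.ofList w)

theorem ncoeff_eq (w : List σ) (p : FreeAlgebra F σ) :
    ncoeff w p = (FreeAlgebra.equivMonoidAlgebraFreeMonoid p).coeff (FreeMonoid.ofList w) := rfl

open Classical in
theorem ncoeff_word (w w' : List σ) :
    ncoeff w (word w' : FreeAlgebra F σ) = if w' = w then 1 else 0 := by
  rw [← basis_apply, ncoeff, Module.Basis.coord_apply, Module.Basis.repr_self, Finsupp.single_apply]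
  exact if_congr FreeMonoid.ofList.injective.eq_iff rfl rfl

theorem ncoeff_ext {p q : FreeAlgebra F σ} (h : ∀ w, ncoeff w p = ncoeff w q) : p = q :=
  (FreeAlgebra.basisFreeMonoid F σ).ext_elem fun m => h (FreeMonoid.toList m)

theorem word_lhom_ext {M : Type*} [AddCommMonoid M] [Module F M] {f g : FreeAlgebra F σ →ₗ[F] M}
    (h : ∀ w, f (word w) = g (word w)) : f = g :=
  (FreeAlgebra.basisFreeMonoid F σ).ext fun m => by
    have := h (FreeMonoid.toList m)
    rwa [← basis_apply] at this

theorem word_bilin_ext {M : Type*} [AddCommMonoid M] [Module F M]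
    {f g : FreeAlgebra F σ →ₗ[F] FreeAlgebra F σ →ₗ[F] M}
    (h : ∀ w w', f (word w) (word w') = g (word w) (word w')) : f = g :=
  word_lhom_ext fun w => word_lhom_ext fun w' => h w w'

theorem mem_of_word_mem {S : Submodule F (FreeAlgebra F σ)} {p : FreeAlgebra F σ}
    (h : ∀ w, ncoeff w p ≠ 0 → word w ∈ S) : p ∈ S := by
  rw [← (FreeAlgebra.basisFreeMonoid F σ).linearCombination_repr p]
  refine Submodule.sum_mem _ fun m hm => S.smul_mem _ ?_
  have := h (FreeMonoid.toList m) (Finsupp.mem_support_iff.1 hm)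
  rwa [← basis_apply] at this

/-- The linear map with given values on words. -/
def wordMap {M : Type*} [AddCommMonoid M] [Module F M] (f : List σ → M) : FreeAlgebra F σ →ₗ[F] M :=
  (FreeAlgebra.basisFreeMonoid F σ).constr F fun m => f (FreeMonoid.toList m)

@[simp] theorem wordMap_word {M : Type*} [AddCommMonoid M] [Module F M] (f : List σ → M) (w : List σ) :
    wordMap f (word w : FreeAlgebra F σ) = f w := by
  rw [← basis_apply, wordMap, Module.Basis.constr_basis]; rfl

-- Left multiplication by a variable adds a first letter to every word. Together with the case of
-- the empty word, this is the only rule about coefficients of products that the coefficient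
-- recursion for programs needs.
open Classical in
theorem ncoeff_ι_mul_cons (i x : σ) (w : List σ) (p : FreeAlgebra F σ) :
    ncoeff (x :: w) (FreeAlgebra.ι F i * p) = if i = x then ncoeff w p else 0 := by
  have : (ncoeff (x :: w)) ∘ₗ LinearMap.mulLeft F (FreeAlgebra.ι F i) =
      (if i = x then (1 : F) else 0) • ncoeff w := by
    refine word_lhom_ext fun w' => ?_
    simp only [LinearMap.comp_apply, LinearMap.mulLeft_apply, ← word_cons, ncoeff_word,
      LinearMap.smul_apply, smul_eq_mul, List.cons.injEq]
    split_ifs <;> simp_all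
  have := LinearMap.congr_fun this p
  simp only [LinearMap.comp_apply, LinearMap.mulLeft_apply, LinearMap.smul_apply, smul_eq_mul] at this
  rw [this]
  split_ifs <;> simp

theorem ncoeff_ι_mul_nil (i : σ) (p : FreeAlgebra F σ) : ncoeff [] (FreeAlgebra.ι F i * p) = 0 := by
  classical
  have : (ncoeff []) ∘ₗ LinearMap.mulLeft F (FreeAlgebra.ι F i) = 0 := by
    refine word_lhom_ext fun w' => ?_
    simp [LinearMap.comp_apply, LinearMap.mulLeft_apply, ← word_cons, ncoeff_word]
  exact LinearMap.congr_fun this p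

theorem exists_of_ncoeff_mul_ne_zero {p q : FreeAlgebra F σ} {w : List σ} (h : ncoeff w (p * q) ≠ 0) :
    ∃ u v, w = u ++ v ∧ ncoeff u p ≠ 0 ∧ ncoeff v q ≠ 0 := by
  classical
  rw [ncoeff_eq, map_mul] at h
  have := MonoidAlgebra.support_coeff_mul_subset _ _ (Finsupp.mem_support_iff.2 h)
  obtain ⟨a, ha, b, hb, hab⟩ := Finset.mem_mul.1 this
  refine ⟨FreeMonoid.toList a, FreeMonoid.toList b, ?_, ?_, ?_⟩
  · rw [← FreeMonoid.toList_mul, hab]; rfl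
  · exact Finsupp.mem_support_iff.1 ha
  · exact Finsupp.mem_support_iff.1 hb

/-- If a word factors in only one way through the supports of `p` and `q`, nothing can cancel
against that factorization. -/
theorem ncoeff_append_mul {p q : FreeAlgebra F σ} {u v : List σ}
    (h : ∀ a b, ncoeff a p ≠ 0 → ncoeff b q ≠ 0 → a ++ b = u ++ v → a = u ∧ b = v) :
    ncoeff (u ++ v) (p * q) = ncoeff u p * ncoeff v q := by
  rw [ncoeff_eq, map_mul, FreeMonoid.ofList_append]
  refine MonoidAlgebra.coeff_mul_mul_of_uniqueMul fun a b ha hb hab => ?_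
  have := h (FreeMonoid.toList a) (FreeMonoid.toList b) (Finsupp.mem_support_iff.1 ha)
    (Finsupp.mem_support_iff.1 hb) hab
  exact this

/-! ## Deleting a variable -/

open Classical in
/-- Delete all words that contain `x`. -/
def zeroMap (x : σ) : FreeAlgebra F σ →ₗ[F] FreeAlgebra F σ :=
  wordMap fun w => if x ∈ w then 0 else word w

open Classical in
/-- Delete the first `x` from the words that contain `x` and delete all other words. -/
def quotMap (x : σ) : FreeAlgebra F σ →ₗ[F] FreeAlgebra F σ :=
  wordMap fun w => if x ∈ w then word (w.erase x) else 0

theorem zeroMap_mul (x : σ) (p q : FreeAlgebra F σ) :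
    zeroMap x (p * q) = zeroMap x p * zeroMap x q := by
  classical
  have : (LinearMap.mul F (FreeAlgebra F σ)).compr₂ (zeroMap x) =
      (LinearMap.mul F (FreeAlgebra F σ)).compl₁₂ (zeroMap x) (zeroMap x) := by
    refine word_bilin_ext fun w w' => ?_
    simp only [LinearMap.compr₂_apply, LinearMap.mul_apply', LinearMap.compl₁₂_apply, ← word_append,
      zeroMap, wordMap_word, List.mem_append]
    by_cases h : x ∈ w <;> by_cases h' : x ∈ w' <;> simp [h, h', word_append]
  exact LinearMap.congr_fun₂ this p q

/-- The first `x` of a product word lies in the left factor, or else the left factor contains no `x`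
and it is the first `x` of the right factor. This twisted Leibniz rule is what makes `Formula.quot`
a formula. -/
theorem quotMap_mul (x : σ) (p q : FreeAlgebra F σ) :
    quotMap x (p * q) = quotMap x p * q + zeroMap x p * quotMap x q := by
  classical
  have : (LinearMap.mul F (FreeAlgebra F σ)).compr₂ (quotMap x) =
      (LinearMap.mul F (FreeAlgebra F σ)).compl₁₂ (quotMap x) LinearMap.id +
      (LinearMap.mul F (FreeAlgebra F σ)).compl₁₂ (zeroMap x) (quotMap x) := by
    refine word_bilin_ext fun w w' => ?_
    simp only [LinearMap.compr₂_apply, LinearMap.mul_apply', LinearMap.compl₁₂_apply, ← word_append,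
      zeroMap, quotMap, wordMap_word, List.mem_append, LinearMap.add_apply, LinearMap.id_apply]
    by_cases h : x ∈ w
    · simp [h, List.erase_append_left, word_append]
    · by_cases h' : x ∈ w' <;> simp [h, h', List.erase_append_right, word_append]
  exact LinearMap.congr_fun₂ this p q

open Classical in
/-- Substitution of `0` for `x`. -/
def Formula.zero (x : σ) : Formula F σ → Formula F σ
  | .var i => if i = x then .const 0 else .var i
  | .const a => .const a
  | .add f g => .add (f.zero x) (g.zero x)
  | .mul f g => .mul (f.zero x) (g.zero x)

open Classical in
/-- A formula for `quotMap x`. -/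
def Formula.quot (x : σ) : Formula F σ → Formula F σ
  | .var i => if i = x then .const 1 else .const 0
  | .const _ => .const 0
  | .add f g => .add (f.quot x) (g.quot x)
  | .mul f g => .add (.mul (f.quot x) g) (.mul (f.zero x) (g.quot x))

theorem algebraMap_eq_smul_word (a : F) : algebraMap F (FreeAlgebra F σ) a = a • word [] := by
  rw [word_nil, Algebra.algebraMap_eq_smul_one]

theorem Formula.eval_zero (x : σ) (f : Formula F σ) : (f.zero x).eval = zeroMap x f.eval := by
  classical
  induction f with
  | var i =>
    rw [show (Formula.var i : Formula F σ).eval = word [i] by simp [Formula.eval], zeroMap, wordMap_word]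
    by_cases h : i = x
    · subst h; simp [zero, Formula.eval]
    · simp [zero, Formula.eval, h, Ne.symm h]
  | const a => simp [zero, Formula.eval, algebraMap_eq_smul_word, -word_nil, zeroMap]
  | add f g ihf ihg => simp [zero, Formula.eval, ihf, ihg]
  | mul f g ihf ihg => simp [zero, Formula.eval, ihf, ihg, zeroMap_mul]

theorem Formula.eval_quot (x : σ) (f : Formula F σ) : (f.quot x).eval = quotMap x f.eval := by
  classical
  induction f with
  | var i =>
    rw [show (Formula.var i : Formula F σ).eval = word [i] by simp [Formula.eval], quotMap, wordMap_word]
    by_cases h : i = x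
    · subst h; simp [quot, Formula.eval]
    · simp [quot, Formula.eval, h, Ne.symm h]
  | const a => simp [quot, Formula.eval, algebraMap_eq_smul_word, -word_nil, quotMap]
  | add f g ihf ihg => simp [quot, Formula.eval, ihf, ihg]
  | mul f g ihf ihg => simp [quot, Formula.eval, ihf, ihg, quotMap_mul, Formula.eval_zero]

/-! ## Ordered polynomials -/

/-- The sorted word of a monomial. -/
def sortedWord (ord : LinearOrder σ) (m : σ →₀ ℕ) : List σ :=
  (Finsupp.toMultiset m).sort (fun i j => ord.le i j)

theorem sortedWord_pairwise (ord : LinearOrder σ) (m : σ →₀ ℕ) :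
    (sortedWord ord m).Pairwise fun i j => ord.le i j := Multiset.pairwise_sort _ _

theorem coe_sortedWord (ord : LinearOrder σ) (m : σ →₀ ℕ) :
    (sortedWord ord m : Multiset σ) = Finsupp.toMultiset m := Multiset.sort_eq _ _

theorem eq_sortedWord {ord : LinearOrder σ} {w : List σ} (hw : w.Pairwise fun i j => ord.le i j)
    {m : σ →₀ ℕ} (h : (w : Multiset σ) = Finsupp.toMultiset m) : w = sortedWord ord m := by
  refine List.Perm.eq_of_pairwise (fun a b _ _ h1 h2 => ord.le_antisymm _ _ h1 h2) hw
    (sortedWord_pairwise ord m) ?_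
  rw [← Multiset.coe_eq_coe, coe_sortedWord, h]

theorem sortedWord_injective (ord : LinearOrder σ) : Function.Injective (sortedWord ord) := by
  intro m m' h
  have := congrArg (fun w : List σ => (w : Multiset σ)) h
  simp only [coe_sortedWord] at this
  classical
  rw [← Finsupp.toMultiset_toFinsupp m, this, Finsupp.toMultiset_toFinsupp]

theorem exists_sortedWord {ord : LinearOrder σ} {w : List σ} (hw : w.Pairwise fun i j => ord.le i j) :
    ∃ m, w = sortedWord ord m := by
  classical
  exact ⟨Multiset.toFinsupp (w : Multiset σ), eq_sortedWord hw (by simp)⟩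

theorem mem_sortedWord {ord : LinearOrder σ} {m : σ →₀ ℕ} {x : σ} : x ∈ sortedWord ord m ↔ m x ≠ 0 := by
  rw [← Multiset.mem_coe, coe_sortedWord, Finsupp.mem_toMultiset, Finsupp.mem_support_iff]

/-- `bracket` as a linear map. -/
def bracketMap (ord : LinearOrder σ) : MvPolynomial σ F →ₗ[F] FreeAlgebra F σ :=
  (MvPolynomial.basisMonomials σ F).constr F fun m => word (sortedWord ord m)

theorem bracketMap_apply (ord : LinearOrder σ) (p : MvPolynomial σ F) :
    bracketMap ord p = bracket ord p := by
  rw [bracketMap, Module.Basis.constr_apply]; rfl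

theorem bracketMap_monomial (ord : LinearOrder σ) (m : σ →₀ ℕ) (a : F) :
    bracketMap ord (MvPolynomial.monomial m a) = a • word (sortedWord ord m) := by
  have : (MvPolynomial.monomial m a : MvPolynomial σ F) = a • MvPolynomial.basisMonomials σ F m := by
    simp [MvPolynomial.smul_monomial]
  rw [this, map_smul, bracketMap, Module.Basis.constr_basis]

theorem ncoeff_sortedWord (ord : LinearOrder σ) (m : σ →₀ ℕ) (p : MvPolynomial σ F) :
    ncoeff (sortedWord ord m) (bracketMap ord p) = p.coeff m := by
  classical
  have : ncoeff (sortedWord ord m) ∘ₗ bracketMap ord = MvPolynomial.lcoeff F m := by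
    refine (MvPolynomial.basisMonomials σ F).ext fun m' => ?_
    simp only [MvPolynomial.coe_basisMonomials, LinearMap.comp_apply, bracketMap_monomial, one_smul,
      ncoeff_word, (sortedWord_injective ord).eq_iff, MvPolynomial.lcoeff_apply,
      MvPolynomial.coeff_monomial]
  exact LinearMap.congr_fun this p

theorem bracketMap_injective (ord : LinearOrder σ) :
    Function.Injective (bracketMap ord : MvPolynomial σ F →ₗ[F] _) := by
  intro p q h
  ext m
  rw [← ncoeff_sortedWord ord, h, ncoeff_sortedWord]

theorem exists_of_ncoeff_bracketMap {ord : LinearOrder σ} {p : MvPolynomial σ F} {w : List σ}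
    (h : ncoeff w (bracketMap ord p) ≠ 0) : ∃ m, w = sortedWord ord m ∧ p.coeff m ≠ 0 := by
  classical
  by_contra! hne
  apply h
  rw [bracketMap, Module.Basis.constr_apply, Finsupp.sum, map_sum]
  refine Finset.sum_eq_zero fun m hm => ?_
  rw [map_smul, ncoeff_word, if_neg, smul_zero]
  rintro rfl
  exact Finsupp.mem_support_iff.1 hm (hne m rfl)

/-- All words of the polynomial are nondecreasing. -/
def SortedSupport (ord : LinearOrder σ) (h : FreeAlgebra F σ) : Prop :=
  ∀ w, ncoeff w h ≠ 0 → w.Pairwise fun i j => ord.le i j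

/-- A nondecreasing word is the sorted word of the monomial with the same multiset of letters, so
the span of the nondecreasing words is the range of the linear map `bracketMap`. -/
theorem isOrderedPoly_iff {ord : LinearOrder σ} {h : FreeAlgebra F σ} :
    IsOrderedPoly ord h ↔ SortedSupport ord h := by
  constructor
  · rintro ⟨p, rfl⟩ w hw
    rw [← bracketMap_apply] at hw
    obtain ⟨m, rfl, _⟩ := exists_of_ncoeff_bracketMap hw
    exact sortedWord_pairwise ord m
  · intro hs
    have : h ∈ LinearMap.range (bracketMap ord : MvPolynomial σ F →ₗ[F] _) := by
      refine mem_of_word_mem fun w hw => ?_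
      obtain ⟨m, rfl⟩ := exists_sortedWord (hs w hw)
      exact ⟨MvPolynomial.monomial m 1, by rw [bracketMap_monomial, one_smul]⟩
    obtain ⟨p, hp⟩ := this
    exact ⟨p, by rw [← bracketMap_apply, hp]⟩

theorem _root_.MvPolynomial.X_mul_monomial_one (x : σ) (m : σ →₀ ℕ) :
    (MvPolynomial.X x * MvPolynomial.monomial m 1 : MvPolynomial σ F) =
      MvPolynomial.monomial (m + Finsupp.single x 1) 1 := by
  rw [add_comm, MvPolynomial.monomial_single_add, pow_one]

theorem erase_sortedWord_add (ord : LinearOrder σ) [DecidableEq σ] (x : σ) (m : σ →₀ ℕ) :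
    (sortedWord ord (m + Finsupp.single x 1)).erase x = sortedWord ord m := by
  refine eq_sortedWord ((sortedWord_pairwise ord _).sublist List.erase_sublist) ?_
  rw [← Multiset.coe_erase, coe_sortedWord, map_add, Finsupp.toMultiset_single, one_smul,
    Multiset.erase_add_right_pos _ (by simp)]
  simp

theorem quotMap_bracketMap_X_mul (ord : LinearOrder σ) (x : σ) (p : MvPolynomial σ F) :
    quotMap x (bracketMap ord (MvPolynomial.X x * p)) = bracketMap ord p := by
  classical
  have : quotMap x ∘ₗ bracketMap ord ∘ₗ LinearMap.mulLeft F (MvPolynomial.X x : MvPolynomial σ F) =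
      bracketMap ord := by
    refine (MvPolynomial.basisMonomials σ F).ext fun m => ?_
    simp only [MvPolynomial.coe_basisMonomials, LinearMap.comp_apply, LinearMap.mulLeft_apply]
    rw [MvPolynomial.X_mul_monomial_one, bracketMap_monomial, bracketMap_monomial, one_smul, one_smul,
      quotMap, wordMap_word, if_pos (by rw [mem_sortedWord]; simp), erase_sortedWord_add]
  exact LinearMap.congr_fun this p

theorem zeroMap_bracketMap_X_mul (ord : LinearOrder σ) (x : σ) (p : MvPolynomial σ F) :
    zeroMap x (bracketMap ord (MvPolynomial.X x * p)) = 0 := by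
  classical
  have : zeroMap x ∘ₗ bracketMap ord ∘ₗ LinearMap.mulLeft F (MvPolynomial.X x : MvPolynomial σ F) =
      0 := by
    refine (MvPolynomial.basisMonomials σ F).ext fun m => ?_
    simp only [MvPolynomial.coe_basisMonomials, LinearMap.comp_apply, LinearMap.mulLeft_apply]
    rw [MvPolynomial.X_mul_monomial_one, bracketMap_monomial, one_smul, zeroMap, wordMap_word,
      if_pos (by rw [mem_sortedWord]; simp)]
    rfl
  exact LinearMap.congr_fun this p

theorem eq_zero_of_apply_word {f : FreeAlgebra F σ →ₗ[F] FreeAlgebra F σ} {p : FreeAlgebra F σ}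
    (h : ∀ w, ncoeff w p ≠ 0 → f (word w) = 0) : f p = 0 :=
  LinearMap.mem_ker.1 (mem_of_word_mem fun w hw => LinearMap.mem_ker.2 (h w hw))

/-- Division with remainder by `x`. The words of the remainder contain no `x`, so `zeroMap` fixes it
and `quotMap` kills it. -/
theorem exists_eq_X_mul_add (ord : LinearOrder σ) (x : σ) (q : MvPolynomial σ F) :
    ∃ q₁ q₀, q = MvPolynomial.X x * q₁ + q₀ ∧ zeroMap x (bracketMap ord q₀) = bracketMap ord q₀ ∧
      quotMap x (bracketMap ord q₀) = 0 ∧ ∀ m, q₁.coeff m = q.coeff (Finsupp.single x 1 + m) := by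
  classical
  refine ⟨q.divMonomial (Finsupp.single x 1), q.modMonomial (Finsupp.single x 1),
    (q.divMonomial_add_modMonomial_single x).symm, ?_, ?_, fun m => by simp⟩
  all_goals
    have key : ∀ w, ncoeff w (bracketMap ord (q.modMonomial (Finsupp.single x 1))) ≠ 0 → x ∉ w := by
      intro w hw
      obtain ⟨m, rfl, hm⟩ := exists_of_ncoeff_bracketMap hw
      intro hx
      rw [mem_sortedWord] at hx
      refine hm (MvPolynomial.coeff_modMonomial_of_le _ ?_)
      rw [Finsupp.single_le_iff]
      omega
  · have : (zeroMap x - LinearMap.id : FreeAlgebra F σ →ₗ[F] _) (bracketMap ord (q.modMonomial (Finsupp.single x 1))) = 0 := by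
      refine eq_zero_of_apply_word fun w hw => ?_
      simp [zeroMap, key w hw]
    rwa [LinearMap.sub_apply, LinearMap.id_apply, sub_eq_zero] at this
  · refine eq_zero_of_apply_word fun w hw => ?_
    simp [quotMap, key w hw]

/-- The multiplication rule is tested backwards, by dividing `q` by `x`. Multiplying `bracket ord p`
by `x` on the left would in general not give an ordered polynomial, and `x` would have to be
inserted in the middle of words. -/
theorem eq_X_mul_iff (ord : LinearOrder σ) (x : σ) (p q : MvPolynomial σ F) :
    q = MvPolynomial.X x * p ↔ zeroMap x (bracketMap ord q) = 0 ∧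
      quotMap x (bracketMap ord q) = bracketMap ord p := by
  constructor
  · rintro rfl
    exact ⟨zeroMap_bracketMap_X_mul ord x p, quotMap_bracketMap_X_mul ord x p⟩
  · rintro ⟨h1, h2⟩
    obtain ⟨q₁, q₀, rfl, h3, h4, _⟩ := exists_eq_X_mul_add ord x q
    rw [map_add, map_add, zeroMap_bracketMap_X_mul, zero_add, h3] at h1
    rw [map_add, map_add, quotMap_bracketMap_X_mul, h4, add_zero] at h2
    rw [bracketMap_injective ord h2, bracketMap_injective ord (h1.trans (map_zero _).symm), add_zero]

/-- Deleting one `x` is injective on the sorted words that contain `x`, so no cancellation occurs.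
Without order this fails: `quotMap x` sends `x y - y x` to `0` for `x ≠ y`. -/
theorem quotMap_ne_zero_iff {ord : LinearOrder σ} {h : FreeAlgebra F σ} (hs : SortedSupport ord h)
    {x : σ} : quotMap x h ≠ 0 ↔ ∃ w, ncoeff w h ≠ 0 ∧ x ∈ w := by
  obtain ⟨q, hq⟩ := isOrderedPoly_iff.2 hs
  rw [← bracketMap_apply] at hq
  subst hq
  constructor
  · intro hne
    by_contra! hx
    exact hne (eq_zero_of_apply_word fun w hw => by simp [quotMap, hx w hw])
  · rintro ⟨w, hw, hx⟩ h0
    obtain ⟨m, rfl, hm⟩ := exists_of_ncoeff_bracketMap hw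
    rw [mem_sortedWord] at hx
    obtain ⟨q₁, q₀, hq, _, h4, h5⟩ := exists_eq_X_mul_add ord x q
    have h6 : q₁ = 0 := by
      refine bracketMap_injective ord ?_
      rw [map_zero, ← h0, hq, map_add, map_add, quotMap_bracketMap_X_mul, h4, add_zero]
    refine hm ?_
    have := h5 (m - Finsupp.single x 1)
    rw [h6, add_tsub_cancel_of_le] at this
    · simpa using this.symm
    · rw [Finsupp.single_le_iff]; omega

/-- A letter of the nonempty overlap `c` mediates between the letters of `a` and those of `b`. -/
theorem pairwise_append_trans {ord : LinearOrder σ} {a c b : List σ} (hc : c ≠ [])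
    (h1 : (a ++ c).Pairwise fun i j => ord.le i j) (h2 : (c ++ b).Pairwise fun i j => ord.le i j) :
    (a ++ (c ++ b)).Pairwise fun i j => ord.le i j := by
  obtain ⟨y, hy⟩ := List.exists_mem_of_ne_nil c hc
  rw [List.pairwise_append] at h1 ⊢
  refine ⟨h1.1, h2, fun i hi j hj => ?_⟩
  rcases List.mem_append.1 hj with hj | hj
  · exact h1.2.2 i hi j hj
  · exact ord.le_trans _ _ _ (h1.2.2 i hi y hy) ((List.pairwise_append.1 h2).2.2 y hy j hj)

/-- Suppose that `x` occurs in a word `u` of `f`, that `y` occurs in a word `v` of `g`, and that `x`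
is not below `y`. Then `u ++ v` is unsorted. A second factorization of it into a word of `f` and a
word of `g` would cut it at another place. Both cuts give sorted pieces with a nonempty overlap, and
these glue to a sorted word. So the factorization is unique and `u ++ v` survives in the product. -/
theorem sortedSupport_mul_iff {ord : LinearOrder σ} {f g : FreeAlgebra F σ}
    (hf : SortedSupport ord f) (hg : SortedSupport ord g) :
    SortedSupport ord (f * g) ↔ ∀ x y, quotMap x f ≠ 0 → quotMap y g ≠ 0 → ord.le x y := by
  constructor
  · intro h x y hx hy
    obtain ⟨u, hu, hxu⟩ := (quotMap_ne_zero_iff hf).1 hx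
    obtain ⟨v, hv, hyv⟩ := (quotMap_ne_zero_iff hg).1 hy
    by_contra hxy
    have hns : ¬ (u ++ v).Pairwise fun i j => ord.le i j := fun hp =>
      hxy ((List.pairwise_append.1 hp).2.2 x hxu y hyv)
    refine hns (h _ ?_)
    rw [ncoeff_append_mul]
    · exact mul_ne_zero hu hv
    · intro a b ha hb hab
      rcases List.append_eq_append_iff.1 hab with ⟨c, h1, h2⟩ | ⟨c, h1, h2⟩
      · subst h1 h2
        by_cases hc : c = []
        · subst hc; simp
        · refine absurd ?_ hns
          rw [List.append_assoc]
          exact pairwise_append_trans hc (hf _ hu) (hg _ hb)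
      · subst h1 h2
        by_cases hc : c = []
        · subst hc; simp
        · exact absurd (pairwise_append_trans hc (hf _ ha) (hg _ hv)) hns
  · intro h w hw
    obtain ⟨u, v, rfl, hu, hv⟩ := exists_of_ncoeff_mul_ne_zero hw
    rw [List.pairwise_append]
    exact ⟨hf u hu, hg v hv, fun x hx y hy => h x y ((quotMap_ne_zero_iff hf).2 ⟨u, hu, hx⟩)
      ((quotMap_ne_zero_iff hg).2 ⟨v, hv, hy⟩)⟩

end

section
variable {F : Type*} [Field F] {σ : Type*}

/-! ## Ordered formulas and proofs in terms of identities -/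

/-- At every product node, the variables in `X` that occur on the left are below those that occur on
the right. -/
def Formula.SortedOn (X : Set σ) (le : σ → σ → Prop) : Formula F σ → Prop
  | .var _ => True
  | .const _ => True
  | .add f g => f.SortedOn X le ∧ g.SortedOn X le
  | .mul f g => (∀ x ∈ X, ∀ y ∈ X, (f.quot x).eval ≠ 0 → (g.quot y).eval ≠ 0 → le x y) ∧
      f.SortedOn X le ∧ g.SortedOn X le

theorem Formula.IsOrdered.isOrderedPoly {ord : LinearOrder σ} {f : Formula F σ} (h : f.IsOrdered ord) :
    IsOrderedPoly ord f.eval := by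
  cases f with
  | var i => exact h
  | const a => exact h
  | add f g => exact h.1
  | mul f g => exact h.1

theorem isOrderedPoly_word {ord : LinearOrder σ} {w : List σ} (hw : w.Pairwise fun i j => ord.le i j) :
    IsOrderedPoly ord (word w : FreeAlgebra F σ) := by
  classical
  rw [isOrderedPoly_iff]
  intro v hv
  rw [ncoeff_word] at hv
  by_cases h : w = v
  · exact h ▸ hw
  · simp [h] at hv

theorem IsOrderedPoly.add {ord : LinearOrder σ} {h k : FreeAlgebra F σ} (hh : IsOrderedPoly ord h)
    (hk : IsOrderedPoly ord k) : IsOrderedPoly ord (h + k) := by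
  obtain ⟨p, rfl⟩ := hh
  obtain ⟨q, rfl⟩ := hk
  exact ⟨p + q, by rw [← bracketMap_apply, map_add, bracketMap_apply, bracketMap_apply]⟩

theorem IsOrderedPoly.smul {ord : LinearOrder σ} {h : FreeAlgebra F σ} (hh : IsOrderedPoly ord h)
    (a : F) : IsOrderedPoly ord (a • h) := by
  obtain ⟨p, rfl⟩ := hh
  exact ⟨a • p, by rw [← bracketMap_apply, map_smul, bracketMap_apply]⟩

theorem isOrderedPoly_ι {ord : LinearOrder σ} (i : σ) :
    IsOrderedPoly ord (FreeAlgebra.ι F i : FreeAlgebra F σ) := by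
  simpa using isOrderedPoly_word (F := F) (ord := ord) (w := [i]) (by simp)

theorem isOrderedPoly_algebraMap {ord : LinearOrder σ} (a : F) :
    IsOrderedPoly ord (algebraMap F (FreeAlgebra F σ) a) := by
  rw [algebraMap_eq_smul_word]
  exact (isOrderedPoly_word (by simp)).smul a

/-- Leaves are ordered and sums of ordered polynomials are ordered, so only the product nodes impose
a condition. -/
theorem isOrdered_iff {ord : LinearOrder σ} {f : Formula F σ} :
    f.IsOrdered ord ↔ f.SortedOn Set.univ fun i j => ord.le i j := by
  induction f with
  | var i => exact ⟨fun _ => trivial, fun _ => isOrderedPoly_ι i⟩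
  | const a => exact ⟨fun _ => trivial, fun _ => isOrderedPoly_algebraMap a⟩
  | add f g ihf ihg =>
    rw [Formula.SortedOn, ← ihf, ← ihg, Formula.IsOrdered]
    exact ⟨fun h => h.2, fun h => ⟨h.1.isOrderedPoly.add h.2.isOrderedPoly, h⟩⟩
  | mul f g ihf ihg =>
    rw [Formula.SortedOn, ← ihf, ← ihg, Formula.IsOrdered]
    refine and_congr_left fun h => ?_
    rw [isOrderedPoly_iff, Formula.eval, sortedSupport_mul_iff
      (isOrderedPoly_iff.1 h.1.isOrderedPoly) (isOrderedPoly_iff.1 h.2.isOrderedPoly)]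
    simp [Formula.eval_quot]

/-- The formula `x - x * x`. -/
def boolFormula (x : σ) : Formula F σ :=
  .add (.var x) (.mul (.const (-1)) (.mul (.var x) (.var x)))

theorem eval_boolFormula (ord : LinearOrder σ) (x : σ) : (boolFormula x : Formula F σ).eval =
    bracketMap ord (MvPolynomial.X x * (1 - MvPolynomial.X x)) := by
  have h : (MvPolynomial.X x * (1 - MvPolynomial.X x) : MvPolynomial σ F) =
      MvPolynomial.monomial (Finsupp.single x 1) 1 - MvPolynomial.monomial (Finsupp.single x 2) 1 := by
    rw [← MvPolynomial.X_pow_eq_monomial, ← MvPolynomial.X_pow_eq_monomial]; ring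
  rw [h, map_sub, bracketMap_monomial, bracketMap_monomial,
    ← eq_sortedWord (w := [x]) (by simp) (by simp),
    ← eq_sortedWord (w := [x, x]) (by simp) (by simp [two_smul]; rfl)]
  simp [boolFormula, Formula.eval, sub_eq_add_neg]

/-- `f` may be written as a line after the lines `prev`. -/
def LineOK (X : Set σ) (Qs prev : List (Formula F σ)) (f : Formula F σ) : Prop :=
  (∃ q ∈ Qs, f.eval = q.eval) ∨
  (∃ x ∈ X, f.eval = (boolFormula x).eval) ∨
  (∃ h ∈ prev, ∃ r ∈ X, (f.zero r).eval = 0 ∧ (f.quot r).eval = h.eval) ∨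
  (∃ h ∈ prev, ∃ h' ∈ prev, ∃ a b : F, f.eval = a • h.eval + b • h'.eval)

/-- Every entry of the list is related to the list of its predecessors. -/
def Lines {α : Type*} (L : List α → α → Prop) (l : List α) : Prop :=
  ∀ (i : ℕ) (hi : i < l.length), L (l.take i) l[i]

theorem lines_nil {α : Type*} (L : List α → α → Prop) : Lines L [] := fun _ hi => by simp at hi

theorem lines_concat {α : Type*} {L : List α → α → Prop} {l : List α} {a : α} :
    Lines L (l ++ [a]) ↔ Lines L l ∧ L l a := by
  constructor
  · intro h
    refine ⟨fun i hi => ?_, ?_⟩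
    · have := h i (by simp; omega)
      rwa [List.take_append_of_le_length hi.le, List.getElem_append_left hi] at this
    · have := h l.length (by simp)
      simpa using this
  · rintro ⟨h1, h2⟩ i hi
    rcases Nat.lt_or_ge i l.length with hl | hl
    · rw [List.take_append_of_le_length hl.le, List.getElem_append_left hl]
      exact h1 i hl
    · obtain rfl : i = l.length := by simp at hi; omega
      simpa using h2

/-- `π` proves `g` from `Qs`, with bounded quantifiers and in terms of identities between the
polynomials computed by formulas. -/
def ProofSpec (X : Set σ) (le : σ → σ → Prop) (Qs : List (Formula F σ)) (g : Formula F σ)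
    (π : List (Formula F σ)) : Prop :=
  (∀ f ∈ Qs, f.SortedOn X le) ∧ g.SortedOn X le ∧ (∀ f ∈ π, f.SortedOn X le) ∧
  (∃ f, π.getLast? = some f ∧ f.eval = g.eval) ∧ Lines (LineOK X Qs) π

open Classical in
/-- The commutative polynomial computed by an ordered formula. -/
def Formula.poly (ord : LinearOrder σ) (f : Formula F σ) : MvPolynomial σ F :=
  if h : IsOrderedPoly ord f.eval then h.choose else 0

theorem Formula.IsOrdered.eval_eq {ord : LinearOrder σ} {f : Formula F σ} (h : f.IsOrdered ord) :
    f.eval = bracketMap ord (f.poly ord) := by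
  rw [Formula.poly, dif_pos h.isOrderedPoly, bracketMap_apply]
  exact h.isOrderedPoly.choose_spec.symm

theorem computes_iff {ord : LinearOrder σ} {f : Formula F σ} {p : MvPolynomial σ F} :
    f.Computes ord p ↔ f.IsOrdered ord ∧ f.poly ord = p := by
  refine and_congr_right fun h => ?_
  rw [h.eval_eq, ← bracketMap_apply, (bracketMap_injective ord).eq_iff]

theorem forall₂_computes_iff {ord : LinearOrder σ} {fs : List (Formula F σ)}
    {ps : List (MvPolynomial σ F)} : List.Forall₂ (Formula.Computes ord) fs ps ↔
      (∀ f ∈ fs, f.IsOrdered ord) ∧ fs.map (Formula.poly ord) = ps := by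
  induction fs generalizing ps with
  | nil => simp [eq_comm]
  | cons f fs ih =>
    cases ps with
    | nil => simp
    | cons p ps =>
      rw [List.forall₂_cons, ih, computes_iff]
      simp only [List.mem_cons, forall_eq_or_imp, List.map_cons, List.cons.injEq]
      tauto

theorem lineOK_iff {ord : LinearOrder σ} {Qs prev : List (Formula F σ)} {f : Formula F σ}
    (hQ : ∀ q ∈ Qs, q.IsOrdered ord) (hprev : ∀ q ∈ prev, q.IsOrdered ord) (hf : f.IsOrdered ord) :
    LineOK Set.univ Qs prev f ↔
      IsPCLine (Qs.map (Formula.poly ord)) (prev.map (Formula.poly ord)) (f.poly ord) := by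
  unfold LineOK IsPCLine
  have inj : Function.Injective (bracketMap ord : MvPolynomial σ F →ₗ[F] _) := bracketMap_injective ord
  refine or_congr ?_ (or_congr ?_ (or_congr ?_ ?_))
  · rw [List.mem_map]
    refine exists_congr fun q => and_congr_right fun hq => ?_
    rw [hf.eval_eq, (hQ q hq).eval_eq, inj.eq_iff, eq_comm]
  · simp only [Set.mem_univ, true_and]
    refine exists_congr fun x => ?_
    rw [hf.eval_eq, eval_boolFormula ord, inj.eq_iff]
  · simp only [Set.mem_univ, true_and, List.mem_map, exists_exists_and_eq_and]
    refine exists_congr fun h => and_congr_right fun hh => exists_congr fun r => ?_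
    rw [eq_X_mul_iff ord, ← hf.eval_eq, ← (hprev h hh).eval_eq, Formula.eval_zero, Formula.eval_quot]
  · simp only [List.mem_map, exists_exists_and_eq_and]
    refine exists_congr fun h => and_congr_right fun hh => exists_congr fun h' =>
      and_congr_right fun hh' => exists_congr fun a => exists_congr fun b => ?_
    rw [hf.eval_eq, (hprev h hh).eval_eq, (hprev h' hh').eval_eq, ← map_smul, ← map_smul, ← map_add,
      inj.eq_iff, MvPolynomial.smul_eq_C_mul, MvPolynomial.smul_eq_C_mul]

/-- An ordered formula determines its commutative polynomial because `bracketMap` is injective. The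
existential quantifier over the PC proof therefore disappears. -/
theorem isOFPCProof_iff {ord : LinearOrder σ} {Qs : List (Formula F σ)} {qs : List (MvPolynomial σ F)}
    {g : Formula F σ} {h : MvPolynomial σ F} {π : List (Formula F σ)}
    (hQ : List.Forall₂ (Formula.Computes ord) Qs qs) (hg : g.Computes ord h) :
    IsOFPCProof ord qs h π ↔ ProofSpec Set.univ (fun i j => ord.le i j) Qs g π := by
  rw [forall₂_computes_iff] at hQ
  rw [computes_iff] at hg
  obtain ⟨hQ, rfl⟩ := hQ
  obtain ⟨hg, rfl⟩ := hg
  have hline : ∀ π : List (Formula F σ), (∀ f ∈ π, f.IsOrdered ord) →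
      (Lines (IsPCLine (Qs.map (Formula.poly ord))) (π.map (Formula.poly ord)) ↔
        Lines (LineOK Set.univ Qs) π) := by
    intro π
    induction π using List.reverseRecOn with
    | nil => intro _; exact ⟨fun _ => lines_nil _, fun _ => lines_nil _⟩
    | append_singleton π f ih =>
      intro hπ
      simp only [List.mem_append, List.mem_singleton] at hπ
      rw [List.map_append, List.map_singleton, lines_concat, lines_concat,
        ih fun f hf => hπ f (Or.inl hf),
        lineOK_iff hQ (fun f hf => hπ f (Or.inl hf)) (hπ f (Or.inr rfl))]
  unfold IsOFPCProof ProofSpec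
  simp only [forall₂_computes_iff, ← isOrdered_iff]
  constructor
  · rintro ⟨ps, ⟨h1, h2⟩, hπ, rfl⟩
    refine ⟨hQ, hg, hπ, ?_, (hline π hπ).1 h2⟩
    rw [List.getLast?_map, Option.map_eq_some_iff] at h1
    obtain ⟨f, hf, h1⟩ := h1
    exact ⟨f, hf, by rw [(hπ f (List.mem_of_getLast? hf)).eval_eq, h1, hg.eval_eq]⟩
  · rintro ⟨_, _, hπ, ⟨f, hf, h1⟩, h2⟩
    refine ⟨_, ⟨?_, (hline π hπ).2 h2⟩, hπ, rfl⟩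
    rw [List.getLast?_map, hf, Option.map_some]
    rw [(hπ f (List.mem_of_getLast? hf)).eval_eq, hg.eval_eq] at h1
    rw [bracketMap_injective ord h1]

theorem exists_isOFPCProof_iff {ord : LinearOrder σ} {Qs : List (Formula F σ)}
    {g : Formula F σ} {π : List (Formula F σ)} :
    (∃ (qs : List (MvPolynomial σ F)) (h : MvPolynomial σ F),
      List.Forall₂ (Formula.Computes ord) Qs qs ∧ g.Computes ord h ∧ IsOFPCProof ord qs h π) ↔
    ProofSpec Set.univ (fun i j => ord.le i j) Qs g π := by
  constructor
  · rintro ⟨qs, h, hQ, hg, hp⟩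
    exact (isOFPCProof_iff hQ hg).1 hp
  · intro hp
    have hQ : List.Forall₂ (Formula.Computes ord) Qs (Qs.map (Formula.poly ord)) :=
      forall₂_computes_iff.2 ⟨fun f hf => isOrdered_iff.2 (hp.1 f hf), rfl⟩
    have hg : g.Computes ord (g.poly ord) := computes_iff.2 ⟨isOrdered_iff.2 hp.2.1, rfl⟩
    exact ⟨_, _, hQ, hg, (isOFPCProof_iff hQ hg).2 hp⟩

theorem computes_one (ord : LinearOrder σ) : (Formula.const 1 : Formula F σ).Computes ord 1 := by
  refine ⟨isOrderedPoly_algebraMap 1, ?_⟩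
  rw [← bracketMap_apply, MvPolynomial.one_def, bracketMap_monomial,
    ← eq_sortedWord (w := []) (by simp) (by simp)]
  simp [Formula.eval]

/-! ## Renaming and restricting variables -/

section map
variable {τ : Type*}

def Formula.map (v : σ → τ) : Formula F σ → Formula F τ
  | .var i => .var (v i)
  | .const a => .const a
  | .add f g => .add (f.map v) (g.map v)
  | .mul f g => .mul (f.map v) (g.map v)

theorem Formula.eval_map (v : σ → τ) (f : Formula F σ) :
    (f.map v).eval = FreeAlgebra.lift F (FreeAlgebra.ι F ∘ v) f.eval := by
  induction f with
  | var i => simp [Formula.map, Formula.eval]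
  | const a => simp [Formula.map, Formula.eval]
  | add f g ihf ihg => simp [Formula.map, Formula.eval, ihf, ihg]
  | mul f g ihf ihg => simp [Formula.map, Formula.eval, ihf, ihg]

/-- Sending the variables outside the range of `v` to `0` and the others to their preimages gives a
left inverse. -/
theorem lift_ι_injective {v : σ → τ} (hv : Function.Injective v) :
    Function.Injective (FreeAlgebra.lift F (FreeAlgebra.ι F ∘ v)) := by
  classical
  let l : FreeAlgebra F τ →ₐ[F] FreeAlgebra F σ :=
    FreeAlgebra.lift F fun j => if h : ∃ i, v i = j then FreeAlgebra.ι F h.choose else 0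
  have : l.comp (FreeAlgebra.lift F (FreeAlgebra.ι F ∘ v)) = AlgHom.id F _ := by
    ext i
    have h : ∃ i', v i' = v i := ⟨i, rfl⟩
    simp [l, hv h.choose_spec]
  intro p q h
  have := congrArg l h
  rw [← AlgHom.comp_apply, ← AlgHom.comp_apply, ‹l.comp _ = _›] at this
  exact this

theorem Formula.zero_map {v : σ → τ} (hv : Function.Injective v) (x : σ) (f : Formula F σ) :
    (f.map v).zero (v x) = (f.zero x).map v := by
  induction f with
  | var i => by_cases h : i = x <;> simp [Formula.map, Formula.zero, h, hv.eq_iff]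
  | const a => rfl
  | add f g ihf ihg => simp [Formula.map, Formula.zero, ihf, ihg]
  | mul f g ihf ihg => simp [Formula.map, Formula.zero, ihf, ihg]

theorem Formula.quot_map {v : σ → τ} (hv : Function.Injective v) (x : σ) (f : Formula F σ) :
    (f.map v).quot (v x) = (f.quot x).map v := by
  induction f with
  | var i => by_cases h : i = x <;> simp [Formula.map, Formula.quot, h, hv.eq_iff]
  | const a => rfl
  | add f g ihf ihg => simp [Formula.map, Formula.quot, ihf, ihg]
  | mul f g ihf ihg => simp [Formula.map, Formula.quot, ihf, ihg, Formula.zero_map hv]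

theorem Formula.eval_map_eq_iff {v : σ → τ} (hv : Function.Injective v) (f g : Formula F σ) :
    (f.map v).eval = (g.map v).eval ↔ f.eval = g.eval := by
  rw [Formula.eval_map, Formula.eval_map, (lift_ι_injective hv).eq_iff]

theorem Formula.eval_map_eq_zero_iff {v : σ → τ} (hv : Function.Injective v) (f : Formula F σ) :
    (f.map v).eval = 0 ↔ f.eval = 0 := by
  rw [Formula.eval_map, map_eq_zero_iff _ (lift_ι_injective hv)]

theorem Formula.sortedOn_map {v : σ → τ} (hv : Function.Injective v) {le : σ → σ → Prop}
    {le' : τ → τ → Prop} (hle : ∀ x y, le' (v x) (v y) ↔ le x y) (f : Formula F σ) :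
    (f.map v).SortedOn (Set.range v) le' ↔ f.SortedOn Set.univ le := by
  induction f with
  | var i => rfl
  | const a => rfl
  | add f g ihf ihg => simp [Formula.map, Formula.SortedOn, ihf, ihg]
  | mul f g ihf ihg =>
    simp [Formula.map, Formula.SortedOn, ihf, ihg, Formula.quot_map hv,
      Formula.eval_map_eq_zero_iff hv, hle]

theorem lineOK_map {v : σ → τ} (hv : Function.Injective v) (Qs prev : List (Formula F σ))
    (f : Formula F σ) : LineOK (Set.range v) (Qs.map (Formula.map v)) (prev.map (Formula.map v))
      (f.map v) ↔ LineOK Set.univ Qs prev f := by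
  have hb : ∀ x, (boolFormula (v x) : Formula F τ) = (boolFormula x).map v := fun x => rfl
  have hl : ∀ (g h : Formula F σ) (a b : F), (f.map v).eval = a • (g.map v).eval + b • (h.map v).eval ↔
      f.eval = a • g.eval + b • h.eval := by
    intro g h a b
    rw [Formula.eval_map, Formula.eval_map, Formula.eval_map, ← map_smul, ← map_smul, ← map_add,
      (lift_ι_injective hv).eq_iff]
  unfold LineOK
  simp [Formula.eval_map_eq_iff hv, Formula.eval_map_eq_zero_iff hv, Formula.zero_map hv,
    Formula.quot_map hv, hb, hl]

/-- Proofs in `n` variables can be checked as proofs in the variables `ℕ`. The checker then needs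
only one type of formulas, whatever the value of `n`. -/
theorem proofSpec_map {v : σ → τ} (hv : Function.Injective v) {le : σ → σ → Prop}
    {le' : τ → τ → Prop} (hle : ∀ x y, le' (v x) (v y) ↔ le x y) (Qs : List (Formula F σ))
    (g : Formula F σ) (π : List (Formula F σ)) :
    ProofSpec (Set.range v) le' (Qs.map (Formula.map v)) (g.map v) (π.map (Formula.map v)) ↔
      ProofSpec Set.univ le Qs g π := by
  unfold ProofSpec
  refine and_congr ?_ (and_congr (Formula.sortedOn_map hv hle g) (and_congr ?_ (and_congr ?_ ?_)))
  · simp [Formula.sortedOn_map hv hle]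
  · simp [Formula.sortedOn_map hv hle]
  · simp [List.getLast?_map, Formula.eval_map_eq_iff hv]
  · induction π using List.reverseRecOn with
    | nil => exact ⟨fun _ => lines_nil _, fun _ => lines_nil _⟩
    | append_singleton π f ih =>
      rw [List.map_append, List.map_singleton, lines_concat, lines_concat, ih, lineOK_map hv]

end map

/-- All variables of the formula are in `X`. -/
def Formula.VarsIn (X : Set σ) : Formula F σ → Prop
  | .var i => i ∈ X
  | .const _ => True
  | .add f g => f.VarsIn X ∧ g.VarsIn X
  | .mul f g => f.VarsIn X ∧ g.VarsIn X

theorem Formula.VarsIn.eval_zero_eq {X : Set σ} {f : Formula F σ} (h : f.VarsIn X) {x : σ}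
    (hx : x ∉ X) : (f.zero x).eval = f.eval := by
  induction f with
  | var i =>
    have : i ≠ x := fun e => hx (e ▸ h)
    simp [Formula.zero, this]
  | const a => rfl
  | add f g ihf ihg => simp [Formula.zero, Formula.eval, ihf h.1, ihg h.2]
  | mul f g ihf ihg => simp [Formula.zero, Formula.eval, ihf h.1, ihg h.2]

theorem Formula.VarsIn.eval_quot_eq {X : Set σ} {f : Formula F σ} (h : f.VarsIn X) {x : σ}
    (hx : x ∉ X) : (f.quot x).eval = 0 := by
  induction f with
  | var i =>
    have : i ≠ x := fun e => hx (e ▸ h)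
    simp [Formula.quot, Formula.eval, this]
  | const a => simp [Formula.quot, Formula.eval]
  | add f g ihf ihg => simp [Formula.quot, Formula.eval, ihf h.1, ihg h.2]
  | mul f g ihf ihg => simp [Formula.quot, Formula.eval, ihf h.1, ihg h.2]

theorem Formula.VarsIn.sortedOn_iff {X : Set σ} {f : Formula F σ} (h : f.VarsIn X)
    {le : σ → σ → Prop} : f.SortedOn X le ↔ f.SortedOn Set.univ le := by
  induction f with
  | var i => rfl
  | const a => rfl
  | add f g ihf ihg => rw [Formula.SortedOn, Formula.SortedOn, ihf h.1, ihg h.2]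
  | mul f g ihf ihg =>
    rw [Formula.SortedOn, Formula.SortedOn, ihf h.1, ihg h.2]
    refine and_congr_left fun _ => ⟨fun hs x _ y _ hx hy => ?_, fun hs x _ y _ => hs x trivial y trivial⟩
    refine hs x ?_ y ?_ hx hy
    · by_contra hX; exact hx (h.1.eval_quot_eq hX)
    · by_contra hX; exact hy (h.2.eval_quot_eq hX)

theorem quotMap_boolFormula (x : σ) :
    quotMap x (boolFormula x : Formula F σ).eval = 1 - FreeAlgebra.ι F x := by
  classical
  rw [← Formula.eval_quot]
  simp [boolFormula, Formula.quot, Formula.zero, Formula.eval]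
  abel

theorem one_sub_ι_ne_zero (x : σ) : (1 - FreeAlgebra.ι F x : FreeAlgebra F σ) ≠ 0 := by
  classical
  intro h
  have := congrArg (ncoeff []) h
  rw [map_sub, ← word_nil, show FreeAlgebra.ι F x = word [x] by simp, ncoeff_word, ncoeff_word] at this
  simp at this

/-- The rules never need a variable `x` that does not occur in `f`. Such an `f` is not `x - x * x`,
whose quotient by `x` is `1 - x ≠ 0`. If `f` is `x` times an earlier line, then substituting `0` for
`x` both fixes `f` and kills it, so `f` computes `0` and is the combination `0 g + 0 g` of an
earlier line. -/
theorem Formula.VarsIn.lineOK_iff {X : Set σ} {Qs prev : List (Formula F σ)} {f : Formula F σ}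
    (h : f.VarsIn X) : LineOK X Qs prev f ↔ LineOK Set.univ Qs prev f := by
  constructor
  · rintro (h | ⟨x, _, h⟩ | ⟨g, hg, r, _, h⟩ | h)
    · exact Or.inl h
    · exact Or.inr (Or.inl ⟨x, trivial, h⟩)
    · exact Or.inr (Or.inr (Or.inl ⟨g, hg, r, trivial, h⟩))
    · exact Or.inr (Or.inr (Or.inr h))
  · rintro (h1 | ⟨x, _, h1⟩ | ⟨g, hg, r, _, h1, h2⟩ | h1)
    · exact Or.inl h1
    · refine Or.inr (Or.inl ⟨x, ?_, h1⟩)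
      by_contra hX
      refine one_sub_ι_ne_zero (F := F) x ?_
      rw [← quotMap_boolFormula, ← h1, ← Formula.eval_quot, h.eval_quot_eq hX]
    · by_cases hX : r ∈ X
      · exact Or.inr (Or.inr (Or.inl ⟨g, hg, r, hX, h1, h2⟩))
      · refine Or.inr (Or.inr (Or.inr ⟨g, hg, g, hg, 0, 0, ?_⟩))
        rw [← h.eval_zero_eq hX, h1]; simp
    · exact Or.inr (Or.inr (Or.inr h1))

theorem proofSpec_iff_of_varsIn {X : Set σ} {le : σ → σ → Prop} {Qs π : List (Formula F σ)}
    {g : Formula F σ} (hQ : ∀ f ∈ Qs, f.VarsIn X) (hg : g.VarsIn X) (hπ : ∀ f ∈ π, f.VarsIn X) :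
    ProofSpec X le Qs g π ↔ ProofSpec Set.univ le Qs g π := by
  unfold ProofSpec
  refine and_congr (forall₂_congr fun f hf => (hQ f hf).sortedOn_iff) (and_congr hg.sortedOn_iff
    (and_congr (forall₂_congr fun f hf => (hπ f hf).sortedOn_iff) (and_congr_right fun _ => ?_)))
  exact forall₂_congr fun i hi => (hπ _ (List.getElem_mem hi)).lineOK_iff

/-! ## Completeness -/

theorem IsPCLine.mono {Q prev prev' : List (MvPolynomial σ F)} {p : MvPolynomial σ F}
    (h : IsPCLine Q prev p) (hs : prev ⊆ prev') : IsPCLine Q prev' p := by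
  rcases h with h | h | ⟨q, hq, r, h⟩ | ⟨q, hq, q', hq', h⟩
  · exact Or.inl h
  · exact Or.inr (Or.inl h)
  · exact Or.inr (Or.inr (Or.inl ⟨q, hs hq, r, h⟩))
  · exact Or.inr (Or.inr (Or.inr ⟨q, hs hq, q', hs hq', h⟩))

theorem lines_append {Q ps qs : List (MvPolynomial σ F)} (hp : Lines (IsPCLine Q) ps)
    (hq : Lines (IsPCLine Q) qs) : Lines (IsPCLine Q) (ps ++ qs) := by
  induction qs using List.reverseRecOn with
  | nil => simpa using hp
  | append_singleton qs q ih =>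
    rw [lines_concat] at hq
    rw [← List.append_assoc, lines_concat]
    exact ⟨ih hq.1, hq.2.mono (List.subset_append_right _ _)⟩

/-- The polynomials with a PC proof from `Q`. -/
def Derivable (Q : List (MvPolynomial σ F)) (p : MvPolynomial σ F) : Prop := ∃ ps, IsPCProof Q p ps

theorem derivable_iff {Q : List (MvPolynomial σ F)} {p : MvPolynomial σ F} :
    Derivable Q p ↔ ∃ ps, Lines (IsPCLine Q) (ps ++ [p]) := by
  constructor
  · rintro ⟨ps, h1, h2⟩
    obtain ⟨qs, rfl⟩ := List.getLast?_eq_some_iff.1 h1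
    exact ⟨qs, h2⟩
  · rintro ⟨ps, h⟩
    exact ⟨ps ++ [p], by simp, h⟩

/-- The derivations of the premises are concatenated. A line stays correct when more lines precede
it. -/
theorem Derivable.of_line {Q prev : List (MvPolynomial σ F)} {p : MvPolynomial σ F}
    (h : IsPCLine Q prev p) (hprev : ∀ q ∈ prev, Derivable Q q) : Derivable Q p := by
  have : ∃ ps, prev ⊆ ps ∧ Lines (IsPCLine Q) ps := by
    clear h
    induction prev with
    | nil => exact ⟨[], by simp, lines_nil _⟩
    | cons q t ih =>
      obtain ⟨ps, h1, h2⟩ := ih fun q hq => hprev q (by simp [hq])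
      obtain ⟨qs, h3⟩ := derivable_iff.1 (hprev q (by simp))
      refine ⟨(qs ++ [q]) ++ ps, ?_, lines_append h3 h2⟩
      intro x hx
      rcases List.mem_cons.1 hx with rfl | hx
      · simp
      · simp [h1 hx]
  obtain ⟨ps, h1, h2⟩ := this
  exact derivable_iff.2 ⟨ps, lines_concat.2 ⟨h2, h.mono h1⟩⟩

theorem Derivable.linearCombination {Q : List (MvPolynomial σ F)} {p q : MvPolynomial σ F}
    (hp : Derivable Q p) (hq : Derivable Q q) (a b : F) :
    Derivable Q (MvPolynomial.C a * p + MvPolynomial.C b * q) :=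
  .of_line (prev := [p, q])
    (Or.inr (Or.inr (Or.inr ⟨p, by simp, q, by simp, a, b, rfl⟩))) (by simp [hp, hq])

theorem Derivable.mul_left {Q : List (MvPolynomial σ F)} {p : MvPolynomial σ F} (hp : Derivable Q p)
    (q : MvPolynomial σ F) : Derivable Q (q * p) := by
  induction q using MvPolynomial.induction_on with
  | C a => simpa using hp.linearCombination hp a 0
  | add q r hq hr => simpa [add_mul] using hq.linearCombination hr 1 1
  | mul_X q r hq =>
    rw [mul_comm q, mul_assoc]
    exact .of_line (prev := [q * p]) (Or.inr (Or.inr (Or.inl ⟨_, by simp, r, rfl⟩))) (by simp [hq])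

theorem derivable_one_of_not_hasZeroOneSolution {Q : List (MvPolynomial σ F)}
    (h : ¬ HasZeroOneSolution Q) : Derivable Q 1 := by
  have hmem : ∀ q ∈ Q, Derivable Q q := fun q hq => .of_line (prev := []) (Or.inl hq) (by simp)
  have hbool : ∀ i, Derivable Q (MvPolynomial.X i * (1 - MvPolynomial.X i)) := fun i =>
    .of_line (prev := []) (Or.inr (Or.inl ⟨i, rfl⟩)) (by simp)
  -- An empty system has every point as a solution. An element of `Q` is needed to derive the zero
  -- polynomial, since without axioms there would be no line to start from.
  obtain ⟨q₀, hq₀⟩ : ∃ q₀, q₀ ∈ Q := by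
    by_contra! hne
    exact h ⟨0, fun i => Or.inl rfl, fun q hq => absurd hq (hne q)⟩
  let J : Ideal (MvPolynomial σ F) :=
    { carrier := {p | Derivable Q p}
      add_mem' := fun {p q} hp hq => by simpa using hp.linearCombination hq 1 1
      zero_mem' := by simpa using (hmem q₀ hq₀).linearCombination (hmem q₀ hq₀) 0 0
      smul_mem' := fun q p hp => hp.mul_left q }
  have hJ : ∀ p, p ∈ J ↔ Derivable Q p := fun p => Iff.rfl
  rw [← hJ, ← Ideal.eq_top_iff_one]
  by_contra hJ1
  obtain ⟨M, hM, hJM⟩ := Ideal.exists_le_maximal J hJ1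
  classical
  refine h ⟨fun i => if MvPolynomial.X i ∈ M then 0 else 1, fun i => by
    by_cases hi : (MvPolynomial.X i : MvPolynomial σ F) ∈ M <;> simp [hi], fun q hq => ?_⟩
  set a : σ → F := fun i => if MvPolynomial.X i ∈ M then 0 else 1 with ha
  -- The quotient map agrees with evaluation at `a` on the variables: `M` contains `x (1 - x)`,
  -- hence `x` or `1 - x`.
  have key : (Ideal.Quotient.mkₐ F M) =
      (Algebra.ofId F (MvPolynomial σ F ⧸ M)).comp (MvPolynomial.aeval a) := by
    ext i
    simp only [Ideal.Quotient.mkₐ_eq_mk, AlgHom.comp_apply, MvPolynomial.aeval_X, ha]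
    by_cases hi : (MvPolynomial.X i : MvPolynomial σ F) ∈ M
    · rw [if_pos hi, map_zero, Ideal.Quotient.eq_zero_iff_mem]
      exact hi
    · rw [if_neg hi, map_one]
      have h1 := hM.isPrime.mem_or_mem (hJM (hbool i))
      have h2 := h1.resolve_left hi
      rw [← Ideal.Quotient.eq_zero_iff_mem, map_sub, map_one, sub_eq_zero] at h2
      exact h2.symm
  have h1 := AlgHom.congr_fun key q
  rw [Ideal.Quotient.mkₐ_eq_mk, Ideal.Quotient.eq_zero_iff_mem.2 (hJM (hmem q hq)),
    AlgHom.comp_apply] at h1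
  have hinj : Function.Injective (Algebra.ofId F (MvPolynomial σ F ⧸ M)) := by
    have := Ideal.Quotient.nontrivial_iff.2 hM.ne_top
    exact RingHom.injective (algebraMap F (MvPolynomial σ F ⧸ M))
  have h2 := (map_eq_zero_iff _ hinj).1 h1.symm
  rwa [MvPolynomial.aeval_def, Algebra.algebraMap_self, MvPolynomial.eval₂_id] at h2

theorem eval_eq_zero_of_lines {Q ps : List (MvPolynomial σ F)} (h : Lines (IsPCLine Q) ps) {a : σ → F}
    (ha : ∀ i, a i = 0 ∨ a i = 1) (hQ : ∀ q ∈ Q, MvPolynomial.eval a q = 0) :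
    ∀ p ∈ ps, MvPolynomial.eval a p = 0 := by
  induction ps using List.reverseRecOn with
  | nil => simp
  | append_singleton ps p ih =>
    rw [lines_concat] at h
    have ih := ih h.1
    intro q hq
    rcases List.mem_append.1 hq with hq | hq
    · exact ih q hq
    rw [List.mem_singleton.1 hq]
    rcases h.2 with h | ⟨i, rfl⟩ | ⟨r, hr, i, rfl⟩ | ⟨r, hr, r', hr', c, d, rfl⟩
    · exact hQ p h
    · rcases ha i with h | h <;> simp [h]
    · simp [ih r hr]
    · simp [ih r hr, ih r' hr']

/-- The product of the variables of a word. -/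
def wordFormula : List σ → Formula F σ
  | [] => .const 1
  | i :: w => .mul (.var i) (wordFormula w)

theorem eval_wordFormula (w : List σ) : (wordFormula w : Formula F σ).eval = word w := by
  induction w with
  | nil => simp [wordFormula, Formula.eval]
  | cons i w ih => simp [wordFormula, Formula.eval, ih]

theorem isOrdered_wordFormula {ord : LinearOrder σ} {w : List σ}
    (hw : w.Pairwise fun i j => ord.le i j) : (wordFormula w : Formula F σ).IsOrdered ord := by
  induction w with
  | nil => exact isOrderedPoly_algebraMap 1
  | cons i w ih =>
    refine ⟨?_, isOrderedPoly_ι i, ih hw.of_cons⟩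
    rw [← wordFormula, eval_wordFormula]
    exact isOrderedPoly_word hw

theorem exists_computes (ord : LinearOrder σ) (p : MvPolynomial σ F) :
    ∃ f : Formula F σ, f.Computes ord p := by
  induction p using MvPolynomial.induction_on' with
  | monomial m a =>
    refine ⟨.mul (.const a) (wordFormula (sortedWord ord m)), ⟨?_, isOrderedPoly_algebraMap a,
      isOrdered_wordFormula (sortedWord_pairwise ord m)⟩, ?_⟩
    · rw [Formula.eval, eval_wordFormula, Formula.eval, ← Algebra.smul_def]
      exact (isOrderedPoly_word (sortedWord_pairwise ord m)).smul a
    · rw [Formula.eval, eval_wordFormula, Formula.eval, ← Algebra.smul_def, ← bracketMap_apply,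
        bracketMap_monomial]
  | add p q hp hq =>
    obtain ⟨f, hf, hf'⟩ := hp
    obtain ⟨g, hg, hg'⟩ := hq
    refine ⟨.add f g, ⟨hf.isOrderedPoly.add hg.isOrderedPoly, hf, hg⟩, ?_⟩
    rw [Formula.eval, hf', hg', ← bracketMap_apply, ← bracketMap_apply, ← bracketMap_apply, map_add]

/-- OFPC is sound and complete. -/
theorem exists_isOFPCRefutation_iff (ord : LinearOrder σ) (Q : List (MvPolynomial σ F)) :
    (∃ π : List (Formula F σ), IsOFPCRefutation ord Q π) ↔ ¬ HasZeroOneSolution Q := by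
  constructor
  · rintro ⟨π, ps, ⟨h1, h2⟩, _⟩ ⟨a, ha, hQ⟩
    have := eval_eq_zero_of_lines h2 ha hQ 1 (List.mem_of_getLast? h1)
    simp at this
  · intro h
    obtain ⟨ps, hps⟩ := derivable_one_of_not_hasZeroOneSolution h
    choose f hf using exists_computes (F := F) ord
    refine ⟨ps.map f, ps, hps, ?_⟩
    rw [List.forall₂_map_left_iff, List.forall₂_same]
    exact fun p _ => hf p

end

/-! ## Efficiently represented fields -/

/-- A field whose encoding is efficient. -/
class EfficientField (F : Type*) [Field F] [Enc F] : Prop where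
  eff : IsEfficientEncoding (Enc.code : F → Datum)

section
variable {F : Type*} [Field F] [Enc F] [EfficientField F]

instance : LawfulEnc F := ⟨EfficientField.eff.injective⟩

instance : Recognizable F := ⟨by
  obtain ⟨r, hr, h⟩ := decidableInPolyTime_iff.1 (EfficientField.eff (F := F)).valid
  exact ⟨r, hr, h⟩⟩

namespace PolyTime
variable {α : Type u} [Enc α]

@[fun_prop]
theorem fieldAdd {f g : α → F} (hf : PolyTime f) (hg : PolyTime g) : PolyTime fun a => f a + g a :=
  (show PolyTime fun a : F × F => a.1 + a.2 from (EfficientField.eff (F := F)).add).comp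
    (f := fun a => (f a, g a)) (by fun_prop)

@[fun_prop]
theorem fieldMul {f g : α → F} (hf : PolyTime f) (hg : PolyTime g) : PolyTime fun a => f a * g a :=
  (show PolyTime fun a : F × F => a.1 * a.2 from (EfficientField.eff (F := F)).mul).comp
    (f := fun a => (f a, g a)) (by fun_prop)

@[fun_prop]
theorem fieldNeg {f : α → F} (hf : PolyTime f) : PolyTime fun a => -f a :=
  (show PolyTime fun a : F => -a from (EfficientField.eff (F := F)).neg).comp hf

@[fun_prop]
theorem fieldInv {f : α → F} (hf : PolyTime f) : PolyTime fun a => (f a)⁻¹ :=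
  (show PolyTime fun a : F => a⁻¹ from (EfficientField.eff (F := F)).inv).comp hf

@[fun_prop]
theorem fieldSub {f g : α → F} (hf : PolyTime f) (hg : PolyTime g) : PolyTime fun a => f a - g a :=
  (show PolyTime fun a => f a + -g a by fun_prop).of_code_eq fun a => by rw [sub_eq_add_neg]

end PolyTime
end

/-! ## Values of integer polynomials with bounded degree and coefficients -/

section
variable {F : Type*} [Field F]

/-- `x` is the value at `cs` of an integer polynomial of degree at most `d` whose coefficients have
absolute values of sum at most `L`. -/
def Rep (cs : List F) (d L : ℕ) (x : F) : Prop :=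
  ∃ p q : MvPolynomial (Fin cs.length) ℕ, p.totalDegree ≤ d ∧ q.totalDegree ≤ d ∧
    MvPolynomial.eval (fun _ => 1) (p + q) ≤ L ∧
    MvPolynomial.aeval cs.get p - MvPolynomial.aeval cs.get q = x

namespace Rep
variable {cs : List F} {d d' L L' : ℕ} {x y : F}

theorem mono (h : Rep cs d L x) (hd : d ≤ d') (hL : L ≤ L') : Rep cs d' L' x :=
  let ⟨p, q, h1, h2, h3, h4⟩ := h
  ⟨p, q, h1.trans hd, h2.trans hd, h3.trans hL, h4⟩

theorem zero : Rep cs 0 0 0 := ⟨0, 0, by simp, by simp, by simp, by simp⟩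

theorem one : Rep cs 0 1 1 := ⟨1, 0, by simp, by simp, by simp, by simp⟩

theorem of_mem (h : x ∈ cs) : Rep cs 1 1 x := by
  obtain ⟨i, rfl⟩ := List.get_of_mem h
  exact ⟨MvPolynomial.X i, 0, by simp, by simp, by simp, by simp⟩

theorem add (hx : Rep cs d L x) (hy : Rep cs d L' y) : Rep cs d (L + L') (x + y) := by
  obtain ⟨p, q, h1, h2, h3, rfl⟩ := hx
  obtain ⟨p', q', h1', h2', h3', rfl⟩ := hy
  refine ⟨p + p', q + q', (MvPolynomial.totalDegree_add _ _).trans (max_le h1 h1'),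
    (MvPolynomial.totalDegree_add _ _).trans (max_le h2 h2'), ?_, by simp only [map_add]; ring⟩
  simp only [map_add] at *
  omega

theorem neg (hx : Rep cs d L x) : Rep cs d L (-x) := by
  obtain ⟨p, q, h1, h2, h3, rfl⟩ := hx
  exact ⟨q, p, h2, h1, by rwa [add_comm], by ring⟩

theorem sub (hx : Rep cs d L x) (hy : Rep cs d L' y) : Rep cs d (L + L') (x - y) := by
  rw [sub_eq_add_neg]; exact hx.add hy.neg

/-- Writing values as `p - q` with coefficients in `ℕ` makes the bound on the coefficients
multiplicative: it is the evaluation of `p + q` at `1`, and the new sum is `(p + q) (p' + q')`. -/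
theorem mul (hx : Rep cs d L x) (hy : Rep cs d' L' y) : Rep cs (d + d') (L * L') (x * y) := by
  obtain ⟨p, q, h1, h2, h3, rfl⟩ := hx
  obtain ⟨p', q', h1', h2', h3', rfl⟩ := hy
  have hm : ∀ a b : MvPolynomial (Fin cs.length) ℕ, a.totalDegree ≤ d → b.totalDegree ≤ d' →
      (a * b).totalDegree ≤ d + d' := fun a b ha hb =>
    (MvPolynomial.totalDegree_mul a b).trans (Nat.add_le_add ha hb)
  refine ⟨p * p' + q * q', p * q' + q * p',
    (MvPolynomial.totalDegree_add _ _).trans (max_le (hm _ _ h1 h1') (hm _ _ h2 h2')),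
    (MvPolynomial.totalDegree_add _ _).trans (max_le (hm _ _ h1 h2') (hm _ _ h2 h1')), ?_,
    by simp only [map_add, map_mul]; ring⟩
  refine le_trans (le_of_eq ?_) (Nat.mul_le_mul h3 h3')
  simp only [map_add, map_mul]; ring

theorem sum {ι : Type*} (s : Finset ι) {f : ι → F} (h : ∀ i ∈ s, Rep cs d L (f i)) :
    Rep cs d (s.card * L) (∑ i ∈ s, f i) := by
  classical
  induction s using Finset.induction_on with
  | empty => simpa using zero.mono (Nat.zero_le _) le_rfl
  | insert i s hi ih =>
    rw [Finset.sum_insert hi, Finset.card_insert_of_notMem hi, add_comm s.card, add_mul, one_mul]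
    exact (h i (by simp)).add (ih fun j hj => h j (by simp [hj]))

theorem prod {ι : Type*} (s : Finset ι) {f : ι → F} (h : ∀ i ∈ s, Rep cs d L (f i)) :
    Rep cs (s.card * d) (L ^ s.card) (∏ i ∈ s, f i) := by
  classical
  induction s using Finset.induction_on with
  | empty => simpa using one.mono (Nat.zero_le _) le_rfl
  | insert i s hi ih =>
    rw [Finset.prod_insert hi, Finset.card_insert_of_notMem hi, add_comm s.card, add_mul, one_mul,
      pow_add, pow_one]
    exact (h i (by simp)).mul (ih fun j hj => h j (by simp [hj]))

/-- The Leibniz formula has `k!` terms, each a product of `k` entries up to sign. The factor `k!` is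
absorbed by `2 ^ (k * k)`. -/
theorem det {k b : ℕ} {A : Matrix (Fin k) (Fin k) F} (h : ∀ i j, Rep cs d (2 ^ b) (A i j)) :
    Rep cs (k * d) (2 ^ (k * k + k * b)) A.det := by
  rw [Matrix.det_apply]
  have := sum (cs := cs) (d := k * d) (L := (2 ^ b) ^ k) Finset.univ
    (f := fun σ : Equiv.Perm (Fin k) => Equiv.Perm.sign σ • ∏ i, A (σ i) i) fun σ _ => by
      have := prod (cs := cs) Finset.univ (f := fun i => A (σ i) i) fun i _ => h _ _
      rw [Finset.card_univ, Fintype.card_fin] at this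
      rcases Int.units_eq_one_or (Equiv.Perm.sign σ) with hs | hs
      · simpa [hs] using this
      · simpa [hs] using this.neg
  refine this.mono le_rfl ?_
  rw [Finset.card_univ, Fintype.card_perm, Fintype.card_fin, pow_add, ← pow_mul, mul_comm b k]
  refine Nat.mul_le_mul_right _ ?_
  rw [pow_mul]
  refine (Nat.factorial_le_pow k).trans (Nat.pow_le_pow_left ?_ k)
  exact Nat.lt_two_pow_self.le

theorem coeff_le_eval {k : ℕ} (p : MvPolynomial (Fin k) ℕ) (m : Fin k →₀ ℕ) :
    p.coeff m ≤ MvPolynomial.eval (fun _ => 1) p := by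
  classical
  rw [MvPolynomial.eval_eq]
  simp only [one_pow, Finset.prod_const_one, mul_one]
  by_cases hm : m ∈ p.support
  · exact Finset.single_le_sum (f := fun m => p.coeff m) (fun _ _ => Nat.zero_le _) hm
  · rw [MvPolynomial.notMem_support_iff.1 hm]; exact Nat.zero_le _

theorem totalDegree_map_le {σ R S : Type*} [CommSemiring R] [CommSemiring S] (f : R →+* S)
    (p : MvPolynomial σ R) : (MvPolynomial.map f p).totalDegree ≤ p.totalDegree :=
  Finset.sup_mono (MvPolynomial.support_map_subset f p)

/-- This is the only use of the assumption that codes of polynomial values do not blow up. A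
coefficient of a polynomial over `ℕ` is at most the value at `1`, so `L = 2 ^ b` bounds the
coefficients of `p - q` in absolute value. -/
theorem size (F : Type*) [Field F] [Enc F] [EfficientField F] :
    ∃ q : Polynomial ℕ, ∀ (cs : List F) (d b : ℕ) (x : F), Rep cs d (2 ^ b) x →
      esize x ≤ q.eval (esize cs + d + b) := by
  obtain ⟨B, hB⟩ := (EfficientField.eff (F := F)).size_bound
  -- The factor `2` appears because `esize cs` bounds both the number of constants and the size of
  -- each of them.
  refine ⟨B.comp (2 * Polynomial.X), fun cs d b x hx => ?_⟩
  obtain ⟨p, q, h1, h2, h3, rfl⟩ := hx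
  have h := hB cs.length d b (esize cs) (MvPolynomial.map (algebraMap ℕ ℤ) p -
    MvPolynomial.map (algebraMap ℕ ℤ) q) cs.get
    ((MvPolynomial.totalDegree_sub _ _).trans (max_le ((totalDegree_map_le _ _).trans h1)
      ((totalDegree_map_le _ _).trans h2))) (fun m => ?_)
    (fun i => (esize_lt_of_mem (List.get_mem cs i)).le)
  · rw [map_sub, MvPolynomial.aeval_map_algebraMap, MvPolynomial.aeval_map_algebraMap] at h
    refine h.trans ?_
    rw [Polynomial.eval_comp]
    refine B.eval_nat_mono ?_
    have := length_lt_esize cs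
    simp only [Polynomial.eval_mul, Polynomial.eval_ofNat, Polynomial.eval_X]
    omega
  · rw [MvPolynomial.coeff_sub, MvPolynomial.coeff_map, MvPolynomial.coeff_map]
    have e1 := coeff_le_eval p m
    have e2 := coeff_le_eval q m
    rw [map_add] at h3
    simp only [eq_natCast] at *
    generalize MvPolynomial.coeff m p = a at *
    generalize MvPolynomial.coeff m q = c at *
    generalize 2 ^ b = P at *
    have : ((a : ℤ) - (c : ℤ)).natAbs ≤ P := by omega
    simpa using this

end Rep

/-! ## Row reduction -/

/-- Padding with zeros puts lists of all lengths into one vector space, so that subspaces can be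
discussed without indexing by length. -/
def vec (l : List F) : ℕ → F := fun i => l.getD i 0

def axpy (s : F) (r c : List F) : List F := (c.zip r).map fun p => p.1 - s * p.2

theorem length_axpy {s : F} {r c : List F} (h : r.length = c.length) :
    (axpy s r c).length = c.length := by simp [axpy, h]

theorem vec_axpy {s : F} {r c : List F} (h : r.length = c.length) :
    vec (axpy s r c) = vec c - s • vec r := by
  funext i
  simp only [vec, axpy, Pi.sub_apply, Pi.smul_apply, smul_eq_mul]
  rcases Nat.lt_or_ge i c.length with hi | hi
  · rw [List.getD_eq_getElem _ _ (by simp; omega), List.getD_eq_getElem _ _ hi,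
      List.getD_eq_getElem _ _ (by omega)]
    simp
  · rw [List.getD_eq_default _ _ (by simp; omega), List.getD_eq_default _ _ hi,
      List.getD_eq_default _ _ (by omega)]
    simp

/-- A list of rows with pivot positions. -/
abbrev Rows (F : Type*) := List (ℕ × List F)

def reduce (rows : Rows F) (c : List F) : List F :=
  rows.foldl (fun c r => axpy (c.getD r.1 0) r.2 c) c

def isZero (c : List F) : Bool := c.all fun x => eqb x 0

/-- The position of the first nonzero entry. -/
def pivot (c : List F) : ℕ := c.foldr (fun x i => bif eqb x 0 then i + 1 else 0) 0

/-- The new row is scaled to have `1` at its pivot, and the pivot column is cleared in all old rows.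
With `c` already reduced, the basis stays fully reduced, so its rows are determined by their span
and the pivot positions. The entries can then be bounded without following the elimination. -/
def insertRow (rows : Rows F) (c : List F) : Rows F :=
  (pivot c, c.map fun x => x * (c.getD (pivot c) 0)⁻¹) ::
    rows.map fun r => (r.1, axpy (r.2.getD (pivot c) 0)
      (c.map fun x => x * (c.getD (pivot c) 0)⁻¹) r.2)

def addVec (rows : Rows F) (c : List F) : Rows F :=
  bif isZero (reduce rows c) then rows else insertRow rows (reduce rows c)

theorem vec_eq_zero_of_isZero {c : List F} (h : isZero c = true) : vec c = 0 := by
  funext i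
  simp only [isZero, List.all_eq_true, eqb_iff] at h
  rcases Nat.lt_or_ge i c.length with hi | hi
  · rw [vec, List.getD_eq_getElem _ _ hi]
    exact h _ (List.getElem_mem hi)
  · rw [vec, List.getD_eq_default _ _ hi]; rfl

theorem isZero_iff {c : List F} : isZero c = true ↔ vec c = 0 := by
  refine ⟨vec_eq_zero_of_isZero, fun h => ?_⟩
  simp only [isZero, List.all_eq_true, eqb_iff]
  intro x hx
  obtain ⟨i, hi, rfl⟩ := List.getElem_of_mem hx
  have := congrFun h i
  rwa [vec, List.getD_eq_getElem _ _ hi] at this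

theorem pivot_spec {c : List F} (h : isZero c = false) :
    pivot c < c.length ∧ c.getD (pivot c) 0 ≠ 0 := by
  induction c with
  | nil => simp [isZero] at h
  | cons x c ih =>
    have hp : pivot (x :: c) = bif eqb x 0 then pivot c + 1 else 0 := rfl
    cases hx : eqb x 0 with
    | true =>
      rw [hp, hx]
      have : isZero c = false := by
        simpa [isZero, hx] using h
      have := ih this
      simpa using this
    | false =>
      rw [hp, hx]
      simpa using hx

/-- The rows are a reduced basis of `S`. -/
structure Echelon (N : ℕ) (rows : Rows F) (S : Submodule F (ℕ → F)) : Prop where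
  len : ∀ r ∈ rows, r.2.length = N
  piv : ∀ r ∈ rows, r.1 < N
  delta : ∀ r ∈ rows, ∀ r' ∈ rows, vec r.2 r'.1 = if r.1 = r'.1 then 1 else 0
  nodup : (rows.map Prod.fst).Nodup
  span : Submodule.span F ((fun r : ℕ × List F => vec r.2) '' {r | r ∈ rows}) = S

theorem Echelon.nil (N : ℕ) : Echelon (F := F) N [] ⊥ :=
  ⟨by simp, by simp, by simp, by simp, by simp⟩

theorem Echelon.mem {N : ℕ} {rows : Rows F} {S : Submodule F (ℕ → F)} (h : Echelon N rows S)
    {r : ℕ × List F} (hr : r ∈ rows) : vec r.2 ∈ S := by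
  rw [← h.span]
  exact Submodule.subset_span ⟨r, hr, rfl⟩

theorem Echelon.length_le {N : ℕ} {rows : Rows F} {S : Submodule F (ℕ → F)} (h : Echelon N rows S) :
    rows.length ≤ N := by
  have := (h.nodup.subperm (l₂ := List.range N) fun x hx => by
    obtain ⟨r, hr, rfl⟩ := List.mem_map.1 hx
    exact List.mem_range.2 (h.piv r hr)).length_le
  simpa using this

/-- Each row vanishes at the pivots of the others, so a coordinate that has been cleared stays zero
in the later steps. -/
theorem Echelon.reduce {N : ℕ} {rows : Rows F} {S : Submodule F (ℕ → F)} (h : Echelon N rows S)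
    {c : List F} (hc : c.length = N) : (reduce rows c).length = N ∧
      vec (OFPC.reduce rows c) - vec c ∈ S ∧ ∀ r ∈ rows, vec (OFPC.reduce rows c) r.1 = 0 := by
  suffices ∀ t : Rows F, (∀ r ∈ t, r ∈ rows) → (OFPC.reduce t c).length = N ∧
      vec (OFPC.reduce t c) - vec c ∈ S ∧ ∀ r ∈ t, vec (OFPC.reduce t c) r.1 = 0 from
    this rows fun r hr => hr
  intro t
  induction t using List.reverseRecOn with
  | nil => intro _; exact ⟨hc, by simp [OFPC.reduce], by simp⟩
  | append_singleton t r ih =>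
    intro ht
    obtain ⟨h1, h2, h3⟩ := ih fun r hr => ht r (by simp [hr])
    have hr : r ∈ rows := ht r (by simp)
    have e : OFPC.reduce (t ++ [r]) c =
        axpy ((OFPC.reduce t c).getD r.1 0) r.2 (OFPC.reduce t c) := by simp [OFPC.reduce]
    have hlen : r.2.length = (OFPC.reduce t c).length := by rw [h1, h.len r hr]
    have hv := vec_axpy (s := (OFPC.reduce t c).getD r.1 0) hlen
    refine ⟨?_, ?_, fun r' hr' => ?_⟩
    · rw [e, length_axpy hlen, h1]
    · rw [e, hv, sub_right_comm]
      exact S.sub_mem h2 (S.smul_mem _ (h.mem hr))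
    · rw [e, hv]
      change vec (OFPC.reduce t c) r'.1 - vec (OFPC.reduce t c) r.1 * vec r.2 r'.1 = 0
      rw [h.delta r hr r' (ht r' hr')]
      rcases List.mem_append.1 hr' with hr' | hr'
      · by_cases heq : r.1 = r'.1
        · rw [heq, h3 r' hr']; simp
        · rw [h3 r' hr', if_neg heq]; simp
      · rw [List.mem_singleton.1 hr']; simp

/-- Every element of the span is the combination of the rows whose coefficients are its own values
at the pivots. A reduced vector vanishes at the pivots, so it lies in the span only if it is zero.
-/
theorem Echelon.mem_iff {N : ℕ} {rows : Rows F} {S : Submodule F (ℕ → F)} (h : Echelon N rows S)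
    {c : List F} (hc : c.length = N) : vec c ∈ S ↔ isZero (OFPC.reduce rows c) = true := by
  obtain ⟨h1, h2, h3⟩ := h.reduce hc
  rw [isZero_iff]
  constructor
  · intro hcS
    have hS : vec (OFPC.reduce rows c) ∈ S := by
      have := S.add_mem h2 hcS
      rwa [sub_add_cancel] at this
    rw [← h.span] at hS
    have key : ∀ f ∈ Submodule.span F ((fun r : ℕ × List F => vec r.2) '' {r | r ∈ rows}),
        (rows.map fun r => f r.1 • vec r.2).sum = f := by
      intro f hf
      induction hf using Submodule.span_induction with
      | mem f hf =>
        obtain ⟨r, hr, rfl⟩ := hf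
        have hr : r ∈ rows := hr
        have hsum : ∀ t : Rows F, (∀ r' ∈ t, r' ∈ rows) → (t.map Prod.fst).Nodup → 
            (t.map fun r' => vec r.2 r'.1 • vec r'.2).sum = if r.1 ∈ t.map Prod.fst then vec r.2 else 0 := by
          intro t
          induction t with
          | nil => simp
          | cons s t ih =>
            intro ht hn
            rw [List.map_cons, List.nodup_cons] at hn
            rw [List.map_cons, List.sum_cons, ih (fun r' hr' => ht r' (by simp [hr'])) hn.2,
              h.delta r hr s (ht s (by simp))]
            by_cases hrs : r.1 = s.1
            · have : r = s := List.inj_on_of_nodup_map h.nodup hr (ht s (by simp)) hrs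
              subst this
              rw [if_pos rfl, one_smul, if_neg hn.1, add_zero, if_pos (by simp)]
            · rw [if_neg hrs, zero_smul, zero_add]
              refine if_congr ?_ rfl rfl
              rw [List.map_cons, List.mem_cons, or_iff_right hrs]
        refine (hsum rows (fun _ h => h) h.nodup).trans (if_pos ?_)
        exact List.mem_map_of_mem hr
      | zero => simp
      | add f g _ _ hf hg =>
        conv_rhs => rw [← hf, ← hg]
        rw [← List.sum_map_add]
        simp [add_smul]
      | smul a f _ hf =>
        conv_rhs => rw [← hf]
        rw [List.smul_sum, List.map_map]
        simp [Function.comp_def, smul_smul]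
    rw [← key _ hS]
    refine List.sum_eq_zero fun x hx => ?_
    obtain ⟨r, hr, rfl⟩ := List.mem_map.1 hx
    rw [h3 r hr, zero_smul]
  · intro h0
    rw [h0, zero_sub] at h2
    exact (S.neg_mem_iff).1 h2

theorem vec_map_mul (c : List F) (s : F) : vec (c.map fun x => x * s) = s • vec c := by
  funext i
  simp only [vec, Pi.smul_apply, smul_eq_mul]
  rcases Nat.lt_or_ge i c.length with hi | hi
  · rw [List.getD_eq_getElem _ _ (by simpa using hi), List.getD_eq_getElem _ _ hi]
    simp [mul_comm]
  · rw [List.getD_eq_default _ _ (by simpa using hi), List.getD_eq_default _ _ hi]; simp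

theorem Echelon.insertRow {N : ℕ} {rows : Rows F} {S : Submodule F (ℕ → F)} (h : Echelon N rows S)
    {c : List F} (hc : c.length = N) (h0 : isZero c = false) (hp : ∀ r ∈ rows, vec c r.1 = 0) :
    Echelon N (insertRow rows c) (S ⊔ Submodule.span F {vec c}) := by
  obtain ⟨hlt, hne⟩ := pivot_spec h0
  have hne : vec c (pivot c) ≠ 0 := hne
  set p := pivot c with hpdef
  set c' := c.map fun x => x * (c.getD p 0)⁻¹ with hc'
  have hv' : vec c' = (vec c p)⁻¹ • vec c := vec_map_mul _ _
  have hl' : c'.length = N := by simp [hc', hc]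
  have hva : ∀ r ∈ rows, vec (axpy (r.2.getD p 0) c' r.2) = vec r.2 - vec r.2 p • vec c' := fun r hr =>
    vec_axpy (by rw [hl', h.len r hr])
  have hpne : ∀ r ∈ rows, p ≠ r.1 := by
    intro r hr hpr
    exact hne (by rw [hpr]; exact hp r hr)
  have hc'p : vec c' p = 1 := by
    rw [hv', Pi.smul_apply, smul_eq_mul, inv_mul_cancel₀ hne]
  have hc'r : ∀ r ∈ rows, vec c' r.1 = 0 := fun r hr => by
    rw [hv', Pi.smul_apply, hp r hr, smul_zero]
  have hmem : ∀ r, r ∈ OFPC.insertRow rows c ↔ r = (p, c') ∨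
      ∃ r' ∈ rows, r = (r'.1, axpy (r'.2.getD p 0) c' r'.2) := by
    intro r
    simp only [OFPC.insertRow, List.mem_cons, List.mem_map, ← hpdef, ← hc']
    exact or_congr_right (exists_congr fun r' => and_congr_right fun _ => eq_comm)
  have hc'S : vec c' ∈ S ⊔ Submodule.span F {vec c} := by
    rw [hv']
    exact Submodule.smul_mem _ _ (Submodule.mem_sup_right (Submodule.mem_span_singleton_self _))
  refine ⟨?_, ?_, ?_, ?_, ?_⟩
  · intro r hr
    rcases (hmem r).1 hr with rfl | ⟨r', hr', rfl⟩
    · exact hl'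
    · dsimp only
      rw [length_axpy (by rw [hl', h.len r' hr']), h.len r' hr']
  · intro r hr
    rcases (hmem r).1 hr with rfl | ⟨r', hr', rfl⟩
    · rw [← hc]; exact hlt
    · exact h.piv r' hr'
  · intro r hr s hs
    rcases (hmem r).1 hr with rfl | ⟨r', hr', rfl⟩ <;> rcases (hmem s).1 hs with rfl | ⟨s', hs', rfl⟩ <;>
      dsimp only
    · rw [hc'p, if_pos rfl]
    · rw [hc'r s' hs', if_neg (hpne s' hs')]
    · rw [hva r' hr', Pi.sub_apply, Pi.smul_apply, hc'p, if_neg (hpne r' hr').symm]; simp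
    · rw [hva r' hr', Pi.sub_apply, Pi.smul_apply, hc'r s' hs', h.delta r' hr' s' hs']; simp
  · rw [OFPC.insertRow, List.map_cons, List.map_map, List.nodup_cons]
    refine ⟨?_, h.nodup⟩
    intro hx
    obtain ⟨r, hr, hx⟩ := List.mem_map.1 hx
    exact hpne r hr hx.symm
  · apply le_antisymm
    · rw [Submodule.span_le]
      rintro _ ⟨r, hr, rfl⟩
      rcases (hmem r).1 hr with rfl | ⟨r', hr', rfl⟩
      · exact hc'S
      · change vec (axpy _ _ _) ∈ _
        rw [hva r' hr']
        exact Submodule.sub_mem _ (Submodule.mem_sup_left (h.mem hr')) (Submodule.smul_mem _ _ hc'S)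
    · have h1 : vec c' ∈ Submodule.span F ((fun r : ℕ × List F => vec r.2) ''
          {r | r ∈ OFPC.insertRow rows c}) := Submodule.subset_span ⟨(p, c'), (hmem _).2 (Or.inl rfl), rfl⟩
      rw [sup_le_iff, Submodule.span_singleton_le_iff_mem]
      constructor
      · rw [← h.span, Submodule.span_le]
        rintro _ ⟨r, hr, rfl⟩
        have h2 : vec (axpy (r.2.getD p 0) c' r.2) ∈ Submodule.span F ((fun r : ℕ × List F => vec r.2) ''
          {r | r ∈ OFPC.insertRow rows c}) :=
            Submodule.subset_span ⟨_, (hmem _).2 (Or.inr ⟨r, hr, rfl⟩), rfl⟩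
        rw [hva r hr] at h2
        have := Submodule.add_mem _ h2 (Submodule.smul_mem _ (vec r.2 p) h1)
        rwa [sub_add_cancel] at this
      · have := Submodule.smul_mem _ (vec c p) h1
        rwa [hv', smul_smul, mul_inv_cancel₀ hne, one_smul] at this

theorem Echelon.addVec {N : ℕ} {rows : Rows F} {S : Submodule F (ℕ → F)} (h : Echelon N rows S)
    {c : List F} (hc : c.length = N) :
    Echelon N (addVec rows c) (S ⊔ Submodule.span F {vec c}) := by
  obtain ⟨h1, h2, h3⟩ := h.reduce hc
  unfold OFPC.addVec
  cases h0 : isZero (OFPC.reduce rows c) with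
  | true =>
    have := (h.mem_iff hc).2 h0
    rw [cond_true, sup_eq_left.2 ((Submodule.span_singleton_le_iff_mem _ _).2 this)]
    exact h
  | false =>
    rw [cond_false]
    have := h.insertRow h1 h0 h3
    convert this using 1
    apply le_antisymm <;> rw [sup_le_iff, Submodule.span_singleton_le_iff_mem] <;>
      refine ⟨le_sup_left, ?_⟩
    · have := Submodule.sub_mem (S ⊔ Submodule.span F {vec (OFPC.reduce rows c)})
        (Submodule.mem_sup_right (Submodule.mem_span_singleton_self _)) (Submodule.mem_sup_left h2)
      rwa [sub_sub_cancel] at this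
    · have := Submodule.add_mem (S ⊔ Submodule.span F {vec c})
        (Submodule.mem_sup_left h2) (Submodule.mem_sup_right (Submodule.mem_span_singleton_self _))
      rwa [sub_add_cancel] at this

/-! ### Bounds on the entries of reduced bases -/

theorem Rep.getD {cs : List F} {d L : ℕ} {l : List F} (h : ∀ x ∈ l, Rep cs d L x) (i : ℕ) :
    Rep cs d L (l.getD i 0) := by
  rcases Nat.lt_or_ge i l.length with hi | hi
  · rw [List.getD_eq_getElem _ _ hi]
    exact h _ (List.getElem_mem hi)
  · rw [List.getD_eq_default _ _ hi]
    exact Rep.zero.mono (Nat.zero_le _) (Nat.zero_le _)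

/-- The entries of a reduced basis of the span of `k` vectors are bounded by Cramer's rule. -/
theorem Echelon.exists_rep {N : ℕ} {rows : Rows F} {bs : List (List F)}
    (h : Echelon N rows (Submodule.span F (vec '' {b | b ∈ bs}))) (hlen : bs.length = rows.length)
    {cs : List F} {d b : ℕ} (hbs : ∀ c ∈ bs, ∀ x ∈ c, Rep cs d (2 ^ b) x) {r : ℕ × List F}
    (hr : r ∈ rows) {x : F} (hx : x ∈ r.2) :
    ∃ num den, x = den⁻¹ * num ∧
      Rep cs (rows.length * d + d) (2 ^ (rows.length + (rows.length * rows.length + rows.length * b + b))) num ∧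
      Rep cs (rows.length * d) (2 ^ (rows.length * rows.length + rows.length * b)) den := by
  set k := rows.length with hk
  let R : Fin k → ℕ → F := fun i => vec (rows[i]).2
  let p : Fin k → ℕ := fun i => (rows[i]).1
  let B : Fin k → ℕ → F := fun i => vec (bs[i]'(by rw [hlen]; exact i.2))
  have hBrange : Set.range B = vec '' {b | b ∈ bs} := by
    ext f
    constructor
    · rintro ⟨i, rfl⟩
      exact ⟨_, List.getElem_mem _, rfl⟩
    · rintro ⟨c, hc, rfl⟩
      obtain ⟨i, hi, rfl⟩ := List.getElem_of_mem hc
      exact ⟨⟨i, by omega⟩, rfl⟩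
  have hRp : ∀ i j, R i (p j) = if i = j then 1 else 0 := by
    intro i j
    rw [show R i (p j) = _ from h.delta _ (List.getElem_mem _) _ (List.getElem_mem _)]
    refine if_congr ⟨fun hij => ?_, fun hij => by rw [hij]; rfl⟩ rfl rfl
    have := List.inj_on_of_nodup_map h.nodup (List.getElem_mem _) (List.getElem_mem _) hij
    exact Fin.ext ((List.Nodup.getElem_inj_iff (List.Nodup.of_map _ h.nodup)).1 this)
  have hC : ∀ i, ∃ C : Fin k → F, ∑ j, C j • B j = R i := fun i => by
    rw [← Submodule.mem_span_range_iff_exists_fun, hBrange]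
    exact h.mem (List.getElem_mem _)
  choose C hC using hC
  -- The columns of the generators at the pivot positions. If `C` expresses the reduced rows by the
  -- generators, then `C * A = 1`, because the reduced rows restrict to the identity matrix at the
  -- pivots. So `C` is the adjugate of `A` divided by the determinant.
  let A : Matrix (Fin k) (Fin k) F := Matrix.of fun j l => B j (p l)
  have hCA : Matrix.of C * A = 1 := by
    ext i l
    rw [Matrix.mul_apply, Matrix.one_apply, ← hRp i l, ← hC i]
    simp [A, Finset.sum_apply]
  have hinv := Matrix.inv_eq_left_inv hCA
  obtain ⟨i, hi, rfl⟩ := List.getElem_of_mem hr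
  obtain ⟨q, hq, rfl⟩ := List.getElem_of_mem hx
  have hBrep : ∀ j q, Rep cs d (2 ^ b) (B j q) := fun j q => Rep.getD (hbs _ (List.getElem_mem _)) q
  -- An entry of the adjugate is the determinant of `A` with one row replaced by a unit vector,
  -- whose entries are again bounded.
  have hAdj : ∀ i j, Rep cs (k * d) (2 ^ (k * k + k * b)) (A.adjugate i j) := by
    intro i j
    rw [Matrix.adjugate_apply]
    refine Rep.det fun i' j' => ?_
    rw [Matrix.updateRow_apply]
    split_ifs with h1
    · by_cases h2 : j' = i
      · subst h2
        simpa using Rep.one.mono (Nat.zero_le _) Nat.one_le_two_pow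
      · rw [Pi.single_eq_of_ne h2]
        exact Rep.zero.mono (Nat.zero_le _) (Nat.zero_le _)
    · exact hBrep _ _
  refine ⟨∑ j, A.adjugate ⟨i, hi⟩ j * B j q, A.det, ?_, ?_, Rep.det fun i j => hBrep _ _⟩
  · have h1 : (rows[i]).2[q] = R ⟨i, hi⟩ q := by
      simp only [R, vec]
      exact (List.getD_eq_getElem _ _ hq).symm
    have h2 : ∀ j, C ⟨i, hi⟩ j = (A.det)⁻¹ * A.adjugate ⟨i, hi⟩ j := by
      intro j
      have : Matrix.of C ⟨i, hi⟩ j = A⁻¹ ⟨i, hi⟩ j := by rw [hinv]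
      rw [Matrix.inv_def, Matrix.smul_apply, Ring.inverse_eq_inv', smul_eq_mul] at this
      exact this
    rw [h1, ← hC ⟨i, hi⟩, Finset.sum_apply, Finset.mul_sum]
    refine Finset.sum_congr rfl fun j _ => ?_
    rw [Pi.smul_apply, smul_eq_mul, h2, mul_assoc]
  · have := Rep.sum (cs := cs) (Finset.univ : Finset (Fin k)) (f := fun j => A.adjugate ⟨i, hi⟩ j * B j q)
      fun j _ => (hAdj _ j).mul (hBrep j q)
    -- The sum has `k` terms, and this factor is absorbed by `2 ^ k`.
    refine this.mono le_rfl ?_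
    rw [Finset.card_univ, Fintype.card_fin, ← pow_add, pow_add 2 k]
    exact Nat.mul_le_mul_right _ Nat.lt_two_pow_self.le

theorem rep_axpy {cs : List F} {d b : ℕ} {s : F} {r c : List F} (hs : Rep cs d (2 ^ b) s)
    (hr : ∀ x ∈ r, Rep cs 1 1 x) (hc : ∀ x ∈ c, Rep cs d (2 ^ b) x) :
    ∀ x ∈ OFPC.axpy s r c, Rep cs (d + 1) (2 ^ (b + 1)) x := by
  intro x hx
  obtain ⟨⟨y, z⟩, hyz, rfl⟩ := List.mem_map.1 hx
  have h1 := hc y (List.of_mem_zip hyz).1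
  have h2 := hs.mul (hr z (List.of_mem_zip hyz).2)
  rw [mul_one] at h2
  have := (h1.mono (Nat.le_succ d) le_rfl).sub h2
  rwa [← two_mul, ← pow_succ'] at this

/-- With the entries of the rows as constants, each elimination step is linear in the current
vector. It raises the degree by one and at most doubles the sum of the coefficients, so the growth
over all rows is linear in the exponent. -/
theorem rep_reduce {cs : List F} (rows : Rows F) (hrows : ∀ r ∈ rows, ∀ x ∈ r.2, Rep cs 1 1 x) :
    ∀ (d b : ℕ) (c : List F), (∀ x ∈ c, Rep cs d (2 ^ b) x) →
      (OFPC.reduce rows c).length ≤ c.length ∧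
      ∀ x ∈ OFPC.reduce rows c, Rep cs (d + rows.length) (2 ^ (b + rows.length)) x := by
  induction rows with
  | nil => intro d b c hc; exact ⟨le_rfl, hc⟩
  | cons r rows ih =>
    intro d b c hc
    have h := ih (fun r' hr' => hrows r' (by simp [hr'])) (d + 1) (b + 1)
      (OFPC.axpy (c.getD r.1 0) r.2 c) (rep_axpy (Rep.getD hc _) (hrows r (by simp)) hc)
    refine ⟨h.1.trans (by simp [OFPC.axpy]), ?_⟩
    rw [List.length_cons, show d + (rows.length + 1) = d + 1 + rows.length by ring,
      show b + (rows.length + 1) = b + 1 + rows.length by ring]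
    exact h.2

end

/-! ### Size bounds and running time of row reduction -/

section
variable {F : Type*} [Field F] [Enc F] [EfficientField F] {α : Type u} [Enc α]

/-- Numerator and denominator from Cramer's rule have small codes, and the running time of division
bounds the code of the quotient. The bound depends on the generators only and not on the history of
the elimination, so it does not deteriorate as rows are inserted. -/
theorem echelon_size (F : Type*) [Field F] [Enc F] [EfficientField F] :
    ∃ Q : Polynomial ℕ, ∀ (N : ℕ) (rows : Rows F) (bs : List (List F)) (cs : List F) (d b : ℕ),
      Echelon N rows (Submodule.span F (vec '' {b | b ∈ bs})) → bs.length = rows.length →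
      (∀ c ∈ bs, ∀ x ∈ c, Rep cs d (2 ^ b) x) → ∀ r ∈ rows, ∀ x ∈ r.2,
        esize x ≤ Q.eval (esize cs + d + b + rows.length) := by
  obtain ⟨q, hq⟩ := Rep.size F
  have hdiv : PolyTime fun p : F × F => p.1⁻¹ * p.2 := by fun_prop
  obtain ⟨s, hs⟩ := hdiv.size
  refine ⟨s.comp (2 * q.comp (2 * Polynomial.X + Polynomial.X * (2 * Polynomial.X + 2)) + 1),
    fun N rows bs cs d b h1 h2 h3 r hr x hx => ?_⟩
  obtain ⟨num, den, rfl, hn, hd⟩ := h1.exists_rep h2 h3 hr hx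
  refine (hs (den, num)).trans ?_
  rw [Polynomial.eval_comp]
  refine s.eval_nat_mono ?_
  have e1 := hq _ _ _ _ hn
  have e2 := hq _ _ _ _ hd
  set k := rows.length
  set e := esize cs
  have e3 : e + (k * d + d) + (k + (k * k + k * b + b)) ≤
      2 * (e + d + b + k) + (e + d + b + k) * (2 * (e + d + b + k) + 2) := by
    nlinarith [Nat.zero_le (e * e), Nat.zero_le (e * d), Nat.zero_le (d * b), Nat.zero_le (d * d),
      Nat.zero_le (b * b), Nat.zero_le (e * b), Nat.zero_le (e * k), Nat.zero_le (d * k),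
      Nat.zero_le (b * k), Nat.zero_le (k * k)]
  have e4 : e + k * d + (k * k + k * b) ≤
      2 * (e + d + b + k) + (e + d + b + k) * (2 * (e + d + b + k) + 2) := by
    refine le_trans ?_ e3
    omega
  have e1 := e1.trans (q.eval_nat_mono e3)
  have e2 := e2.trans (q.eval_nat_mono e4)
  rw [esize_prod]
  simp only [Polynomial.eval_add, Polynomial.eval_mul, Polynomial.eval_ofNat, Polynomial.eval_comp,
    Polynomial.eval_X, Polynomial.eval_one]
  omega

namespace PolyTime

@[fun_prop]
theorem axpy {s : α → F} {r c : α → List F} (hs : PolyTime s) (hr : PolyTime r) (hc : PolyTime c) :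
    PolyTime fun a => axpy (s a) (r a) (c a) := by unfold OFPC.axpy; fun_prop

@[fun_prop]
theorem isZero {c : α → List F} (hc : PolyTime c) : PolyTime fun a => isZero (c a) := by
  unfold OFPC.isZero; fun_prop

@[fun_prop]
theorem pivot {c : α → List F} (hc : PolyTime c) : PolyTime fun a => pivot (c a) := by
  have : PolyTime (OFPC.pivot : List F → ℕ) := by
    unfold OFPC.pivot
    refine foldr_of_le (l := fun c : List F => c) (by fun_prop) (i := fun _ => 0) (by fun_prop)
      (f := fun _ x i => bif OFPC.eqb x 0 then i + 1 else 0) (by fun_prop) (B := fun _ => 2)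
      (.const 2) fun a s x _ => ?_
    cases OFPC.eqb x 0 <;> simp
    omega
  exact this.comp hc

@[fun_prop]
theorem insertRow {rows : α → Rows F} {c : α → List F} (hr : PolyTime rows) (hc : PolyTime c) :
    PolyTime fun a => insertRow (rows a) (c a) := by
  unfold OFPC.insertRow
  fun_prop

@[fun_prop]
theorem reduce {rows : α → Rows F} {c : α → List F} (hr : PolyTime rows) (hc : PolyTime c) :
    PolyTime fun a => reduce (rows a) (c a) := by
  have hcs : PolyTime fun a => c a ++ (rows a).flatMap fun r => r.2 := by fun_prop
  obtain ⟨q, hq⟩ := Rep.size F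
  refine foldl (l := rows) hr hc (f := fun _ c r => OFPC.axpy (c.getD r.1 0) r.2 c) (by fun_prop)
    (B := fun a => OFPC.esize (c a) * (q.eval (OFPC.esize (c a ++ (rows a).flatMap fun r => r.2) +
      (1 + OFPC.esize (rows a)) + OFPC.esize (rows a)) + 1) + 1)
    ((hc.size.mul ((((hcs.size.add ((PolyBdd.const 1).add hr.size)).add hr.size).eval q).add
      (.const 1))).add (.const 1)) fun a k => ?_
  -- All entries of the vector and of the rows count as constants, which is why the degree starts at
  -- `1` and the exponent at `0`.
  have h := rep_reduce (cs := c a ++ (rows a).flatMap fun r => r.2) ((rows a).take k)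
    (fun r hr x hx => Rep.of_mem (List.mem_append_right _
      (List.mem_flatMap.2 ⟨r, List.mem_of_mem_take hr, hx⟩))) 1 0 (c a)
    (fun x hx => Rep.of_mem (List.mem_append_left _ hx))
  have hk : ((rows a).take k).length ≤ OFPC.esize (rows a) :=
    (List.length_take_le' _ _).trans (length_lt_esize _).le
  refine esize_list_le (h.1.trans (length_lt_esize _).le) fun x hx => ?_
  refine (hq _ _ _ _ (h.2 x hx)).trans (q.eval_nat_mono ?_)
  omega

@[fun_prop]
theorem addVec {rows : α → Rows F} {c : α → List F} (hr : PolyTime rows) (hc : PolyTime c) :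
    PolyTime fun a => addVec (rows a) (c a) := by
  unfold OFPC.addVec
  fun_prop

end PolyTime
end

/-! ## Straight-line programs for the coefficients of formulas -/

/-- The instruction `((e, a, j), (b, k), (i, c))` appends to the list of registers the value
`e + a * r_j + b * r_k + c * x_i * r_0`, where `r_0, r_1, …` are the registers, the last one first. -/
abbrev Instr (F : Type*) := (F × F × ℕ) × (F × ℕ) × (ℕ × F)

section
variable {F : Type*} [Field F] {M M' : Type*} [AddCommGroup M] [Module F M] [AddCommGroup M']
  [Module F M']

/-- The coefficient of a word `x :: w` in the value of an instruction, given these coefficients of the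
registers, the coefficient `p` of `w` in the last register and the coefficient `d` of `1`. -/
def instrVal (d : M) (x : ℕ) (cur : List M) (p : M) (I : Instr F) : M :=
  I.1.1 • d + I.1.2.1 • cur.getD I.1.2.2 0 + I.2.1.1 • cur.getD I.2.1.2 0 +
    bif eqb I.2.2.1 x then I.2.2.2 • p else 0

/-- Here `cur` holds the coefficients of the longer word computed so far, the last register first.
The value `p` is the coefficient of the shorter word in the last register. The head of `prev` is
that coefficient in the register being computed, so it becomes the next `p`. The output lists the
registers in the order of the program. -/
def trace (d : M) (x : ℕ) : List M → M → List M → List (Instr F) → List M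
  | _, _, _, [] => []
  | cur, p, prev, I :: prog => instrVal d x cur p I ::
      trace d x (instrVal d x cur p I :: cur) (prev.headD 0) prev.tail prog

/-- The coefficients of `x :: w` in the registers, given those of `w`. -/
def stepVec (d : M) (x : ℕ) (prog : List (Instr F)) (prev : List M) : List M :=
  trace d x [] 0 prev prog

theorem length_trace (d : M) (x : ℕ) (cur : List M) (p : M) (prev : List M) (prog : List (Instr F)) :
    (trace d x cur p prev prog).length = prog.length := by
  induction prog generalizing cur p prev with
  | nil => rfl
  | cons I prog ih => rw [trace, List.length_cons, ih, List.length_cons]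

theorem map_getD (g : M →ₗ[F] M') (l : List M) (i : ℕ) : (l.map g).getD i 0 = g (l.getD i 0) := by
  rw [← map_zero g, List.getD_map]

theorem map_headD (g : M →ₗ[F] M') (l : List M) : (l.map g).headD 0 = g (l.headD 0) := by
  cases l <;> simp

/-- An instruction forms linear combinations whose coefficients come from the program, so running
the program commutes with linear maps applied to the data. -/
theorem map_trace (g : M →ₗ[F] M') (d : M) (x : ℕ) (cur : List M) (p : M) (prev : List M)
    (prog : List (Instr F)) : (trace d x cur p prev prog).map g =
      trace (g d) x (cur.map g) (g p) (prev.map g) prog := by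
  induction prog generalizing cur p prev with
  | nil => rfl
  | cons I prog ih =>
    have : g (instrVal d x cur p I) = instrVal (g d) x (cur.map g) (g p) I := by
      unfold instrVal
      rw [map_getD, map_getD]
      cases eqb I.2.2.1 x <;> simp
    rw [trace, trace, List.map_cons, ih, List.map_cons, this, map_headD, List.map_tail]

/-- Reading one more letter is linear. -/
theorem exists_stepVec_linear (x : ℕ) (prog : List (Instr F)) :
    ∃ Φ : (ℕ → F) →ₗ[F] (ℕ → F), ∀ l : List F, l.length = prog.length →
      vec (stepVec 0 x prog l) = Φ (vec l) := by
  -- The program is run on the coordinate functionals in place of numbers, and the resulting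
  -- functionals are the rows of `Φ`. The constant term is `0` here, which makes the map linear and
  -- not merely affine.
  set t : List ((ℕ → F) →ₗ[F] F) := stepVec 0 x prog
    ((List.range prog.length).map fun i => LinearMap.proj i) with ht
  refine ⟨LinearMap.pi fun i => t.getD i 0, fun l hl => ?_⟩
  have h := map_trace (LinearMap.applyₗ (R := F) (M₂ := F) (vec l)) (0 : (ℕ → F) →ₗ[F] F) x [] 0
    ((List.range prog.length).map fun i => LinearMap.proj i) prog
  rw [map_zero, List.map_nil, List.map_map] at h
  have hr : (List.range prog.length).map
      ((LinearMap.applyₗ (R := F) (M₂ := F) (vec l)) ∘ fun i => LinearMap.proj i) = l := by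
    refine List.ext_getElem (by simp [hl]) fun i h1 h2 => ?_
    simp [vec, h2]
  rw [hr] at h
  funext i
  rw [vec, stepVec, ← h, map_getD]
  rfl

/-- The polynomials in the registers. -/
def symVal (cur : List (FreeAlgebra F ℕ)) (I : Instr F) : FreeAlgebra F ℕ :=
  I.1.1 • 1 + I.1.2.1 • cur.getD I.1.2.2 0 + I.2.1.1 • cur.getD I.2.1.2 0 +
    I.2.2.2 • (FreeAlgebra.ι F I.2.2.1 * cur.headD 0)

def symTrace : List (FreeAlgebra F ℕ) → List (Instr F) → List (FreeAlgebra F ℕ)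
  | _, [] => []
  | cur, I :: prog => symVal cur I :: symTrace (symVal cur I :: cur) prog

theorem length_symTrace (cur : List (FreeAlgebra F ℕ)) (prog : List (Instr F)) :
    (symTrace cur prog).length = prog.length := by
  induction prog generalizing cur with
  | nil => rfl
  | cons I prog ih => rw [symTrace, List.length_cons, ih, List.length_cons]

theorem symTrace_append (cur : List (FreeAlgebra F ℕ)) (p q : List (Instr F)) :
    symTrace cur (p ++ q) = symTrace cur p ++ symTrace ((symTrace cur p).reverse ++ cur) q := by
  induction p generalizing cur with
  | nil => rfl
  | cons I p ih => simp [symTrace, ih]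

/-- The functionals `L` and `L'` stand for the coefficients of `x :: w` and of `w`. Keeping them
abstract also covers the empty word, where `L'` is zero. -/
theorem trace_eq_map_symTrace {L L' : FreeAlgebra F ℕ →ₗ[F] F} {x : ℕ}
    (h : ∀ i p, L (FreeAlgebra.ι F i * p) = bif eqb i x then L' p else 0)
    (cur : List (FreeAlgebra F ℕ)) (prog : List (Instr F)) :
    trace (L 1) x (cur.map L) (L' (cur.headD 0)) ((symTrace cur prog).map L') prog =
      (symTrace cur prog).map L := by
  induction prog generalizing cur with
  | nil => rfl
  | cons I prog ih =>
    have hv : instrVal (L 1) x (cur.map L) (L' (cur.headD 0)) I = L (symVal cur I) := by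
      rw [instrVal, symVal, map_getD, map_getD, map_add, map_add, map_add, map_smul, map_smul, map_smul,
        map_smul, h]
      cases eqb I.2.2.1 x <;> simp
    have := ih (symVal cur I :: cur)
    rw [symTrace, trace, hv, List.map_cons, List.map_cons, List.headD_cons, List.tail_cons, ← this]
    rfl

/-- The coefficients of a word in the registers. -/
def coeffVec (prog : List (Instr F)) (w : List ℕ) : List F := (symTrace [] prog).map (ncoeff w)

theorem length_coeffVec (prog : List (Instr F)) (w : List ℕ) :
    (coeffVec prog w).length = prog.length := by rw [coeffVec, List.length_map, length_symTrace]

theorem coeffVec_cons (prog : List (Instr F)) (x : ℕ) (w : List ℕ) :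
    coeffVec prog (x :: w) = stepVec 0 x prog (coeffVec prog w) := by
  classical
  have := trace_eq_map_symTrace (F := F) (L := ncoeff (x :: w)) (L' := ncoeff w) (x := x)
    (fun i p => by
      rw [ncoeff_ι_mul_cons]
      by_cases hi : i = x <;> simp [hi, eqb]) [] prog
  rw [List.headD_nil, map_zero, ← word_nil, ncoeff_word, if_neg (by simp)] at this
  exact this.symm

/-- The empty word is treated as if it arose from a word with all coefficients zero, with the
constant term `1` switched on. Then no multiplication by a variable contributes and the letter `x`
is irrelevant. -/
theorem coeffVec_nil (prog : List (Instr F)) (x : ℕ) :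
    coeffVec prog [] = stepVec 1 x prog (prog.map fun _ => 0) := by
  classical
  have := trace_eq_map_symTrace (F := F) (L := ncoeff []) (L' := 0) (x := x)
    (fun i p => by rw [ncoeff_ι_mul_nil]; cases eqb i x <;> rfl) [] prog
  rw [← word_nil, ncoeff_word, if_pos rfl, LinearMap.zero_apply] at this
  have h0 : (symTrace [] prog).map (0 : FreeAlgebra F ℕ →ₗ[F] F) = prog.map fun _ => (0 : F) := by
    refine List.ext_getElem (by simp [length_symTrace]) fun i h1 h2 => by simp
  rw [h0] at this
  exact this.symm

/-! ## Compiling formulas -/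

def instrVar (i : ℕ) : Instr F := ((0, 0, 0), (0, 0), (i, 1))
def instrScale (a : F) (j : ℕ) : Instr F := ((0, a, j), (0, 0), (0, 0))
def instrAdd (j : ℕ) : Instr F := ((0, 1, 0), (1, j), (0, 0))
def instrOne : Instr F := ((1, 0, 0), (0, 0), (0, 0))

/-- Multiply the polynomial in the last register by the formula on the left. -/
def compile : Formula F ℕ → List (Instr F)
  | .var i => [instrVar i]
  | .const a => [instrScale a 0]
  | .add f g => compile g ++ instrScale 1 (compile g).length :: compile f ++
      [instrAdd ((compile f).length + 1)]
  | .mul f g => compile g ++ compile f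

/-- Compiling a formula as a left multiplier avoids products of registers: `f * g` acts as `g`
followed by `f`. For a sum the multiplicand `k` has to be used twice. It is copied from `(compile
g).length` registers back, and at the end `g.eval * k` is found behind the registers of `f` and that
copy. -/
theorem symTrace_compile (f : Formula F ℕ) (k : FreeAlgebra F ℕ) (cur : List (FreeAlgebra F ℕ)) :
    ∃ new, (symTrace (k :: cur) (compile f)).reverse = f.eval * k :: new ∧
      new.length + 1 = (compile f).length := by
  induction f generalizing k cur with
  | var i => exact ⟨[], by simp [compile, symTrace, symVal, instrVar, Formula.eval], rfl⟩
  | const a =>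
    exact ⟨[], by simp [compile, symTrace, symVal, instrScale, Formula.eval, Algebra.smul_def], rfl⟩
  | add f g ihf ihg =>
    obtain ⟨new, h1, h2⟩ := ihg k cur
    have hc : symVal (g.eval * k :: (new ++ k :: cur)) (instrScale 1 (compile g).length : Instr F) = k := by
      rw [← h2]
      simp [symVal, instrScale]
    obtain ⟨new', h1', h2'⟩ := ihf k (g.eval * k :: (new ++ k :: cur))
    refine ⟨f.eval * k :: new' ++ k :: g.eval * k :: new, ?_, ?_⟩
    · have e1 : (symTrace (k :: cur) (compile g)).reverse ++ k :: cur =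
          g.eval * k :: (new ++ k :: cur) := by rw [h1]; rfl
      rw [compile, List.append_assoc, symTrace_append, List.reverse_append, e1, h1, List.cons_append,
        symTrace, hc, symTrace_append, List.reverse_cons, List.reverse_append, h1']
      have hv : symVal (f.eval * k :: new' ++ k :: g.eval * k :: (new ++ k :: cur))
          (instrAdd ((compile f).length + 1) : Instr F) = (Formula.add f g).eval * k := by
        rw [← h2']
        simp [symVal, instrAdd, Formula.eval, add_mul]
      rw [symTrace, hv, symTrace]
      simp
    · simp only [compile, List.length_append, List.length_cons, List.length_nil]
      omega
  | mul f g ihf ihg =>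
    obtain ⟨new, h1, h2⟩ := ihg k cur
    obtain ⟨new', h1', h2'⟩ := ihf (g.eval * k) (new ++ k :: cur)
    refine ⟨new' ++ g.eval * k :: new, ?_, by simp [compile]; omega⟩
    have e1 : (symTrace (k :: cur) (compile g)).reverse ++ k :: cur =
      g.eval * k :: (new ++ k :: cur) := by rw [h1]; rfl
    rw [compile, symTrace_append, List.reverse_append, e1, h1, h1', Formula.eval, mul_assoc]
    rfl

theorem symTrace_instrOne_compile (f : Formula F ℕ) (cur : List (FreeAlgebra F ℕ)) (i : ℕ)
    (hi : i = (compile f).length) :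
    (symTrace cur (instrOne :: compile f)).getD i 0 = f.eval := by
  have h1 : symVal cur (instrOne : Instr F) = 1 := by simp [symVal, instrOne]
  obtain ⟨new, h2, h3⟩ := symTrace_compile f 1 cur
  rw [symTrace, h1, ← List.reverse_reverse (symTrace _ (compile f)), h2, hi, ← h3, List.getD_cons_succ,
    List.reverse_cons, List.getD_append_right _ _ _ _ (by simp)]
  simp

/-- A program for three formulas. -/
def prog₃ (f g h : Formula F ℕ) : List (Instr F) :=
  (instrOne :: compile f) ++ ((instrOne :: compile g) ++ (instrOne :: compile h))

/-- The coefficients of the three formulas. -/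
def proj₃ (f g h : Formula F ℕ) (l : List F) : List F :=
  [l.getD (compile f).length 0, l.getD ((compile f).length + 1 + (compile g).length) 0,
    l.getD ((compile f).length + 1 + ((compile g).length + 1 + (compile h).length)) 0]

theorem proj₃_coeffVec (f g h : Formula F ℕ) (w : List ℕ) :
    proj₃ f g h (coeffVec (prog₃ f g h) w) =
      [ncoeff w f.eval, ncoeff w g.eval, ncoeff w h.eval] := by
  rw [proj₃, coeffVec, prog₃, map_getD, map_getD, map_getD, symTrace_append, symTrace_append]
  have e1 := symTrace_instrOne_compile f [] _ rfl
  set t₁ := symTrace [] (instrOne :: compile f) with ht₁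
  have l1 : t₁.length = (compile f).length + 1 := length_symTrace _ _
  have e2 := symTrace_instrOne_compile g (t₁.reverse ++ []) _ rfl
  set t₂ := symTrace (t₁.reverse ++ []) (instrOne :: compile g) with ht₂
  have l2 : t₂.length = (compile g).length + 1 := length_symTrace _ _
  have e3 := symTrace_instrOne_compile h (t₂.reverse ++ (t₁.reverse ++ [])) _ rfl
  set t₃ := symTrace (t₂.reverse ++ (t₁.reverse ++ [])) (instrOne :: compile h) with ht₃
  have s1 : (t₁ ++ (t₂ ++ t₃)).getD (compile f).length 0 = f.eval := by
    rw [List.getD_append _ _ _ _ (by omega), e1]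
  have s2 : (t₁ ++ (t₂ ++ t₃)).getD ((compile f).length + 1 + (compile g).length) 0 = g.eval := by
    rw [List.getD_append_right _ _ _ _ (by omega), List.getD_append _ _ _ _ (by omega), l1,
      Nat.add_sub_cancel_left, e2]
  have s3 : (t₁ ++ (t₂ ++ t₃)).getD
      ((compile f).length + 1 + ((compile g).length + 1 + (compile h).length)) 0 = h.eval := by
    rw [List.getD_append_right _ _ _ _ (by omega), l1, Nat.add_sub_cancel_left,
      List.getD_append_right _ _ _ _ (by omega), l2, Nat.add_sub_cancel_left, e3]
  rw [s1, s2, s3]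

theorem Formula.VarsIn.mem_of_ncoeff {σ : Type*} {X : Set σ} {f : Formula F σ} (hf : f.VarsIn X)
    {w : List σ} (hw : ncoeff w f.eval ≠ 0) : ∀ x ∈ w, x ∈ X := by
  classical
  induction f generalizing w with
  | var i =>
    rw [show (Formula.var i : Formula F σ).eval = word [i] by simp [Formula.eval], ncoeff_word] at hw
    by_cases h : [i] = w
    · subst h
      have : i ∈ X := hf
      simpa using this
    · simp [h] at hw
  | const a =>
    rw [show (Formula.const a : Formula F σ).eval = a • word [] from algebraMap_eq_smul_word a,
      map_smul, ncoeff_word] at hw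
    by_cases h : [] = w
    · simp [← h]
    · simp [h] at hw
  | add f g ihf ihg =>
    rw [Formula.eval, map_add] at hw
    by_cases h : ncoeff w f.eval = 0
    · rw [h, zero_add] at hw
      exact ihg hf.2 hw
    · exact ihf hf.1 h
  | mul f g ihf ihg =>
    obtain ⟨u, v, rfl, hu, hv⟩ := exists_of_ncoeff_mul_ne_zero hw
    intro x hx
    rcases List.mem_append.1 hx with hx | hx
    · exact ihf hf.1 hu x hx
    · exact ihg hf.2 hv x hx

/-! ## The span of the coefficient vectors -/

/-- One step of the search: the state consists of a reduced basis and of a list of vectors that have to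
be added to it. -/
def searchStep (n : ℕ) (prog : List (Instr F)) (s : Rows F × List (List F)) : Rows F × List (List F) :=
  bif s.2.isEmpty then s else
  bif isZero (reduce s.1 (s.2.headD [])) then (s.1, s.2.tail) else
    (addVec s.1 (s.2.headD []),
      (List.range n).map (fun x => stepVec 0 x prog (s.2.headD [])) ++ s.2.tail)

def searchInit (prog : List (Instr F)) : Rows F × List (List F) :=
  ([], [stepVec 1 0 prog (prog.map fun _ => 0)])

/-- A reduced basis of the span of the coefficient vectors of the words in `x_0, …, x_{n-1}`. -/
def search (n : ℕ) (prog : List (Instr F)) : Rows F :=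
  ((searchStep n prog)^[1 + prog.length * n] (searchInit prog)).1

theorem addVec_length {rows : Rows F} {c : List F} (h0 : isZero (reduce rows c) = false) :
    (addVec rows c).length = rows.length + 1 := by
  rw [addVec, h0, cond_false, insertRow, List.length_cons, List.length_map]

/-- The list `bs` contains the original vectors whose insertion enlarged the basis. It occurs only
in the analysis, where it supplies as many generators as there are rows, all of them coefficient
vectors of words of length at most `j`. The field `measure` holds because a step consumes a
candidate, and adds `n` new ones only when the dimension grows, which happens at most `prog.length`
times. -/
structure SearchInv (n : ℕ) (prog : List (Instr F)) (j : ℕ) (s : Rows F × List (List F))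
    (bs : List (List F)) : Prop where
  ech : Echelon prog.length s.1 (Submodule.span F (vec '' {b | b ∈ bs}))
  len : bs.length = s.1.length
  word : ∀ b ∈ bs ++ s.2, ∃ w, w.length ≤ j ∧ coeffVec prog w = b
  start : coeffVec prog [] ∈ bs ++ s.2 ∨
    vec (coeffVec prog []) ∈ Submodule.span F (vec '' {b | b ∈ bs})
  step : ∀ b ∈ bs, ∀ x < n, stepVec 0 x prog b ∈ s.2 ∨
    vec (stepVec 0 x prog b) ∈ Submodule.span F (vec '' {b | b ∈ bs})
  measure : s.2 ≠ [] → s.2.length + (prog.length - s.1.length) * n + j ≤ 1 + prog.length * n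

theorem searchInv_init (n : ℕ) (prog : List (Instr F)) : SearchInv n prog 0 (searchInit prog) [] where
  ech := by simpa [searchInit] using Echelon.nil prog.length
  len := rfl
  word := by
    intro b hb
    simp only [searchInit, List.nil_append, List.mem_singleton] at hb
    exact ⟨[], le_rfl, by rw [hb, coeffVec_nil prog 0]⟩
  start := Or.inl (by simp [searchInit, coeffVec_nil prog 0])
  step := by simp
  measure := by simp [searchInit]

theorem SearchInv.next {n : ℕ} {prog : List (Instr F)} {j : ℕ} {s : Rows F × List (List F)}
    {bs : List (List F)} (h : SearchInv n prog j s bs) :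
    ∃ bs', SearchInv n prog (j + 1) (searchStep n prog s) bs' := by
  obtain ⟨rows, cands⟩ := s
  cases cands with
  | nil =>
    have : searchStep n prog (rows, []) = (rows, []) := rfl
    rw [this]
    exact ⟨bs, h.ech, h.len, fun b hb => (h.word b hb).imp fun w hw => ⟨hw.1.trans j.le_succ, hw.2⟩,
      h.start, h.step, fun hne => absurd rfl hne⟩
  | cons c cands =>
    obtain ⟨w, hw, rfl⟩ := h.word c (by simp)
    have hm := h.measure (by simp)
    simp only [List.length_cons] at hm
    cases h0 : isZero (reduce rows (coeffVec prog w)) with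
    | true =>
      have : searchStep n prog (rows, coeffVec prog w :: cands) = (rows, cands) := by
        simp [searchStep, h0]
      rw [this]
      have hc := (h.ech.mem_iff (length_coeffVec prog w)).2 h0
      refine ⟨bs, h.ech, h.len, fun b hb => ?_, ?_, fun b hb x hx => ?_, fun _ => ?_⟩
      · refine (h.word b ?_).imp fun w hw => ⟨hw.1.trans j.le_succ, hw.2⟩
        simp only [List.mem_append, List.mem_cons] at hb ⊢
        tauto
      · rcases h.start with hs | hs
        · simp only [List.mem_append, List.mem_cons] at hs ⊢
          rcases hs with hs | hs | hs
          · exact Or.inl (Or.inl hs)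
          · rw [← hs] at hc; exact Or.inr hc
          · exact Or.inl (Or.inr hs)
        · exact Or.inr hs
      · rcases h.step b hb x hx with hs | hs
        · rcases List.mem_cons.1 hs with hs | hs
          · rw [← hs] at hc; exact Or.inr hc
          · exact Or.inl hs
        · exact Or.inr hs
      · dsimp only at hm ⊢; omega
    | false =>
      have : searchStep n prog (rows, coeffVec prog w :: cands) = (addVec rows (coeffVec prog w),
          (List.range n).map (fun x => stepVec 0 x prog (coeffVec prog w)) ++ cands) := by
        simp [searchStep, h0]
      rw [this]
      have hlen := addVec_length h0
      have hspan : Submodule.span F (vec '' {b | b ∈ coeffVec prog w :: bs}) =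
          Submodule.span F (vec '' {b | b ∈ bs}) ⊔ Submodule.span F {vec (coeffVec prog w)} := by
        rw [← Submodule.span_union, show {b | b ∈ coeffVec prog w :: bs} =
          {b | b ∈ bs} ∪ {coeffVec prog w} by ext; simp [or_comm], Set.image_union, Set.image_singleton]
      have hech := h.ech.addVec (length_coeffVec prog w)
      have hle := hech.length_le
      refine ⟨coeffVec prog w :: bs, by rw [hspan]; exact hech,
        by rw [List.length_cons, h.len, hlen], fun b hb => ?_, ?_, fun b hb x hx => ?_, fun _ => ?_⟩
      · simp only [List.mem_append, List.mem_cons, List.mem_map, List.mem_range] at hb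
        rcases hb with (rfl | hb) | ⟨x, _, rfl⟩ | hb
        · exact ⟨w, hw.trans j.le_succ, rfl⟩
        · exact (h.word b (by simp [hb])).imp fun w hw => ⟨hw.1.trans j.le_succ, hw.2⟩
        · exact ⟨x :: w, by simpa using hw, coeffVec_cons _ _ _⟩
        · exact (h.word b (by simp [hb])).imp fun w hw => ⟨hw.1.trans j.le_succ, hw.2⟩
      · rcases h.start with hs | hs
        · simp only [List.mem_append, List.mem_cons] at hs ⊢
          tauto
        · rw [hspan]; exact Or.inr (Submodule.mem_sup_left hs)
      · rcases List.mem_cons.1 hb with rfl | hb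
        · exact Or.inl (List.mem_append_left _ (List.mem_map.2 ⟨x, List.mem_range.2 hx, rfl⟩))
        · rcases h.step b hb x hx with hs | hs
          · rcases List.mem_cons.1 hs with hs | hs
            · right
              rw [hs]
              exact Submodule.subset_span ⟨_, by simp, rfl⟩
            · exact Or.inl (List.mem_append_right _ hs)
          · rw [hspan]; exact Or.inr (Submodule.mem_sup_left hs)
      · dsimp only at hm ⊢
        rw [hlen] at hle ⊢
        simp only [List.length_append, List.length_map, List.length_range]
        have : (prog.length - rows.length) * n = (prog.length - (rows.length + 1)) * n + n := by
          rw [← Nat.succ_mul]; congr 1; omega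
        omega

theorem exists_searchInv (n : ℕ) (prog : List (Instr F)) (j : ℕ) :
    ∃ bs, SearchInv n prog j ((searchStep n prog)^[j] (searchInit prog)) bs := by
  induction j with
  | zero => exact ⟨[], searchInv_init n prog⟩
  | succ j ih =>
    obtain ⟨bs, h⟩ := ih
    rw [Function.iterate_succ_apply']
    exact h.next

/-- Once no candidates are left, the span contains the vector of the empty word and is mapped into
itself by reading any letter below `n`, since this holds on its generators and reading is linear.
Induction on the word then gives all vectors. -/
theorem search_spec (n : ℕ) (prog : List (Instr F)) : ∃ S : Submodule F (ℕ → F),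
    Echelon prog.length (search n prog) S ∧
    (S ≤ Submodule.span F (Set.range fun w => vec (coeffVec prog w))) ∧
    ∀ w : List ℕ, (∀ x ∈ w, x < n) → vec (coeffVec prog w) ∈ S := by
  obtain ⟨bs, h⟩ := exists_searchInv n prog (1 + prog.length * n)
  set s := (searchStep n prog)^[1 + prog.length * n] (searchInit prog) with hs
  -- The number of rounds equals the initial value of the measure, so a remaining candidate would
  -- violate the bound.
  have hnil : s.2 = [] := by
    by_contra hne
    have := h.measure hne
    have := List.length_pos_of_ne_nil hne
    omega
  refine ⟨_, h.ech, ?_, fun w => ?_⟩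
  · refine Submodule.span_mono ?_
    rintro _ ⟨b, hb, rfl⟩
    obtain ⟨w, _, rfl⟩ := h.word b (List.mem_append_left _ hb)
    exact ⟨w, rfl⟩
  · induction w with
    | nil =>
      intro _
      rcases h.start with h | h
      · rw [hnil, List.append_nil] at h
        exact Submodule.subset_span ⟨_, h, rfl⟩
      · exact h
    | cons x w ih =>
      intro hw
      obtain ⟨Φ, hΦ⟩ := exists_stepVec_linear x prog
      rw [coeffVec_cons, hΦ _ (length_coeffVec prog w)]
      have hle : Submodule.span F (vec '' {b | b ∈ bs}) ≤
          (Submodule.span F (vec '' {b | b ∈ bs})).comap Φ := by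
        rw [Submodule.span_le]
        rintro _ ⟨b, hb, rfl⟩
        obtain ⟨v, _, rfl⟩ := h.word b (List.mem_append_left _ hb)
        have := h.step _ hb x (hw x (by simp))
        rw [hnil] at this
        have := this.resolve_left (by simp)
        rwa [hΦ _ (length_coeffVec prog v)] at this
      exact hle (ih fun y hy => hw y (by simp [hy]))

/-! ## Deciding linear dependence of formulas -/

/-- Whether `f` is a linear combination of `g` and `h`. -/
def inSpan (n : ℕ) (f g h : Formula F ℕ) : Bool :=
  !isZero (reduce (((search n (prog₃ f g h)).map fun r => proj₃ f g h r.2).foldl addVec []) [1, 0, 0])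

/-- Cramer's rule needs a generating set of exactly as many vectors as there are rows. The vectors
of `vs` that were actually inserted form one. -/
theorem echelon_foldl {N : ℕ} (vs : List (List F)) (hv : ∀ v ∈ vs, v.length = N) :
    ∃ bs : List (List F), (∀ b ∈ bs, b ∈ vs) ∧ bs.length = (vs.foldl addVec []).length ∧
      Echelon N (vs.foldl addVec []) (Submodule.span F (vec '' {b | b ∈ bs})) ∧
      Submodule.span F (vec '' {b | b ∈ bs}) = Submodule.span F (vec '' {b | b ∈ vs}) := by
  induction vs using List.reverseRecOn with
  | nil => exact ⟨[], by simp, rfl, by simpa using Echelon.nil N, rfl⟩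
  | append_singleton vs c ih =>
    obtain ⟨bs, h1, h2, h3, h4⟩ := ih fun v hv' => hv v (by simp [hv'])
    rw [List.foldl_append, List.foldl_cons, List.foldl_nil]
    have hc := hv c (by simp)
    have hspan : Submodule.span F (vec '' {b | b ∈ vs ++ [c]}) =
        Submodule.span F (vec '' {b | b ∈ bs}) ⊔ Submodule.span F {vec c} := by
      rw [h4, ← Submodule.span_union, show {b | b ∈ vs ++ [c]} = {b | b ∈ vs} ∪ {c} by ext; simp [or_comm],
        Set.image_union, Set.image_singleton]
    have hech := h3.addVec hc
    cases h0 : isZero (reduce (vs.foldl addVec []) c) with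
    | true =>
      have hmem := (h3.mem_iff hc).2 h0
      refine ⟨bs, fun b hb => by simp [h1 b hb], ?_, ?_, ?_⟩
      · rw [h2, addVec, h0, cond_true]
      · rwa [addVec, h0, cond_true]
      · rw [hspan, sup_eq_left.2 ((Submodule.span_singleton_le_iff_mem _ _).2 hmem)]
    | false =>
      have hspan' : Submodule.span F (vec '' {b | b ∈ c :: bs}) =
          Submodule.span F (vec '' {b | b ∈ bs}) ⊔ Submodule.span F {vec c} := by
        rw [← Submodule.span_union, show {b | b ∈ c :: bs} = {b | b ∈ bs} ∪ {c} by
          ext; simp, Set.image_union, Set.image_singleton]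
      refine ⟨c :: bs, ?_, by rw [List.length_cons, h2, addVec_length h0], by rwa [hspan'],
        by rw [hspan, hspan']⟩
      intro b hb
      rcases List.mem_cons.1 hb with rfl | hb
      · simp
      · simp [h1 b hb]

/-- Let `T` be the span of the triples of coefficients of `f`, `g` and `h` over all words. A
relation `f = a g + b h` says that the functional `(1, -a, -b)` vanishes on `T`. Such a functional
exists iff `(1, 0, 0)` is not in `T`. The scalars themselves are never computed. -/
theorem inSpan_iff {n : ℕ} {f g h : Formula F ℕ} (hf : f.VarsIn {i | i < n}) (hg : g.VarsIn {i | i < n})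
    (hh : h.VarsIn {i | i < n}) :
    inSpan n f g h = true ↔ ∃ a b : F, f.eval = a • g.eval + b • h.eval := by
  obtain ⟨S, hS, hle, hmem⟩ := search_spec n (prog₃ f g h)
  set vs := (search n (prog₃ f g h)).map fun r => proj₃ f g h r.2 with hvs
  obtain ⟨bs, _, _, h3, h4⟩ := echelon_foldl (N := 3) vs (by
    intro v hv
    obtain ⟨r, _, rfl⟩ := List.mem_map.1 hv
    rfl)
  rw [h4] at h3
  let Ψ : (ℕ → F) →ₗ[F] (ℕ → F) := LinearMap.pi fun i =>
    if i = 0 then LinearMap.proj (compile f).length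
    else if i = 1 then LinearMap.proj ((compile f).length + 1 + (compile g).length)
    else if i = 2 then LinearMap.proj ((compile f).length + 1 + ((compile g).length + 1 +
      (compile h).length))
    else 0
  have hΨ : ∀ l : List F, vec (proj₃ f g h l) = Ψ (vec l) := by
    intro l
    funext i
    match i with
    | 0 => rfl
    | 1 => rfl
    | 2 => rfl
    | i + 3 => rfl
  have hT : Submodule.span F (vec '' {b | b ∈ vs}) = S.map Ψ := by
    rw [← hS.span, Submodule.map_span, ← Set.image_comp]
    congr 1
    ext u
    simp only [hvs, Set.mem_image, Set.mem_ofPred_eq, List.mem_map, exists_exists_and_eq_and,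
      Function.comp_apply, hΨ]
  rw [hT] at h3
  have h5 := h3.mem_iff (c := [1, 0, 0]) rfl
  have h6 : inSpan n f g h = true ↔ vec [1, 0, 0] ∉ S.map Ψ := by
    rw [h5, inSpan, ← hvs]
    simp
  rw [h6]
  have hcoeff : ∀ w, Ψ (vec (coeffVec (prog₃ f g h) w)) =
      vec [ncoeff w f.eval, ncoeff w g.eval, ncoeff w h.eval] := fun w => by
    rw [← hΨ, proj₃_coeffVec]
  constructor
  · intro hnot
    -- A functional that vanishes on the span but not at `(1, 0, 0)`; dividing by its first
    -- coefficient expresses `f` by `g` and `h`.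
    obtain ⟨φ, hφ, hker⟩ := Submodule.exists_le_ker_of_notMem hnot
    have key : ∀ w, ncoeff w f.eval * φ (vec [1, 0, 0]) + ncoeff w g.eval * φ (vec [0, 1, 0]) +
        ncoeff w h.eval * φ (vec [0, 0, 1]) = 0 := by
      intro w
      by_cases hw : ∀ x ∈ w, x < n
      · have := hker ⟨_, hmem w hw, hcoeff w⟩
        rw [LinearMap.mem_ker] at this
        refine Eq.trans ?_ this
        rw [← smul_eq_mul, ← smul_eq_mul, ← smul_eq_mul, ← map_smul, ← map_smul, ← map_smul,
          ← map_add, ← map_add]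
        congr 1
        funext i
        match i with
        | 0 => simp [vec]
        | 1 => simp [vec]
        | 2 => simp [vec]
        | i + 3 => simp [vec]
      -- The search covers only words in the first `n` variables, but other words have coefficient
      -- zero in all three formulas.
      · have hz : ∀ k : Formula F ℕ, k.VarsIn {i | i < n} → ncoeff w k.eval = 0 := fun k hk => by
          by_contra hne
          exact hw (hk.mem_of_ncoeff hne)
        rw [hz f hf, hz g hg, hz h hh]; simp
    refine ⟨-(φ (vec [1, 0, 0]))⁻¹ * φ (vec [0, 1, 0]), -(φ (vec [1, 0, 0]))⁻¹ * φ (vec [0, 0, 1]),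
      ncoeff_ext fun w => ?_⟩
    rw [map_add, map_smul, map_smul, smul_eq_mul, smul_eq_mul]
    have := key w
    field_simp
    linear_combination this
  · rintro ⟨a, b, hab⟩ ⟨s, hs, hse⟩
    have hlin : Submodule.span F (Set.range fun w => vec (coeffVec (prog₃ f g h) w)) ≤
        LinearMap.ker ((LinearMap.proj 0 - a • LinearMap.proj 1 - b • LinearMap.proj 2 :
          (ℕ → F) →ₗ[F] F) ∘ₗ Ψ) := by
      rw [Submodule.span_le]
      rintro _ ⟨w, rfl⟩
      rw [SetLike.mem_coe, LinearMap.mem_ker, LinearMap.comp_apply]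
      dsimp only
      rw [hcoeff w, hab]
      simp [vec]
    have := hlin (hle hs)
    rw [LinearMap.mem_ker, LinearMap.comp_apply, hse] at this
    simp [vec] at this

end

/-! ## The search runs in polynomial time -/

section
variable {F : Type*} [Field F]

/-- The constants of a program. -/
def consts (prog : List (Instr F)) : List F :=
  prog.flatMap fun I => [I.1.1, I.1.2.1, I.2.1.1, I.2.2.2]

/-- The value is a sum of four terms, each a constant of the program times an earlier value, or
zero. Registers are never multiplied with each other, so the degree grows by one and the exponent by
two. -/
theorem rep_instrVal {cs : List F} {D B : ℕ} {d : F} {x : ℕ} {cur : List F} {p : F} {I : Instr F}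
    (hd : Rep cs D (2 ^ B) d) (hcur : ∀ y ∈ cur, Rep cs D (2 ^ B) y) (hp : Rep cs D (2 ^ B) p)
    (h1 : Rep cs 1 1 I.1.1) (h2 : Rep cs 1 1 I.1.2.1) (h3 : Rep cs 1 1 I.2.1.1)
    (h4 : Rep cs 1 1 I.2.2.2) : Rep cs (D + 1) (2 ^ (B + 2)) (instrVal d x cur p I) := by
  have e1 := h1.mul hd
  have e2 := h2.mul (Rep.getD hcur I.1.2.2)
  have e3 := h3.mul (Rep.getD hcur I.2.1.2)
  have e4 : Rep cs (1 + D) (1 * 2 ^ B) (bif eqb I.2.2.1 x then I.2.2.2 • p else 0) := by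
    cases eqb I.2.2.1 x
    · exact Rep.zero.mono (Nat.zero_le _) (Nat.zero_le _)
    · exact h4.mul hp
  refine (((e1.add e2).add e3).add e4).mono (by omega) (le_of_eq ?_)
  rw [pow_add]; ring

theorem rep_trace {cs : List F} {x : ℕ} {d : F} (prog : List (Instr F))
    (hprog : ∀ y ∈ consts prog, Rep cs 1 1 y) : ∀ {D B : ℕ} {cur : List F} {p : F} {prev : List F},
    Rep cs D (2 ^ B) d → (∀ y ∈ cur, Rep cs D (2 ^ B) y) → Rep cs D (2 ^ B) p →
    (∀ y ∈ prev, Rep cs D (2 ^ B) y) → ∀ y ∈ trace d x cur p prev prog,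
      Rep cs (D + prog.length) (2 ^ (B + 2 * prog.length)) y := by
  induction prog with
  | nil => simp [trace]
  | cons I prog ih =>
    intro D B cur p prev hd hcur hp hprev
    have hI : ∀ y ∈ [I.1.1, I.1.2.1, I.2.1.1, I.2.2.2], Rep cs 1 1 y := fun y hy =>
      hprog y (List.mem_flatMap.2 ⟨I, by simp, hy⟩)
    have hv := rep_instrVal (x := x) (I := I) hd hcur hp (hI _ (by simp)) (hI _ (by simp))
      (hI _ (by simp)) (hI _ (by simp))
    have hm : ∀ {y}, Rep cs D (2 ^ B) y → Rep cs (D + 1) (2 ^ (B + 2)) y := fun h =>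
      h.mono (by omega) (Nat.pow_le_pow_right (by omega) (by omega))
    intro y hy
    rw [trace, List.mem_cons] at hy
    rw [List.length_cons]
    rcases hy with rfl | hy
    · exact hv.mono (by omega) (Nat.pow_le_pow_right (by omega) (by omega))
    · refine (ih (fun y hy => hprog y ?_) (hm hd) ?_ ?_ ?_ y hy).mono (by omega)
        (Nat.pow_le_pow_right (by omega) (by omega))
      · rw [consts, List.flatMap_cons]
        exact List.mem_append_right _ hy
      · intro z hz
        rcases List.mem_cons.1 hz with rfl | hz
        · exact hv
        · exact hm (hcur z hz)
      · cases prev with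
        | nil => exact Rep.zero.mono (Nat.zero_le _) (Nat.zero_le _)
        | cons z prev => exact hm (hprev z (by simp))
      · exact fun z hz => hm (hprev z (List.mem_of_mem_tail hz))

/-- There is one pass through the program for each letter and one for the empty word, and the bounds
of the passes add up. -/
theorem rep_coeffVec (prog : List (Instr F)) (w : List ℕ) : ∀ y ∈ coeffVec prog w,
    Rep (consts prog) ((w.length + 1) * prog.length) (2 ^ ((w.length + 1) * (2 * prog.length))) y := by
  have hc : ∀ y ∈ consts prog, Rep (consts prog) 1 1 y := fun y hy => Rep.of_mem hy
  induction w with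
  | nil =>
    rw [coeffVec_nil prog 0, stepVec]
    intro y hy
    refine (rep_trace prog hc (D := 0) (B := 0) Rep.one (by simp)
      (Rep.zero.mono le_rfl (Nat.zero_le _)) ?_ y hy).mono (by simp) (by simp)
    intro y hy
    obtain ⟨_, _, rfl⟩ := List.mem_map.1 hy
    exact Rep.zero.mono le_rfl (Nat.zero_le _)
  | cons x w ih =>
    rw [coeffVec_cons, stepVec]
    intro y hy
    have h0 : Rep (consts prog) ((w.length + 1) * prog.length)
        (2 ^ ((w.length + 1) * (2 * prog.length))) 0 := Rep.zero.mono (Nat.zero_le _) (Nat.zero_le _)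
    refine (rep_trace prog hc h0 (by simp) h0 ih y hy).mono ?_ (le_of_eq ?_)
    · rw [List.length_cons]; linarith
    · rw [List.length_cons]; congr 1; ring

/-- The recursion as a left fold over the instructions, which is the form that the loop rule
accepts. -/
theorem foldl_trace (d : F) (x : ℕ) (prog : List (Instr F)) (cur : List F) (p : F) (prev : List F) :
    (prog.foldl (fun s I => (instrVal d x s.1 s.2.1 I :: s.1, s.2.2.headD 0, s.2.2.tail))
      (cur, p, prev)) = ((trace d x cur p prev prog).reverse ++ cur,
        (p :: prev).getD prog.length 0, prev.drop prog.length) := by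
  induction prog generalizing cur p prev with
  | nil => simp [trace]
  | cons I prog ih =>
    rw [List.foldl_cons, ih, trace]
    cases prev <;> simp

end

section
variable {F : Type*} [Enc F] {α : Type u} [Enc α]

@[fun_prop]
theorem PolyTime.consts {prog : α → List (Instr F)} (hp : PolyTime prog) : PolyTime fun a => OFPC.consts (prog a) := by
  unfold OFPC.consts
  fun_prop

theorem PolyBdd.length {β : Type*} [Enc β] {l : α → List β} (hl : PolyTime l) :
    PolyBdd fun a => (l a).length := hl.size.mono fun _ => (length_lt_esize _).le

end

section
variable {F : Type*} [Field F] [Enc F] [EfficientField F] {α : Type u} [Enc α]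

namespace PolyTime

@[fun_prop]
theorem fieldSmul {f g : α → F} (hf : PolyTime f) (hg : PolyTime g) : PolyTime fun a => f a • g a :=
  hf.fieldMul hg

@[fun_prop]
theorem instrVal {d : α → F} {x : α → ℕ} {cur : α → List F} {p : α → F} {I : α → Instr F}
    (hd : PolyTime d) (hx : PolyTime x) (hcur : PolyTime cur) (hp : PolyTime p) (hI : PolyTime I) :
    PolyTime fun a => instrVal (d a) (x a) (cur a) (p a) (I a) := by
  unfold OFPC.instrVal
  fun_prop

@[fun_prop]
theorem stepVec {d : α → F} {x : α → ℕ} {prog : α → List (Instr F)} {prev : α → List F}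
    (hd : PolyTime d) (hx : PolyTime x) (hprog : PolyTime prog) (hprev : PolyTime prev) :
    PolyTime fun a => stepVec (d a) (x a) (prog a) (prev a) := by
  -- For a single pass the given vector counts as a list of constants. Every intermediate register
  -- then has degree and exponent linear in the length of the program.
  have hcs : PolyTime fun a => d a :: (prev a ++ OFPC.consts (prog a)) := by fun_prop
  obtain ⟨q, hq⟩ := Rep.size F
  have h : PolyTime fun a => (prog a).foldl (fun s I => (OFPC.instrVal (d a) (x a) s.1 s.2.1 I :: s.1,
      s.2.2.headD 0, s.2.2.tail)) (([], 0, prev a) : List F × F × List F) := by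
    refine foldl (l := prog) hprog (i := fun a => (([], 0, prev a) : List F × F × List F)) (by fun_prop)
      (f := fun a s I => (OFPC.instrVal (d a) (x a) s.1 s.2.1 I :: s.1, s.2.2.headD 0, s.2.2.tail))
      (by fun_prop)
      (B := fun a => ((prog a).length *
        (q.eval (OFPC.esize (d a :: (prev a ++ OFPC.consts (prog a))) + (1 + (prog a).length) +
          2 * (prog a).length) + 1) + 1) + ((OFPC.esize (prev a) + OFPC.esize (0 : F)) +
            OFPC.esize (prev a) + 1) + 1)
      ?_ fun a k => ?_
    · have hl := PolyBdd.length hprog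
      exact ((((hl.mul ((((hcs.size.add ((PolyBdd.const 1).add hl)).add
        ((PolyBdd.const 2).mul hl)).eval q).add (.const 1))).add (.const 1)).add
        (((hprev.size.add (.const _)).add hprev.size).add (.const 1))).add (.const 1))
    · rw [foldl_trace, esize_prod, esize_prod]
      have hk : ((prog a).take k).length ≤ (prog a).length := by simp
      have h1 : OFPC.esize ((trace (d a) (x a) [] 0 (prev a) ((prog a).take k)).reverse ++ []) ≤
          (prog a).length * (q.eval (OFPC.esize (d a :: (prev a ++ OFPC.consts (prog a))) +
            (1 + (prog a).length) + 2 * (prog a).length) + 1) + 1 := by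
        rw [List.append_nil, esize_reverse]
        refine esize_list_le (by rw [length_trace]; exact hk) fun y hy => ?_
        refine (hq (d a :: (prev a ++ OFPC.consts (prog a))) (1 + ((prog a).take k).length)
          (0 + 2 * ((prog a).take k).length) y (rep_trace _ ?_ (Rep.of_mem (by simp)) (by simp)
          (Rep.zero.mono (Nat.zero_le _) (Nat.zero_le _)) ?_ y hy)).trans (q.eval_nat_mono ?_)
        · intro z hz
          refine Rep.of_mem (List.mem_cons_of_mem _ (List.mem_append_right _ ?_))
          obtain ⟨I, hI, hz⟩ := List.mem_flatMap.1 hz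
          exact List.mem_flatMap.2 ⟨I, List.mem_of_mem_take hI, hz⟩
        · exact fun z hz => Rep.of_mem (List.mem_cons_of_mem _ (List.mem_append_left _ hz))
        · omega
      have h2 : OFPC.esize (((0 : F) :: prev a).getD ((prog a).take k).length 0) ≤
          OFPC.esize (prev a) + OFPC.esize (0 : F) := by
        generalize ((prog a).take k).length = i
        rcases Nat.lt_or_ge i ((0 : F) :: prev a).length with hi | hi
        · rw [List.getD_eq_getElem _ _ hi]
          rcases List.mem_cons.1 (List.getElem_mem hi) with h | h
          · rw [h]; exact Nat.le_add_left _ _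
          · exact (esize_lt_of_mem h).le.trans (Nat.le_add_right _ _)
        · rw [List.getD_eq_default _ _ hi]; exact Nat.le_add_left _ _
      have h3 := esize_sublist (List.drop_sublist ((prog a).take k).length (prev a))
      omega
  refine (h.fst.reverse).of_code_eq fun a => congrArg _ ?_
  rw [foldl_trace]
  simp [OFPC.stepVec]

@[fun_prop]
theorem searchStep {n : α → ℕ} {prog : α → List (Instr F)} {s : α → Rows F × List (List F)}
    (hn : PolyTime n) (hprog : PolyTime prog) (hs : PolyTime s) :
    PolyTime fun a => searchStep (n a) (prog a) (s a) := by
  unfold OFPC.searchStep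
  fun_prop

end PolyTime

/-- The candidates are coefficient vectors of short words and are bounded directly; the rows are
bounded by Cramer's rule from the vectors in `bs`. The polynomial `Q` is the sum of the two bounds.
-/
theorem SearchInv.size (F : Type*) [Field F] [Enc F] [EfficientField F] :
    ∃ Q : Polynomial ℕ, ∀ (n : ℕ) (prog : List (Instr F)) (j : ℕ) (s : Rows F × List (List F))
      (bs : List (List F)), SearchInv n prog j s bs →
      esize s ≤ (prog.length * (((2 * prog.length + 1) + (prog.length *
        (Q.eval (esize (consts prog) + (j + 1) * prog.length + (j + 1) * (2 * prog.length) +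
          prog.length) + 1) + 1) + 1) + 1) + 1) +
        ((1 + prog.length * n) * ((prog.length *
          (Q.eval (esize (consts prog) + (j + 1) * prog.length + (j + 1) * (2 * prog.length) +
            prog.length) + 1) + 1) + 1) + 1) + 1 := by
  obtain ⟨q, hq⟩ := Rep.size F
  obtain ⟨Q, hQ⟩ := echelon_size F
  refine ⟨Q + q, fun n prog j s bs h => ?_⟩
  have hrep : ∀ b ∈ bs ++ s.2, ∀ y ∈ b, Rep (consts prog) ((j + 1) * prog.length)
      (2 ^ ((j + 1) * (2 * prog.length))) y := by
    intro b hb y hy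
    obtain ⟨w, hw, rfl⟩ := h.word b hb
    exact (rep_coeffVec prog w y hy).mono (Nat.mul_le_mul_right _ (by omega))
      (Nat.pow_le_pow_right (by omega) (Nat.mul_le_mul_right _ (by omega)))
  have hN := h.ech.length_le
  generalize hm : esize (consts prog) + (j + 1) * prog.length + (j + 1) * (2 * prog.length) = m
  rw [esize_prod]
  gcongr
  · refine esize_list_le hN fun r hr => ?_
    rw [esize_prod, esize_nat]
    have := h.ech.piv r hr
    gcongr
    refine esize_list_le (h.ech.len r hr).le fun y hy => ?_
    have := hQ _ _ _ _ _ _ h.ech h.len (fun b hb => hrep b (List.mem_append_left _ hb)) r hr y hy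
    rw [hm] at this
    rw [Polynomial.eval_add]
    exact (this.trans (Q.eval_nat_mono (by omega))).trans (Nat.le_add_right _ _)
  · refine esize_list_le (k := 1 + prog.length * n) ?_ fun c hc => ?_
    · by_cases hs : s.2 = []
      · simp [hs]
      · have := h.measure hs
        omega
    · obtain ⟨w, hw, hcw⟩ := h.word c (List.mem_append_right _ hc)
      refine esize_list_le (by rw [← hcw, length_coeffVec]) fun y hy => ?_
      have := hq _ _ _ _ (hrep c (List.mem_append_right _ hc) y hy)
      rw [hm] at this
      rw [Polynomial.eval_add]
      exact (this.trans (q.eval_nat_mono (by omega))).trans (Nat.le_add_left _ _)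

namespace PolyTime

@[fun_prop]
theorem search {n : α → ℕ} {prog : α → List (Instr F)} (hn : PolyTime n) (hprog : PolyTime prog) :
    PolyTime fun a => search (n a) (prog a) := by
  suffices h : PolyTime fun p : ℕ × List (Instr F) => OFPC.search p.1 p.2 from
    h.comp (f := fun a => (n a, prog a)) (by fun_prop)
  obtain ⟨Q, hQ⟩ := OFPC.SearchInv.size F
  -- Numbers are unary, so the product is the length of a list with one copy of `range` for each
  -- instruction.
  have hmul : PolyTime fun p : ℕ × List (Instr F) => 1 + p.2.length * p.1 := by
    have : PolyTime fun p : ℕ × List (Instr F) =>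
        (((p.2.flatMap fun _ => List.range p.1)).length) + 1 := by fun_prop
    refine this.of_code_eq fun p => congrArg _ ?_
    simp [add_comm]
  unfold OFPC.search
  have hl : PolyBdd fun p : ℕ × List (Instr F) => p.2.length := PolyBdd.length (by fun_prop)
  have hn' : PolyBdd fun p : ℕ × List (Instr F) => p.1 :=
    (show PolyTime fun p : ℕ × List (Instr F) => p.1 by fun_prop).size.mono fun p => by
      rw [esize_nat]; omega
  have hK : PolyBdd fun p : ℕ × List (Instr F) => 1 + p.2.length * p.1 :=
    (PolyBdd.const 1).add (hl.mul hn')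
  have hcs : PolyBdd fun p : ℕ × List (Instr F) => OFPC.esize (OFPC.consts p.2) :=
    (show PolyTime fun p : ℕ × List (Instr F) => OFPC.consts p.2 by fun_prop).size
  have hm := ((((hcs.add ((hK.add (.const 1)).mul hl)).add ((hK.add (.const 1)).mul
    ((PolyBdd.const 2).mul hl))).add hl).eval Q)
  have hv := (hl.mul (hm.add (.const 1))).add (.const 1)
  refine fst (iterate hmul (i := fun p => searchInit p.2) (by unfold searchInit; fun_prop)
    (f := fun p s => OFPC.searchStep p.1 p.2 s) (by fun_prop)
    (((hl.mul (((((((PolyBdd.const 2).mul hl).add (.const 1)).add hv).add (.const 1)).add (.const 1)))).add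
      (.const 1)).add ((hK.mul (hv.add (.const 1))).add (.const 1)) |>.add (.const 1)) fun p j hj => ?_)
  obtain ⟨bs, h⟩ := exists_searchInv p.1 p.2 j
  refine (hQ _ _ _ _ _ h).trans ?_
  gcongr <;> refine Q.eval_nat_mono ?_ <;> gcongr

end PolyTime

end

/-! ## Compilation and substitutions -/

section
variable {F : Type*} [Field F] [Enc F] {α : Type u} [Enc α]

theorem length_compile (f : Formula F ℕ) : (compile f).length ≤ 3 * esize f := by
  induction f with
  | var i =>
    have := esize_pos (Formula.var i : Formula F ℕ)
    simp only [compile, List.length_singleton]; omega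
  | const a =>
    have := esize_pos (Formula.const a : Formula F ℕ)
    simp only [compile, List.length_singleton]; omega
  | add f g ihf ihg =>
    have : esize (Formula.add f g) = 5 + (esize f + esize g + 1) + 1 := rfl
    simp only [compile, List.length_append, List.length_cons, List.length_nil]
    omega
  | mul f g ihf ihg =>
    have : esize (Formula.mul f g) = 7 + (esize f + esize g + 1) + 1 := rfl
    simp only [compile, List.length_append]
    omega

theorem esize_mem_compile (f : Formula F ℕ) : ∀ I ∈ compile f,
    esize I ≤ 50 * esize f + 4 * esize (0 : F) + 4 * esize (1 : F) + 50 := by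
  induction f with
  | var i =>
    have : esize (Formula.var i : Formula F ℕ) = 1 + esize i + 1 := rfl
    rw [esize_nat] at this
    simp only [compile, List.mem_singleton, forall_eq, instrVar, esize_prod, esize_nat]
    omega
  | const a =>
    have : esize (Formula.const a : Formula F ℕ) = 3 + esize a + 1 := rfl
    simp only [compile, List.mem_singleton, forall_eq, instrScale, esize_prod, esize_nat]
    omega
  | add f g ihf ihg =>
    have : esize (Formula.add f g) = 5 + (esize f + esize g + 1) + 1 := rfl
    have h1 := length_compile f
    have h2 := length_compile g
    intro I hI
    simp only [compile, List.mem_append, List.mem_cons, List.not_mem_nil, or_false] at hI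
    rcases hI with (hI | rfl | hI) | rfl
    · have := ihg I hI; omega
    · simp only [instrScale, esize_prod, esize_nat]; omega
    · have := ihf I hI; omega
    · simp only [instrAdd, esize_prod, esize_nat]; omega
  | mul f g ihf ihg =>
    have : esize (Formula.mul f g) = 7 + (esize f + esize g + 1) + 1 := rfl
    intro I hI
    simp only [compile, List.mem_append] at hI
    rcases hI with hI | hI
    · have := ihg I hI; omega
    · have := ihf I hI; omega

theorem esize_zero_le (x : ℕ) (f : Formula F ℕ) :
    esize (f.zero x) ≤ (4 + esize (0 : F)) * esize f := by
  induction f with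
  | var i =>
    have h : esize (Formula.var i : Formula F ℕ) = 1 + esize i + 1 := rfl
    rw [Formula.zero]
    split_ifs
    · have : esize (Formula.const 0 : Formula F ℕ) = 3 + esize (0 : F) + 1 := rfl
      rw [h, this, esize_nat]; nlinarith
    · nlinarith
  | const a => rw [Formula.zero]; nlinarith
  | add f g ihf ihg =>
    have h : ∀ f g : Formula F ℕ, esize (Formula.add f g) = 5 + (esize f + esize g + 1) + 1 := fun _ _ => rfl
    rw [Formula.zero, h, h]; nlinarith
  | mul f g ihf ihg =>
    have h : ∀ f g : Formula F ℕ, esize (Formula.mul f g) = 7 + (esize f + esize g + 1) + 1 := fun _ _ => rfl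
    rw [Formula.zero, h, h]; nlinarith

/-- At a product node the quotient copies one factor unchanged and the other with `0` substituted,
and it recurses into each factor once. The copies add a linear amount at each level, so the growth
is quadratic and not exponential. -/
theorem esize_quot_le (x : ℕ) (f : Formula F ℕ) :
    esize (f.quot x) ≤ (30 + esize (0 : F) + esize (1 : F)) * (esize f * esize f) := by
  have hc : ∀ a : F, esize (Formula.const a : Formula F ℕ) = 3 + esize a + 1 := fun _ => rfl
  induction f with
  | var i =>
    have h := Nat.mul_le_mul (esize_pos (Formula.var i : Formula F ℕ)) (esize_pos (Formula.var i : Formula F ℕ))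
    rw [Formula.quot]
    split_ifs <;> rw [hc] <;> nlinarith
  | const a =>
    have h := Nat.mul_le_mul (esize_pos (Formula.const a : Formula F ℕ)) (esize_pos (Formula.const a : Formula F ℕ))
    rw [Formula.quot, hc]; nlinarith
  | add f g ihf ihg =>
    have h : ∀ f g : Formula F ℕ, esize (Formula.add f g) = 5 + (esize f + esize g + 1) + 1 := fun _ _ => rfl
    rw [Formula.quot, h, h]
    nlinarith [Nat.zero_le (esize f * esize g)]
  | mul f g ihf ihg =>
    have ha : ∀ f g : Formula F ℕ, esize (Formula.add f g) = 5 + (esize f + esize g + 1) + 1 := fun _ _ => rfl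
    have h : ∀ f g : Formula F ℕ, esize (Formula.mul f g) = 7 + (esize f + esize g + 1) + 1 := fun _ _ => rfl
    have hz := esize_zero_le x f
    rw [Formula.quot, ha, h, h, h]
    generalize esize (f.quot x) = qf at *
    generalize esize (g.quot x) = qg at *
    generalize esize (f.zero x) = zf at *
    generalize esize f = a at *
    generalize esize g = b at *
    generalize esize (0 : F) = z at *
    generalize esize (1 : F) = o at *
    have : (30 + z + o) * ((7 + (a + b + 1) + 1) * (7 + (a + b + 1) + 1)) = 
      (30 + z + o) * (a * a) + (30 + z + o) * (b * b) + (30 + z + o) * (2 * (a * b)) + 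
      18 * ((30 + z + o) * a) + 18 * ((30 + z + o) * b) + 81 * (30 + z + o) := by ring
    rw [this]
    have h1 : (4 + z) * a ≤ (30 + z + o) * a := Nat.mul_le_mul_right _ (by omega)
    have h2 : b ≤ (30 + z + o) * b := Nat.le_mul_of_pos_left _ (by omega)
    have h3 := Nat.zero_le ((30 + z + o) * (2 * (a * b)))
    omega

namespace PolyTime

@[fun_prop]
theorem compile {f : α → Formula F ℕ} (hf : PolyTime f) : PolyTime fun a => compile (f a) := by
  suffices h : PolyTime fun p : Unit × Formula F ℕ => OFPC.compile p.2 from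
    h.comp (f := fun a => ((), f a)) (by fun_prop)
  have hm : PolyTime fun p : Unit × Formula F ℕ × List (List (Instr F)) =>
    p.2.2.tail.headD [] ++ p.2.2.headD [] := by fun_prop
  have ha : PolyTime fun p : Unit × Formula F ℕ × List (List (Instr F)) =>
    p.2.2.tail.headD [] ++ instrScale 1 (p.2.2.tail.headD []).length :: p.2.2.headD [] ++
      [instrAdd ((p.2.2.headD []).length + 1)] := by unfold instrScale instrAdd; fun_prop
  refine treeFold (α := Unit) formulaChildren Formula.children_lt
    (node := fun _ t vs => match t with
      | .var i => [instrVar i]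
      | .const a => [instrScale a 0]
      | .add _ _ => vs.tail.headD [] ++ instrScale 1 (vs.tail.headD []).length :: vs.headD [] ++
          [instrAdd ((vs.headD []).length + 1)]
      | .mul _ _ => vs.tail.headD [] ++ vs.headD []) ?_
    (val := fun _ f => OFPC.compile f) (fun _ t => by cases t <;> rfl) ?_
  · refine formulaCases (f := fun p : Unit × Formula F ℕ × List (List (Instr F)) => p.2.1) (by fun_prop)
      (v := fun _ i => [instrVar i]) (by unfold instrVar; fun_prop)
      (c := fun _ a => [instrScale a 0]) (by unfold instrScale; fun_prop)
      (s := fun p _ _ => p.2.2.tail.headD [] ++ instrScale 1 (p.2.2.tail.headD []).length ::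
        p.2.2.headD [] ++ [instrAdd ((p.2.2.headD []).length + 1)])
      (ha.comp (f := fun p : (Unit × Formula F ℕ × List (List (Instr F))) × Formula F ℕ × Formula F ℕ => p.1)
        (by fun_prop))
      (m := fun p _ _ => p.2.2.tail.headD [] ++ p.2.2.headD [])
      (hm.comp (f := fun p : (Unit × Formula F ℕ × List (List (Instr F))) × Formula F ℕ × Formula F ℕ => p.1)
        (by fun_prop)) ?_
    rintro ⟨_, t, vs⟩
    cases t <;> rfl
  · have hf : PolyBdd fun p : Unit × Formula F ℕ => OFPC.esize p.2 :=
      (show PolyTime fun p : Unit × Formula F ℕ => p.2 by fun_prop).size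
    exact (((((PolyBdd.const 3).mul hf).mul ((((((PolyBdd.const 50).mul hf).add (.const _)).add
      (.const _)).add (.const 50)).add (.const 1)))).add (.const 1)).mono fun p =>
        esize_list_le (length_compile p.2) (esize_mem_compile p.2)

/-- The quotient of a product uses the substitution instance of its left factor, so the two are
computed in one recursion. -/
theorem zeroQuot : PolyTime fun p : ℕ × Formula F ℕ => (p.2.zero p.1, p.2.quot p.1) := by
  classical
  refine treeFold (α := ℕ) formulaChildren Formula.children_lt
    (node := fun x t vs => match t with
      | .var i => bif OFPC.eqb i x then (.const 0, .const 1) else (.var i, .const 0)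
      | .const a => (.const a, .const 0)
      | .add _ _ => (.add (vs.headD (.const 0, .const 0)).1 (vs.tail.headD (.const 0, .const 0)).1,
          .add (vs.headD (.const 0, .const 0)).2 (vs.tail.headD (.const 0, .const 0)).2)
      | .mul _ g => (.mul (vs.headD (.const 0, .const 0)).1 (vs.tail.headD (.const 0, .const 0)).1,
          .add (.mul (vs.headD (.const 0, .const 0)).2 g)
            (.mul (vs.headD (.const 0, .const 0)).1 (vs.tail.headD (.const 0, .const 0)).2))) ?_
    (val := fun x f => (f.zero x, f.quot x)) (fun x t => ?_) ?_
  · refine formulaCases (α := ℕ × Formula F ℕ × List (Formula F ℕ × Formula F ℕ))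
      (f := fun p => p.2.1) (by fun_prop)
      (v := fun p i => bif OFPC.eqb i p.1 then (.const 0, .const 1) else (.var i, .const 0)) (by fun_prop)
      (c := fun _ a => (.const a, .const 0)) (by fun_prop)
      (s := fun p _ _ => (.add (p.2.2.headD (.const 0, .const 0)).1 (p.2.2.tail.headD (.const 0, .const 0)).1,
          .add (p.2.2.headD (.const 0, .const 0)).2 (p.2.2.tail.headD (.const 0, .const 0)).2))
      (by fun_prop)
      (m := fun p _ g => (.mul (p.2.2.headD (.const 0, .const 0)).1 (p.2.2.tail.headD (.const 0, .const 0)).1,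
          .add (.mul (p.2.2.headD (.const 0, .const 0)).2 g)
            (.mul (p.2.2.headD (.const 0, .const 0)).1 (p.2.2.tail.headD (.const 0, .const 0)).2)))
      (by fun_prop) ?_
    rintro ⟨x, t, vs⟩
    cases t <;> rfl
  · cases t with
    | var i => by_cases h : i = x <;> simp [Formula.zero, Formula.quot, OFPC.eqb, h]
    | const a => rfl
    | add f g => rfl
    | mul f g => rfl
  · have hf : PolyBdd fun p : ℕ × Formula F ℕ => OFPC.esize p.2 :=
      (show PolyTime fun p : ℕ × Formula F ℕ => p.2 by fun_prop).size
    refine ((((PolyBdd.const (4 + OFPC.esize (0 : F))).mul hf).add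
      ((PolyBdd.const (30 + OFPC.esize (0 : F) + OFPC.esize (1 : F))).mul (hf.mul hf))).add (.const 1)).mono
      fun p => ?_
    rw [esize_prod]
    have := esize_zero_le p.1 p.2
    have := esize_quot_le p.1 p.2
    omega

@[fun_prop]
theorem formulaZero {x : α → ℕ} {f : α → Formula F ℕ} (hx : PolyTime x) (hf : PolyTime f) :
    PolyTime fun a => (f a).zero (x a) :=
  (zeroQuot.comp (f := fun a => (x a, f a)) (by fun_prop)).fst

@[fun_prop]
theorem formulaQuot {x : α → ℕ} {f : α → Formula F ℕ} (hx : PolyTime x) (hf : PolyTime f) :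
    PolyTime fun a => (f a).quot (x a) :=
  (zeroQuot.comp (f := fun a => (x a, f a)) (by fun_prop)).snd

@[fun_prop]
theorem prog₃ {f g h : α → Formula F ℕ} (hf : PolyTime f) (hg : PolyTime g) (hh : PolyTime h) :
    PolyTime fun a => prog₃ (f a) (g a) (h a) := by
  unfold OFPC.prog₃ instrOne
  fun_prop

@[fun_prop]
theorem proj₃ {f g h : α → Formula F ℕ} {l : α → List F} (hf : PolyTime f) (hg : PolyTime g)
    (hh : PolyTime h) (hl : PolyTime l) : PolyTime fun a => proj₃ (f a) (g a) (h a) (l a) := by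
  have h1 : PolyTime fun a => (OFPC.compile (f a)).length + 1 + (OFPC.compile (g a)).length :=
    (show PolyTime fun a => (OFPC.compile (f a) ++ instrOne :: OFPC.compile (g a)).length by
      fun_prop).of_code_eq fun a => congrArg _ (by simp; ring)
  have h2 : PolyTime fun a => (OFPC.compile (f a)).length + 1 +
      ((OFPC.compile (g a)).length + 1 + (OFPC.compile (h a)).length) :=
    (show PolyTime fun a => (OFPC.compile (f a) ++ instrOne :: (OFPC.compile (g a) ++ instrOne ::
      OFPC.compile (h a))).length by fun_prop).of_code_eq fun a => congrArg _ (by simp; ring)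
  unfold OFPC.proj₃
  exact cons (getD (by fun_prop) hl (const 0)) (cons (getD h1 hl (const 0))
    (cons (getD h2 hl (const 0)) (const [])))

end PolyTime
end

/-! ### Running time of the test for linear dependence -/

section
variable {F : Type*} [Field F] [Enc F] [EfficientField F] {α : Type u} [Enc α]
namespace PolyTime

/-- The entries of the given vectors are the constants here. Cramer's rule, applied to the vectors
inserted so far, bounds every intermediate basis. -/
theorem foldl_addVec {vs : α → List (List F)} {N : ℕ} (hvs : PolyTime vs)
    (hlen : ∀ a, ∀ v ∈ vs a, v.length = N) : PolyTime fun a => (vs a).foldl OFPC.addVec [] := by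
  obtain ⟨Q, hQ⟩ := echelon_size F
  have hcs : PolyTime fun a => (vs a).flatMap fun v => v := by fun_prop
  refine foldl hvs (i := fun _ => ([] : Rows F)) (by fun_prop) (f := fun _ rows v => OFPC.addVec rows v)
    (by fun_prop) (B := fun a => N * (((2 * N + 1) + (N * (Q.eval (OFPC.esize ((vs a).flatMap fun v => v) +
      1 + 0 + N) + 1) + 1) + 1) + 1) + 1) ?_ fun a k => ?_
  · exact ((PolyBdd.const N).mul ((((PolyBdd.const (2 * N + 1)).add (((PolyBdd.const N).mul
      (((((hcs.size.add (.const 1)).add (.const 0)).add (.const N)).eval Q).add (.const 1))).add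
        (.const 1))).add (.const 1)).add (.const 1))).add (.const 1)
  · obtain ⟨bs, h1, h2, h3, _⟩ := echelon_foldl (N := N) ((vs a).take k)
      fun v hv => hlen a v (List.mem_of_mem_take hv)
    have hN := h3.length_le
    refine esize_list_le hN fun r hr => ?_
    rw [esize_prod, esize_nat]
    have := h3.piv r hr
    gcongr
    refine esize_list_le (h3.len r hr).le fun y hy => ?_
    refine (hQ _ _ _ ((vs a).flatMap fun v => v) 1 0 h3 h2 (fun b hb y hy => Rep.of_mem
      (List.mem_flatMap.2 ⟨b, List.mem_of_mem_take (h1 b hb), hy⟩)) r hr y hy).trans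
        (Q.eval_nat_mono (by omega))

@[fun_prop]
theorem inSpan {n : α → ℕ} {f g h : α → Formula F ℕ} (hn : PolyTime n) (hf : PolyTime f)
    (hg : PolyTime g) (hh : PolyTime h) : PolyTime fun a => inSpan (n a) (f a) (g a) (h a) := by
  have hv : PolyTime fun a => (OFPC.search (n a) (OFPC.prog₃ (f a) (g a) (h a))).map
      fun r => OFPC.proj₃ (f a) (g a) (h a) r.2 := by fun_prop
  have h := foldl_addVec (N := 3) hv fun a v hv => by
    obtain ⟨r, _, rfl⟩ := List.mem_map.1 hv
    rfl
  unfold OFPC.inSpan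
  fun_prop

end PolyTime
end

/-! ## Checking proofs -/

section
variable {F : Type*}

def varsB (n : ℕ) : Formula F ℕ → Bool
  | .var i => (List.range n).any fun j => eqb j i
  | .const _ => true
  | .add f g => varsB n f && varsB n g
  | .mul f g => varsB n f && varsB n g

theorem varsB_iff {n : ℕ} {f : Formula F ℕ} : varsB n f = true ↔ f.VarsIn {i | i < n} := by
  induction f with
  | var i => simp [varsB, Formula.VarsIn]
  | const a => simp [varsB, Formula.VarsIn]
  | add f g ihf ihg => simp [varsB, Formula.VarsIn, ihf, ihg]
  | mul f g ihf ihg => simp [varsB, Formula.VarsIn, ihf, ihg]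

theorem Formula.exists_map_of_varsIn {n : ℕ} {f : Formula F ℕ} (h : f.VarsIn {i | i < n}) :
    ∃ f' : Formula F (Fin n), f = f'.map Fin.val := by
  induction f with
  | var i => exact ⟨.var ⟨i, h⟩, rfl⟩
  | const a => exact ⟨.const a, rfl⟩
  | add f g ihf ihg =>
    obtain ⟨f', rfl⟩ := ihf h.1
    obtain ⟨g', rfl⟩ := ihg h.2
    exact ⟨.add f' g', rfl⟩
  | mul f g ihf ihg =>
    obtain ⟨f', rfl⟩ := ihf h.1
    obtain ⟨g', rfl⟩ := ihg h.2
    exact ⟨.mul f' g', rfl⟩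

theorem Formula.exists_map_list_of_varsIn {n : ℕ} {l : List (Formula F ℕ)}
    (h : ∀ f ∈ l, f.VarsIn {i | i < n}) : ∃ l' : List (Formula F (Fin n)), l = l'.map (Formula.map Fin.val) := by
  induction l with
  | nil => exact ⟨[], rfl⟩
  | cons f l ih =>
    obtain ⟨f', rfl⟩ := Formula.exists_map_of_varsIn (h f (by simp))
    obtain ⟨l', rfl⟩ := ih fun g hg => h g (by simp [hg])
    exact ⟨f' :: l', rfl⟩

theorem Formula.varsIn_map {n : ℕ} (f : Formula F (Fin n)) : (f.map Fin.val).VarsIn {i | i < n} := by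
  induction f with
  | var i => exact i.2
  | const a => trivial
  | add f g ihf ihg => exact ⟨ihf, ihg⟩
  | mul f g ihf ihg => exact ⟨ihf, ihg⟩

variable [Enc F] {α : Type u} [Enc α]

theorem code_map (f : Formula F ℕ) {n : ℕ} {f' : Formula F (Fin n)} (h : f'.map Fin.val = f) :
    Enc.code f = f'.code Enc.code codeVar := by
  subst h
  induction f' with
  | var i => rfl
  | const a => rfl
  | add f g ihf ihg => exact congrArg₂ (fun x y => Datum.node (Datum.ofNat 2) (.node x y)) ihf ihg
  | mul f g ihf ihg => exact congrArg₂ (fun x y => Datum.node (Datum.ofNat 3) (.node x y)) ihf ihg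

theorem code_map_list {n : ℕ} (l : List (Formula F (Fin n))) :
    Enc.code (l.map (Formula.map Fin.val)) = codeFormulas Enc.code codeVar l := by
  simp only [Enc.code, codeFormulas, List.map_map]
  congr 1
  exact List.map_congr_left fun f _ => code_map _ rfl

theorem PolyTime.formulaAll {node : α → Formula F ℕ → Bool}
    (hnode : PolyTime fun p : α × Formula F ℕ => node p.1 p.2) {val : α → Formula F ℕ → Bool}
    (hval : ∀ a t, val a t = (node a t && t.children.all (val a))) :
    PolyTime fun p : α × Formula F ℕ => val p.1 p.2 :=
  treeFold formulaChildren Formula.children_lt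
    (node := fun a t vs => node a t && vs.all fun b => b)
    (and (hnode.comp (f := fun p : α × Formula F ℕ × List Bool => (p.1, p.2.1)) (by fun_prop))
      (by fun_prop)) (fun a t => by rw [hval, List.all_map]; rfl) (bool_bdd _)

theorem PolyTime.varsB_aux : PolyTime fun p : ℕ × Formula F ℕ => OFPC.varsB p.1 p.2 := by
  refine formulaAll (node := fun n t => match t with
    | .var i => (List.range n).any fun j => OFPC.eqb j i
    | _ => true) ?_ fun n t => ?_
  · exact formulaCases (f := fun p : ℕ × Formula F ℕ => p.2) (by fun_prop)
      (v := fun p i => (List.range p.1).any fun j => OFPC.eqb j i) (by fun_prop)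
      (c := fun _ _ => true) (by fun_prop) (s := fun _ _ _ => true) (by fun_prop)
      (m := fun _ _ _ => true) (by fun_prop) (by rintro ⟨n, t⟩; cases t <;> rfl)
  · cases t <;> simp [OFPC.varsB, Formula.children]

@[fun_prop]
theorem PolyTime.varsB {n : α → ℕ} {f : α → Formula F ℕ} (hn : PolyTime n) (hf : PolyTime f) :
    PolyTime fun a => OFPC.varsB (n a) (f a) := varsB_aux.comp (f := fun a => (n a, f a)) (by fun_prop)

end

section
variable {F : Type*} [Field F]

theorem Formula.VarsIn.zero {σ : Type*} {X : Set σ} {f : Formula F σ} (h : f.VarsIn X) (x : σ) :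
    (f.zero x).VarsIn X := by
  induction f with
  | var i =>
    rw [Formula.zero]
    split_ifs
    · trivial
    · exact h
  | const a => trivial
  | add f g ihf ihg => exact ⟨ihf h.1, ihg h.2⟩
  | mul f g ihf ihg => exact ⟨ihf h.1, ihg h.2⟩

theorem Formula.VarsIn.quot {σ : Type*} {X : Set σ} {f : Formula F σ} (h : f.VarsIn X) (x : σ) :
    (f.quot x).VarsIn X := by
  induction f with
  | var i => rw [Formula.quot]; split_ifs <;> trivial
  | const a => trivial
  | add f g ihf ihg => exact ⟨ihf h.1, ihg h.2⟩
  | mul f g ihf ihg => exact ⟨⟨ihf h.1, h.2⟩, h.1.zero x, ihg h.2⟩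

def isZeroB (n : ℕ) (f : Formula F ℕ) : Bool := inSpan n f (.const 0) (.const 0)

theorem isZeroB_iff {n : ℕ} {f : Formula F ℕ} (hf : f.VarsIn {i | i < n}) :
    isZeroB n f = true ↔ f.eval = 0 := by
  rw [isZeroB, inSpan_iff (g := .const 0) (h := .const 0) hf trivial trivial]
  simp [Formula.eval]

def eqB (n : ℕ) (f g : Formula F ℕ) : Bool := isZeroB n (.add f (.mul (.const (-1)) g))

theorem eqB_iff {n : ℕ} {f g : Formula F ℕ} (hf : f.VarsIn {i | i < n}) (hg : g.VarsIn {i | i < n}) :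
    eqB n f g = true ↔ f.eval = g.eval := by
  rw [eqB, isZeroB_iff (f := .add f (.mul (.const (-1)) g)) ⟨hf, trivial, hg⟩]
  simp [Formula.eval, ← sub_eq_add_neg, sub_eq_zero]

/-- An entry of a comparison table. -/
def lookup (T : List (List Bool)) (x y : ℕ) : Bool := (T.getD x []).getD y false

def sortedB (n : ℕ) (T : List (List Bool)) : Formula F ℕ → Bool
  | .var _ => true
  | .const _ => true
  | .add f g => sortedB n T f && sortedB n T g
  | .mul f g => ((List.range n).all fun x => (List.range n).all fun y =>
      isZeroB n (f.quot x) || isZeroB n (g.quot y) || lookup T x y) &&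
      (sortedB n T f && sortedB n T g)

theorem sortedB_iff {n : ℕ} {T : List (List Bool)} {f : Formula F ℕ} (hf : f.VarsIn {i | i < n}) :
    sortedB n T f = true ↔ f.SortedOn {i | i < n} fun x y => lookup T x y = true := by
  induction f with
  | var i => simp [sortedB, Formula.SortedOn]
  | const a => simp [sortedB, Formula.SortedOn]
  | add f g ihf ihg => simp [sortedB, Formula.SortedOn, ihf hf.1, ihg hf.2]
  | mul f g ihf ihg =>
    simp only [sortedB, Formula.SortedOn, ihf hf.1, ihg hf.2, Bool.and_eq_true, List.all_eq_true,
      List.mem_range, Bool.or_eq_true, isZeroB_iff (hf.1.quot _), isZeroB_iff (hf.2.quot _),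
      Set.mem_ofPred_eq]
    refine and_congr_left fun _ => forall₂_congr fun x _ => forall₂_congr fun y _ => ?_
    tauto

def lineB (n : ℕ) (Qs prev : List (Formula F ℕ)) (f : Formula F ℕ) : Bool :=
  (Qs.any fun q => eqB n f q) || ((List.range n).any fun x => eqB n f (boolFormula x)) ||
  (prev.any fun h => (List.range n).any fun r => isZeroB n (f.zero r) && eqB n (f.quot r) h) ||
  (prev.any fun h => prev.any fun h' => inSpan n f h h')

theorem lineB_iff {n : ℕ} {Qs prev : List (Formula F ℕ)} {f : Formula F ℕ}
    (hQ : ∀ q ∈ Qs, q.VarsIn {i | i < n}) (hprev : ∀ q ∈ prev, q.VarsIn {i | i < n})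
    (hf : f.VarsIn {i | i < n}) :
    lineB n Qs prev f = true ↔ LineOK {i | i < n} Qs prev f := by
  unfold lineB LineOK
  simp only [Bool.or_eq_true, or_assoc, List.any_eq_true, List.mem_range, Set.mem_ofPred_eq,
    Bool.and_eq_true]
  refine or_congr (exists_congr fun q => and_congr_right fun hq => eqB_iff hf (hQ q hq)) (or_congr
    (exists_congr fun x => and_congr_right fun hx => eqB_iff hf ⟨hx, trivial, hx, hx⟩) (or_congr
    (exists_congr fun h => and_congr_right fun hh => exists_congr fun r => and_congr_right fun _ =>
      and_congr (isZeroB_iff (hf.zero r)) (eqB_iff (hf.quot r) (hprev h hh)))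
    (exists_congr fun h => and_congr_right fun hh => exists_congr fun h' => and_congr_right fun hh' =>
      inSpan_iff hf (hprev h hh) (hprev h' hh'))))

def proofB (n : ℕ) (T : List (List Bool)) (Qs : List (Formula F ℕ)) (g : Formula F ℕ)
    (π : List (Formula F ℕ)) : Bool :=
  ((Qs.all (varsB n)) && varsB n g && π.all (varsB n)) &&
  ((Qs.all (sortedB n T)) && sortedB n T g && π.all (sortedB n T)) &&
  -- The default formula here does not affect the answer, as an empty sequence is rejected by the
  -- first test. The one in the next line is never reached, as `i` is below the length.
  (!π.reverse.isEmpty && eqB n (π.reverse.headD (.const 0)) g) &&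
  (List.range π.length).all fun i => lineB n Qs (π.take i) (π.getD i (.const 0))

theorem proofB_iff {n : ℕ} {T : List (List Bool)} {Qs : List (Formula F ℕ)} {g : Formula F ℕ}
    {π : List (Formula F ℕ)} : proofB n T Qs g π = true ↔
      ((∀ f ∈ Qs, f.VarsIn {i | i < n}) ∧ g.VarsIn {i | i < n} ∧ (∀ f ∈ π, f.VarsIn {i | i < n})) ∧
      ProofSpec {i | i < n} (fun x y => lookup T x y = true) Qs g π := by
  rw [proofB, Bool.and_eq_true, Bool.and_eq_true, Bool.and_eq_true]
  simp only [and_assoc]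
  have hv : ((Qs.all (varsB n)) && varsB n g && π.all (varsB n)) = true ↔
      (∀ f ∈ Qs, f.VarsIn {i | i < n}) ∧ g.VarsIn {i | i < n} ∧ (∀ f ∈ π, f.VarsIn {i | i < n}) := by
    simp only [Bool.and_eq_true, List.all_eq_true, varsB_iff, and_assoc]
  rw [hv]
  simp only [and_assoc]
  refine and_congr_right fun hQ => and_congr_right fun hg => and_congr_right fun hπ => ?_
  unfold ProofSpec
  simp only [Bool.and_eq_true, List.all_eq_true, and_assoc]
  refine and_congr (forall₂_congr fun f hf => sortedB_iff (hQ f hf)) (and_congr (sortedB_iff hg)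
    (and_congr (forall₂_congr fun f hf => sortedB_iff (hπ f hf)) ?_))
  rw [← and_assoc]
  refine and_congr ?_ ?_
  · rw [List.getLast?_eq_head?_reverse]
    have hm : ∀ f ∈ π.reverse, f.VarsIn {i | i < n} := fun f hf => hπ f (List.mem_reverse.1 hf)
    cases hr : π.reverse with
    | nil => simp
    | cons f l =>
      rw [hr] at hm
      simp [eqB_iff (hm f (by simp)) hg]
  · unfold Lines
    simp only [List.mem_range]
    refine forall₂_congr fun i hi => ?_
    rw [List.getD_eq_getElem _ _ hi, lineB_iff hQ (fun q hq => hπ q (List.mem_of_mem_take hq))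
      (hπ _ (List.getElem_mem hi))]

variable [Enc F] [EfficientField F] {α : Type u} [Enc α]

namespace PolyTime

@[fun_prop]
theorem isZeroB {n : α → ℕ} {f : α → Formula F ℕ} (hn : PolyTime n) (hf : PolyTime f) :
    PolyTime fun a => isZeroB (n a) (f a) := by
  unfold OFPC.isZeroB
  fun_prop

@[fun_prop]
theorem eqB {n : α → ℕ} {f g : α → Formula F ℕ} (hn : PolyTime n) (hf : PolyTime f) (hg : PolyTime g) :
    PolyTime fun a => eqB (n a) (f a) (g a) := by
  unfold OFPC.eqB
  fun_prop

@[fun_prop]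
theorem lineB {n : α → ℕ} {Qs prev : α → List (Formula F ℕ)} {f : α → Formula F ℕ} (hn : PolyTime n)
    (hQ : PolyTime Qs) (hprev : PolyTime prev) (hf : PolyTime f) :
    PolyTime fun a => lineB (n a) (Qs a) (prev a) (f a) := by
  unfold OFPC.lineB boolFormula
  fun_prop

end PolyTime
end

/-! ### Comparison tables of linear orders -/

section
variable {α : Type u} [Enc α]

@[fun_prop]
theorem PolyTime.lookup {T : α → List (List Bool)} {x y : α → ℕ} (hT : PolyTime T) (hx : PolyTime x)
    (hy : PolyTime y) : PolyTime fun a => lookup (T a) (x a) (y a) := by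
  unfold OFPC.lookup
  fun_prop

/-- Whether the table is the comparison table of a linear order. -/
def orderB (T : List (List Bool)) : Bool :=
  (T.all fun r => eqb r.length T.length) &&
  (List.range T.length).all fun x => lookup T x x && (List.range T.length).all fun y =>
    (eqb x y || !(lookup T x y && lookup T y x)) && (lookup T x y || lookup T y x) &&
    (List.range T.length).all fun z => !(lookup T x y && lookup T y z) || lookup T x z

@[fun_prop]
theorem PolyTime.orderB {T : α → List (List Bool)} (hT : PolyTime T) :
    PolyTime fun a => orderB (T a) := by
  unfold OFPC.orderB
  fun_prop

/-- The comparison table of a linear order. -/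
def orderTable {n : ℕ} (ord : LinearOrder (Fin n)) : List (List Bool) :=
  List.ofFn fun i : Fin n => List.ofFn fun j : Fin n =>
    @decide (ord.le i j) (ord.toDecidableLE i j)

theorem code_orderTable {n : ℕ} (ord : LinearOrder (Fin n)) : Enc.code (orderTable ord) = codeOrder ord := by
  simp only [orderTable, codeOrder, Enc.code, List.map_ofFn, Function.comp_def]

theorem lookup_orderTable {n : ℕ} (ord : LinearOrder (Fin n)) (i j : Fin n) :
    lookup (orderTable ord) i j = true ↔ ord.le i j := by
  have h : (orderTable ord).getD i [] = List.ofFn fun j : Fin n =>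
      @decide (ord.le i j) (ord.toDecidableLE i j) := by
    rw [orderTable, List.getD_eq_getElem _ _ (by simp), List.getElem_ofFn]
  rw [lookup, h, List.getD_eq_getElem _ _ (by simp), List.getElem_ofFn, decide_eq_true_iff]

theorem exists_linearOrder {β : Type*} (le : β → β → Prop) (h1 : ∀ i, le i i)
    (h2 : ∀ i j k, le i j → le j k → le i k) (h3 : ∀ i j, le i j → le j i → i = j)
    (h4 : ∀ i j, le i j ∨ le j i) : ∃ ord : LinearOrder β, ∀ i j, ord.le i j ↔ le i j := by
  classical
  exact ⟨{ le := le, le_refl := h1, le_trans := h2, le_antisymm := h3, le_total := h4,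
           toDecidableLE := fun _ _ => Classical.propDecidable _ }, fun _ _ => Iff.rfl⟩

theorem orderB_iff {T : List (List Bool)} :
    orderB T = true ↔ ∃ (n : ℕ) (ord : LinearOrder (Fin n)), T = orderTable ord := by
  constructor
  · intro h
    simp only [orderB, Bool.and_eq_true, List.all_eq_true, List.mem_range, eqb_iff, Bool.or_eq_true,
      Bool.not_eq_true'] at h
    obtain ⟨h1, h2⟩ := h
    obtain ⟨ord, hord⟩ := exists_linearOrder (fun i j : Fin T.length => lookup T i j = true)
      (fun i => (h2 i i.2).1)
      (fun i j k hij hjk => by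
        have := (((h2 i i.2).2 j j.2).2 k k.2)
        rw [hij, hjk] at this
        simpa using this)
      (fun i j hij hji => by
        have := ((h2 i i.2).2 j j.2).1.1
        rw [hij, hji] at this
        exact Fin.ext (by simpa using this))
      (fun i j => ((h2 i i.2).2 j j.2).1.2)
    refine ⟨T.length, ord, List.ext_getElem (by simp [orderTable]) fun i hi _ => ?_⟩
    have hl := h1 _ (List.getElem_mem hi)
    simp only [orderTable, List.getElem_ofFn]
    refine List.ext_getElem (by simp [hl]) fun j hj hj' => ?_
    rw [List.getElem_ofFn, Bool.eq_iff_iff, decide_eq_true_iff, hord, lookup, List.getD_eq_getElem _ _ hi, List.getD_eq_getElem _ _ hj]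
  · rintro ⟨n, ord, rfl⟩
    have hl : (orderTable ord).length = n := by simp [orderTable]
    simp only [orderB, Bool.and_eq_true, List.all_eq_true, List.mem_range, eqb_iff, Bool.or_eq_true,
      Bool.not_eq_true', hl]
    have h : ∀ {x y : ℕ} (hx : x < n) (hy : y < n), lookup (orderTable ord) x y = true ↔
      ord.le ⟨x, hx⟩ ⟨y, hy⟩ := fun hx hy => lookup_orderTable ord ⟨_, hx⟩ ⟨_, hy⟩
    refine ⟨?_, fun x hx => ⟨(h hx hx).2 (ord.le_refl _), fun y hy => ⟨⟨?_, ?_⟩, fun z hz => ?_⟩⟩⟩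
    · intro r hr
      simp only [orderTable, List.mem_ofFn] at hr
      obtain ⟨i, rfl⟩ := hr
      simp
    · by_cases hxy : x = y
      · exact Or.inl hxy
      · right
        rw [← Bool.not_eq_true, Bool.and_eq_true, h hx hy, h hy hx]
        exact fun h => hxy (by simpa using ord.le_antisymm _ _ h.1 h.2)
    · rw [h hx hy, h hy hx]; exact ord.le_total _ _
    · rw [← Bool.not_eq_true, Bool.and_eq_true, h hx hy, h hy hz, h hx hz, ← imp_iff_not_or]
      exact fun h => ord.le_trans _ _ _ h.1 h.2

end

/-! ### Verifiers for proofs in finitely many variables -/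

section
variable {F : Type*} [Field F]

theorem proofB_map_iff {n : ℕ} {ord : LinearOrder (Fin n)} {Qs π : List (Formula F (Fin n))}
    {g : Formula F (Fin n)} :
    proofB n (orderTable ord) (Qs.map (Formula.map Fin.val)) (g.map Fin.val)
      (π.map (Formula.map Fin.val)) = true ↔ ProofSpec Set.univ (fun i j => ord.le i j) Qs g π := by
  have hr : Set.range (Fin.val : Fin n → ℕ) = {i | i < n} := by
    ext i
    exact ⟨fun ⟨j, hj⟩ => hj ▸ j.2, fun hi => ⟨⟨i, hi⟩, rfl⟩⟩
  rw [proofB_iff, ← proofSpec_map Fin.val_injective (le' := fun x y => lookup (orderTable ord) x y = true)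
    (fun i j => lookup_orderTable ord i j), hr]
  refine and_iff_right ⟨?_, g.varsIn_map, ?_⟩
  · intro f hf
    obtain ⟨f, _, rfl⟩ := List.mem_map.1 hf
    exact f.varsIn_map
  · intro f hf
    obtain ⟨f, _, rfl⟩ := List.mem_map.1 hf
    exact f.varsIn_map

variable [Enc F]

variable [EfficientField F] {α : Type u} [Enc α]

namespace PolyTime

theorem sortedB_aux : PolyTime fun p : (ℕ × List (List Bool)) × Formula F ℕ => sortedB p.1.1 p.1.2 p.2 := by
  refine formulaAll (α := ℕ × List (List Bool)) (val := fun a f => sortedB a.1 a.2 f)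
    (node := fun a t => match t with
    | .mul f g => (List.range a.1).all fun x => (List.range a.1).all fun y =>
      OFPC.isZeroB a.1 (f.quot x) || OFPC.isZeroB a.1 (g.quot y) || OFPC.lookup a.2 x y
    | _ => true) ?_ fun n t => ?_
  · exact formulaCases (f := fun p : (ℕ × List (List Bool)) × Formula F ℕ => p.2) (by fun_prop)
      (v := fun _ _ => true) (by fun_prop)
      (c := fun _ _ => true) (by fun_prop) (s := fun _ _ _ => true) (by fun_prop)
      (m := fun p f g => (List.range p.1.1).all fun x => (List.range p.1.1).all fun y =>
        OFPC.isZeroB p.1.1 (f.quot x) || OFPC.isZeroB p.1.1 (g.quot y) || OFPC.lookup p.1.2 x y)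
      (by fun_prop) (by rintro ⟨n, t⟩; cases t <;> rfl)
  · cases t <;> simp [sortedB, Formula.children]

@[fun_prop]
theorem sortedB {n : α → ℕ} {T : α → List (List Bool)} {f : α → Formula F ℕ} (hn : PolyTime n)
    (hT : PolyTime T) (hf : PolyTime f) : PolyTime fun a => sortedB (n a) (T a) (f a) :=
  sortedB_aux.comp (f := fun a => ((n a, T a), f a)) (by fun_prop)

@[fun_prop]
theorem proofB {n : α → ℕ} {T : α → List (List Bool)} {Qs π : α → List (Formula F ℕ)}
    {g : α → Formula F ℕ} (hn : PolyTime n) (hT : PolyTime T) (hQ : PolyTime Qs) (hg : PolyTime g)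
    (hπ : PolyTime π) : PolyTime fun a => proofB (n a) (T a) (Qs a) (g a) (π a) := by
  unfold OFPC.proofB
  fun_prop

end PolyTime

/-- The number of variables is known only after the table has been read, so the input is parsed as
formulas over `ℕ`. Once `n` is the length of the table, the checker verifies that all variables are
below `n`, and the formulas then come from formulas over `Fin n` with the same codes. -/
theorem decidable_ofpcProofs : DecidableInPolyTime (ofpcProofs (Enc.code : F → Datum)) := by
  refine Recognizable.decidable
    (α := ((List (List Bool) × List (Formula F ℕ)) × Formula F ℕ) × List (Formula F ℕ))
    (dec := fun a => orderB a.1.1.1 && proofB a.1.1.1.length a.1.1.1 a.1.1.2 a.1.2 a.2) (by fun_prop)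
    fun v => ?_
  constructor
  · rintro ⟨n, ord, Qs, g, π, qs, h, rfl, hQ, hg, hπ⟩
    refine ⟨(((orderTable ord, Qs.map (Formula.map Fin.val)), g.map Fin.val),
      π.map (Formula.map Fin.val)), ?_, ?_⟩
    · rw [← code_orderTable, ← code_map_list, ← code_map_list, ← code_map _ rfl]
      rfl
    · rw [Bool.and_eq_true]
      refine ⟨orderB_iff.2 ⟨n, ord, rfl⟩, ?_⟩
      have hl : (orderTable ord).length = n := by simp [orderTable]
      dsimp only
      rw [hl, proofB_map_iff]
      exact exists_isOFPCProof_iff.1 ⟨qs, h, hQ, hg, hπ⟩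
  · rintro ⟨⟨⟨⟨T, Qs⟩, g⟩, π⟩, rfl, h⟩
    rw [Bool.and_eq_true] at h
    obtain ⟨n, ord, rfl⟩ := orderB_iff.1 h.1
    have hl : (orderTable ord).length = n := by simp [orderTable]
    have h := h.2
    dsimp only at h
    rw [hl] at h
    obtain ⟨⟨hQ, hg, hπ⟩, -⟩ := proofB_iff.1 h
    obtain ⟨Qs, rfl⟩ := Formula.exists_map_list_of_varsIn hQ
    obtain ⟨g, rfl⟩ := Formula.exists_map_of_varsIn hg
    obtain ⟨π, rfl⟩ := Formula.exists_map_list_of_varsIn hπ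
    obtain ⟨qs, k, hqs, hk, hp⟩ := exists_isOFPCProof_iff.2 (proofB_map_iff.1 h)
    refine ⟨n, ord, Qs, g, π, qs, k, ?_, hqs, hk, hp⟩
    rw [← code_orderTable, ← code_map_list, ← code_map_list, ← code_map _ rfl]
    rfl

theorem decidable_ofpcRefutations : DecidableInPolyTime (ofpcRefutations (Enc.code : F → Datum)) := by
  refine Recognizable.decidable
    (α := (List (List Bool) × List (Formula F ℕ)) × List (Formula F ℕ))
    (dec := fun a => orderB a.1.1 && proofB a.1.1.length a.1.1 a.1.2 (.const 1) a.2) (by fun_prop)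
    fun v => ?_
  constructor
  · rintro ⟨n, ord, Qs, π, qs, rfl, hQ, hπ⟩
    refine ⟨((orderTable ord, Qs.map (Formula.map Fin.val)), π.map (Formula.map Fin.val)), ?_, ?_⟩
    · rw [← code_orderTable, ← code_map_list, ← code_map_list]
      rfl
    · rw [Bool.and_eq_true]
      refine ⟨orderB_iff.2 ⟨n, ord, rfl⟩, ?_⟩
      have hl : (orderTable ord).length = n := by simp [orderTable]
      dsimp only
      rw [hl]
      exact proofB_map_iff.2 (exists_isOFPCProof_iff.1 ⟨qs, 1, hQ, computes_one ord, hπ⟩)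
  · rintro ⟨⟨⟨T, Qs⟩, π⟩, rfl, h⟩
    rw [Bool.and_eq_true] at h
    obtain ⟨n, ord, rfl⟩ := orderB_iff.1 h.1
    have hl : (orderTable ord).length = n := by simp [orderTable]
    have h := h.2
    dsimp only at h
    rw [hl] at h
    obtain ⟨⟨hQ, -, hπ⟩, -⟩ := proofB_iff.1 h
    obtain ⟨Qs, rfl⟩ := Formula.exists_map_list_of_varsIn hQ
    obtain ⟨π, rfl⟩ := Formula.exists_map_list_of_varsIn hπ
    have h' := proofB_map_iff (g := (Formula.const 1 : Formula F (Fin n))).1 h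
    have hqs : List.Forall₂ (Formula.Computes ord) Qs (Qs.map (Formula.poly ord)) :=
      forall₂_computes_iff.2 ⟨fun f hf => isOrdered_iff.2 (h'.1 f hf), rfl⟩
    refine ⟨n, ord, Qs, π, _, ?_, hqs, (isOFPCProof_iff hqs (computes_one ord)).2 h'⟩
    rw [← code_orderTable, ← code_map_list, ← code_map_list]
    rfl

theorem isProofSystem_ofpcRefutations :
    IsProofSystem (ofpcRefutations (Enc.code : F → Datum)) (unsolvableSystems (Enc.code : F → Datum)) := by
  refine ⟨decidable_ofpcRefutations, fun x => ?_⟩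
  constructor
  · rintro ⟨_, n, ord, Qs, π, qs, h, hQ, hπ⟩
    injection h with h _
    exact ⟨n, ord, Qs, qs, h, hQ, (exists_isOFPCRefutation_iff ord qs).1 ⟨π, hπ⟩⟩
  · rintro ⟨n, ord, Qs, qs, rfl, hQ, h⟩
    obtain ⟨π, hπ⟩ := (exists_isOFPCRefutation_iff ord qs).2 h
    exact ⟨_, n, ord, Qs, π, qs, rfl, hQ, hπ⟩

end

/-! ## Translations of clauses -/

section
variable {F : Type*} [Enc F]

/-- Variables are written in unary, so an index is smaller than the code in which it occurs. -/
theorem Formula.varsIn_esize (f : Formula F ℕ) {n : ℕ} (hn : esize f ≤ n) : f.VarsIn {i | i < n} := by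
  induction f with
  | var i =>
    have : esize (Formula.var i : Formula F ℕ) = 1 + esize i + 1 := rfl
    rw [esize_nat] at this
    change i < n
    omega
  | const a => trivial
  | add f g ihf ihg =>
    have : esize (Formula.add f g) = 5 + (esize f + esize g + 1) + 1 := rfl
    exact ⟨ihf (by omega), ihg (by omega)⟩
  | mul f g ihf ihg =>
    have : esize (Formula.mul f g) = 7 + (esize f + esize g + 1) + 1 := rfl
    exact ⟨ihf (by omega), ihg (by omega)⟩

end

section
variable {F : Type*} [Field F] {σ : Type*}

/-- The commutative image of a noncommutative polynomial. -/
def commMap : FreeAlgebra F σ →ₐ[F] MvPolynomial σ F := FreeAlgebra.lift F MvPolynomial.X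

theorem commMap_bracketMap (ord : LinearOrder σ) (p : MvPolynomial σ F) :
    commMap (bracketMap ord p) = p := by
  have : (commMap (F := F) (σ := σ)).toLinearMap ∘ₗ bracketMap ord = LinearMap.id := by
    refine (MvPolynomial.basisMonomials σ F).ext fun m => ?_
    have hw : commMap (word (sortedWord ord m) : FreeAlgebra F σ) = MvPolynomial.monomial m 1 := by
      rw [word, map_list_prod, List.map_map, ← Multiset.prod_coe, ← Multiset.map_coe, coe_sortedWord,
        Finsupp.toMultiset_map, Finsupp.prod_toMultiset, Finsupp.prod_mapDomain_index (by simp)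
        (fun _ _ _ => pow_add _ _ _), MvPolynomial.monomial_eq, map_one, one_mul]
      refine Finsupp.prod_congr fun i _ => ?_
      simp [commMap]
    simp [bracketMap_monomial, hw]
  exact LinearMap.congr_fun this p

/-- Since `commMap` is a left inverse of `bracketMap`, the polynomial computed by an ordered formula
is found by letting the variables commute. -/
theorem Formula.IsOrdered.computes {ord : LinearOrder σ} {f : Formula F σ} (h : f.IsOrdered ord) :
    f.Computes ord (commMap f.eval) := by
  rw [computes_iff]
  refine ⟨h, ?_⟩
  conv_rhs => rw [h.eval_eq, commMap_bracketMap]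

theorem Formula.sortedOn_congr {X : Set σ} {le le' : σ → σ → Prop}
    (h : ∀ x ∈ X, ∀ y ∈ X, le x y ↔ le' x y) (f : Formula F σ) :
    f.SortedOn X le ↔ f.SortedOn X le' := by
  induction f with
  | var i => rfl
  | const a => rfl
  | add f g ihf ihg => rw [Formula.SortedOn, Formula.SortedOn, ihf, ihg]
  | mul f g ihf ihg =>
    rw [Formula.SortedOn, Formula.SortedOn, ihf, ihg]
    refine and_congr_left fun _ => forall₂_congr fun x hx => forall₂_congr fun y hy => ?_
    rw [h x hx y hy]

theorem proofSpec_congr {X : Set σ} {le le' : σ → σ → Prop} (h : ∀ x ∈ X, ∀ y ∈ X, le x y ↔ le' x y)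
    {Qs : List (Formula F σ)} {g : Formula F σ} {π : List (Formula F σ)} :
    ProofSpec X le Qs g π ↔ ProofSpec X le' Qs g π := by
  unfold ProofSpec
  simp only [Formula.sortedOn_congr h]

end

/-- Insertion into a list that is sorted with respect to `le`. -/
def insertLit (le : ℕ → ℕ → Bool) (a : Literal) (s : Clause) : Clause :=
  s.filter (fun b => !le a.1 b.1) ++ a :: s.filter (fun b => le a.1 b.1)

def sortClause (le : ℕ → ℕ → Bool) (c : Clause) : Clause := c.foldr (insertLit le) []

theorem insertLit_perm (le : ℕ → ℕ → Bool) (a : Literal) (s : Clause) :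
    (insertLit le a s).Perm (a :: s) := by
  refine List.perm_middle.trans (List.Perm.cons a ?_)
  have := List.filter_append_perm (fun b : Literal => !le a.1 b.1) s
  simpa using this

theorem sortClause_perm (le : ℕ → ℕ → Bool) (c : Clause) : (sortClause le c).Perm c := by
  induction c with
  | nil => exact List.Perm.refl _
  | cons a c ih => exact (insertLit_perm le a _).trans (ih.cons a)

theorem sortClause_sorted {ord : LinearOrder ℕ} {le : ℕ → ℕ → Bool}
    (hle : ∀ i j, le i j = true ↔ ord.le i j) (c : Clause) :
    (sortClause le c).Pairwise fun a b => ord.le a.1 b.1 := by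
  induction c with
  | nil => exact List.Pairwise.nil
  | cons a c ih =>
    change (insertLit le a (sortClause le c)).Pairwise _
    have h1 : ∀ b : Literal, (!le a.1 b.1) = true → ord.le b.1 a.1 := by
      intro b hb
      rcases ord.le_total b.1 a.1 with h | h
      · exact h
      · rw [(hle _ _).2 h] at hb; cases hb
    rw [insertLit, List.pairwise_append]
    refine ⟨ih.filter _, ?_, ?_⟩
    · rw [List.pairwise_cons]
      refine ⟨fun b hb => ?_, ih.filter _⟩
      exact (hle _ _).1 (List.mem_filter.1 hb).2
    · intro b hb b' hb'
      have hb := h1 b (List.mem_filter.1 hb).2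
      rcases List.mem_cons.1 hb' with rfl | hb'
      · exact hb
      · exact ord.le_trans _ _ _ hb ((hle _ _).1 (List.mem_filter.1 hb').2)

section
variable {F : Type*} [Field F]

def litFormula (l : Literal) : Formula F ℕ := .add (.var l.1) (.const (bif l.2 then -1 else 0))

/-- The product of the translations of literals. -/
def litProd (c : Clause) : Formula F ℕ := c.foldr (fun l f => .mul (litFormula l) f) (.const 1)

/-- An ordered formula for the translation of a clause. -/
def clauseFormula (le : ℕ → ℕ → Bool) (c : Clause) : Formula F ℕ := litProd (sortClause le c)

theorem varsIn_litProd (c : Clause) : (litProd c : Formula F ℕ).VarsIn {i | ∃ l ∈ c, l.1 = i} := by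
  suffices ∀ X : Set ℕ, (∀ l ∈ c, l.1 ∈ X) → (litProd c : Formula F ℕ).VarsIn X from
    this _ fun l hl => ⟨l, hl, rfl⟩
  intro X hX
  induction c with
  | nil => trivial
  | cons l c ih => exact ⟨⟨hX l (by simp), trivial⟩, ih fun l' hl' => hX l' (by simp [hl'])⟩

theorem varsIn_clauseFormula (le : ℕ → ℕ → Bool) (c : Clause) :
    (clauseFormula le c : Formula F ℕ).VarsIn {i | ∃ l ∈ c, l.1 = i} := by
  have := varsIn_litProd (F := F) (sortClause le c)
  simp only [(sortClause_perm le c).mem_iff] at this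
  exact this

theorem isOrdered_litProd {ord : LinearOrder ℕ} {c : Clause}
    (hc : c.Pairwise fun a b => ord.le a.1 b.1) : (litProd c : Formula F ℕ).IsOrdered ord := by
  rw [isOrdered_iff]
  induction c with
  | nil => trivial
  | cons l c ih =>
    rw [List.pairwise_cons] at hc
    refine ⟨fun x _ y _ hx hy => ?_, ⟨trivial, trivial⟩, ih hc.2⟩
    have hx : x = l.1 := by
      by_contra hne
      have hv : (litFormula l : Formula F ℕ).VarsIn {l.1} := ⟨rfl, trivial⟩
      exact hx (hv.eval_quot_eq hne)
    have hy : ∃ l' ∈ c, l'.1 = y := by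
      by_contra hne
      exact hy ((varsIn_litProd c).eval_quot_eq hne)
    obtain ⟨l', hl', rfl⟩ := hy
    rw [hx]
    exact hc.1 l' hl'

theorem commMap_litProd (c : Clause) : commMap (litProd c : Formula F ℕ).eval = Clause.poly F c := by
  induction c with
  | nil => simp [litProd, Formula.eval, Clause.poly]
  | cons l c ih =>
    have h : (litProd (l :: c) : Formula F ℕ) = .mul (litFormula l) (litProd c) := rfl
    rw [h, Formula.eval, map_mul, ih, Clause.poly, Clause.poly, List.map_cons, List.prod_cons]
    congr 1
    rcases l with ⟨i, b⟩
    cases b <;> simp [litFormula, Formula.eval, commMap, sub_eq_add_neg]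

/-- The factors of the translation commute, so the literals may be sorted first. The product of the
sorted literals, nested to the right, is then ordered at every node; repeated variables do no harm
because the order is not strict. -/
theorem computes_clauseFormula {ord : LinearOrder ℕ} {le : ℕ → ℕ → Bool}
    (hle : ∀ i j, le i j = true ↔ ord.le i j) (c : Clause) :
    (clauseFormula le c : Formula F ℕ).Computes ord (Clause.poly F c) := by
  have h := (isOrdered_litProd (F := F) (sortClause_sorted hle c)).computes
  rw [commMap_litProd] at h
  have hp : Clause.poly F (sortClause le c) = Clause.poly F c :=
    ((sortClause_perm le c).map _).prod_eq
  rwa [hp] at h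

theorem computes_cnf {ord : LinearOrder ℕ} {le : ℕ → ℕ → Bool}
    (hle : ∀ i j, le i j = true ↔ ord.le i j) (φ : CNF) :
    List.Forall₂ (Formula.Computes ord) (φ.map (clauseFormula (F := F) le)) (φ.polys F) := by
  induction φ with
  | nil => exact List.Forall₂.nil
  | cons c φ ih => exact List.Forall₂.cons (computes_clauseFormula hle c) ih

/-- At a point with values in `{0, 1}` the factor of a literal vanishes exactly when the literal is
true, so the product vanishes iff the clause is satisfied. The empty clause becomes the polynomial
`1`. -/
theorem hasZeroOneSolution_polys_iff (φ : CNF) : HasZeroOneSolution (φ.polys F) ↔ φ.Satisfiable := by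
  classical
  have key : ∀ (a : ℕ → F) (c : Clause), MvPolynomial.eval a (Clause.poly F c) = 0 ↔
      ∃ l ∈ c, a l.1 = if l.2 then 1 else 0 := by
    intro a c
    rw [Clause.poly, map_list_prod, List.map_map, List.prod_eq_zero_iff, List.mem_map]
    refine exists_congr fun l => and_congr_right fun _ => ?_
    rcases l with ⟨i, b⟩
    cases b <;> simp [sub_eq_zero]
  simp only [HasZeroOneSolution, CNF.Satisfiable, CNF.polys, List.mem_map, forall_exists_index, and_imp,
    forall_apply_eq_imp_iff₂, key]
  constructor
  · rintro ⟨a, -, h⟩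
    refine ⟨fun i => decide (a i = 1), fun c hc => ?_⟩
    obtain ⟨l, hl, h⟩ := h c hc
    refine ⟨l, hl, ?_⟩
    dsimp only
    rw [h]
    cases l.2 <;> simp
  · rintro ⟨a, h⟩
    refine ⟨fun i => if a i then 1 else 0, fun i => by cases a i <;> simp, fun c hc => ?_⟩
    obtain ⟨l, hl, h⟩ := h c hc
    exact ⟨l, hl, by dsimp only; rw [h]⟩

theorem exists_isOFPCRefutation_polys_iff (ord : LinearOrder ℕ) (φ : CNF) :
    (∃ π : List (Formula F ℕ), IsOFPCRefutation ord (φ.polys F) π) ↔ ¬ φ.Satisfiable := by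
  rw [exists_isOFPCRefutation_iff, hasZeroOneSolution_polys_iff]

variable [Enc F]

/-- All variables of the CNF formula and of the lines have indices below the size of the input, so a
finite square of the comparison table of the infinite order suffices. The same number bounds the
variables that the checker has to try. -/
def cnfProofB (le : ℕ → ℕ → Bool) (φ : CNF) (π : List (Formula F ℕ)) : Bool :=
  proofB (esize (φ, π)) ((List.range (esize (φ, π))).map fun x => (List.range (esize (φ, π))).map (le x))
    (φ.map (clauseFormula le)) (.const 1) π

/-- Proofs over infinitely many variables quantify over all of them. These quantifiers may be
restricted to the variables below the input size, because every formula involved uses only such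
variables (`proofSpec_iff_of_varsIn`). -/
theorem cnfProofB_iff {ord : LinearOrder ℕ} {le : ℕ → ℕ → Bool}
    (hle : ∀ i j, le i j = true ↔ ord.le i j) {φ : CNF} {π : List (Formula F ℕ)} :
    cnfProofB le φ π = true ↔ IsOFPCRefutation ord (φ.polys F) π := by
  have hsize := esize_prod φ π
  rw [IsOFPCRefutation, isOFPCProof_iff (computes_cnf hle φ) (computes_one ord), cnfProofB, proofB_iff]
  generalize esize (φ, π) = n at *
  have hQ : ∀ f ∈ φ.map (clauseFormula (F := F) le), f.VarsIn {i | i < n} := by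
    intro f hf
    obtain ⟨c, hc, rfl⟩ := List.mem_map.1 hf
    have hmono : ∀ {X Y : Set ℕ} {g : Formula F ℕ}, X ⊆ Y → g.VarsIn X → g.VarsIn Y := by
      intro X Y g hXY hg
      induction g with
      | var i => exact hXY hg
      | const a => trivial
      | add f g ihf ihg => exact ⟨ihf hg.1, ihg hg.2⟩
      | mul f g ihf ihg => exact ⟨ihf hg.1, ihg hg.2⟩
    refine hmono ?_ (varsIn_clauseFormula le c)
    rintro _ ⟨l, hl, rfl⟩
    have h1 := esize_lt_of_mem hc
    have h2 := esize_lt_of_mem hl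
    have h3 := esize_prod l.1 l.2
    rw [esize_nat] at h3
    change l.1 < n
    have h4 : esize l = esize (l.1, l.2) := rfl
    omega
  have hπ : ∀ f ∈ π, f.VarsIn {i | i < n} := fun f hf =>
    f.varsIn_esize ((esize_lt_of_mem hf).le.trans (by omega))
  have h1 : (Formula.const 1 : Formula F ℕ).VarsIn {i | i < n} := trivial
  rw [and_iff_right ⟨hQ, h1, hπ⟩, ← proofSpec_iff_of_varsIn hQ h1 hπ]
  refine proofSpec_congr fun x hx y hy => ?_
  have hx : x < n := hx
  have hy : y < n := hy
  have hrow : ((List.range n).map fun x => (List.range n).map (le x)).getD x [] =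
      (List.range n).map (le x) := by
    rw [List.getD_eq_getElem _ _ (by simpa using hx), List.getElem_map, List.getElem_range]
  rw [lookup, hrow, List.getD_eq_getElem _ _ (by simpa using hy), List.getElem_map, List.getElem_range, hle]

end

/-! ### The proof system for CNF formulas -/

section
variable {α : Type u} [Enc α]
namespace PolyTime

theorem esize_insertLit (le : ℕ → ℕ → Bool) (a : Literal) (s : Clause) :
    OFPC.esize (insertLit le a s) = OFPC.esize (a :: s) := by
  rw [esize_list, esize_list, ((insertLit_perm le a s).map _).sum_eq, (insertLit_perm le a s).length_eq]

theorem sortClause {le : ℕ → ℕ → Bool} (hle : PolyTime fun p : ℕ × ℕ => le p.1 p.2) {c : α → Clause}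
    (hc : PolyTime c) : PolyTime fun a => sortClause le (c a) := by
  unfold OFPC.sortClause
  have h1 : PolyTime fun p : (α × Literal × Clause) × Literal => le p.1.2.1.1 p.2.1 :=
    hle.comp (f := fun p : (α × Literal × Clause) × Literal => (p.1.2.1.1, p.2.1)) (by fun_prop)
  refine foldr_of_le hc (i := fun _ => ([] : Clause)) (by fun_prop) (f := fun _ x s => insertLit le x s) ?_
    (B := fun a => OFPC.esize (c a)) hc.size fun a s x hx => ?_
  · unfold insertLit
    exact append (filter (l := fun p : α × Literal × Clause => p.2.2)
        (h := fun p b => !le p.2.1.1 b.1) h1.not (by fun_prop))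
      (cons (by fun_prop) (filter (l := fun p : α × Literal × Clause => p.2.2)
        (h := fun p b => le p.2.1.1 b.1) h1 (by fun_prop)))
  · rw [esize_insertLit, esize_cons]
    have := esize_lt_of_mem hx
    omega

variable {F : Type*} [Field F] [Enc F]

@[fun_prop]
theorem litFormula {l : α → Literal} (hl : PolyTime l) :
    PolyTime fun a => (litFormula (l a) : Formula F ℕ) := by
  unfold OFPC.litFormula
  fun_prop

theorem litProd : PolyTime fun c : Clause => (litProd c : Formula F ℕ) := by
  unfold OFPC.litProd
  obtain ⟨B, hB, hb⟩ := bound_mem (α := Clause) (h := fun _ l => (OFPC.litFormula l : Formula F ℕ))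
    (by fun_prop) (l := fun c => c) (by fun_prop)
  refine foldr_of_le (l := fun c : Clause => c) (by fun_prop) (i := fun _ => Formula.const 1) (by fun_prop)
    (f := fun _ l f => .mul (OFPC.litFormula l) f) (by fun_prop) (B := fun c => B c + 9)
    (hB.add (.const 9)) fun a s x hx => ?_
  have := hb a x hx
  have h : OFPC.esize (Formula.mul (OFPC.litFormula x) s : Formula F ℕ) =
    7 + (OFPC.esize (OFPC.litFormula x : Formula F ℕ) + OFPC.esize s + 1) + 1 := rfl
  omega

variable [EfficientField F]

theorem cnfProofB {le : ℕ → ℕ → Bool} (hle : PolyTime fun p : ℕ × ℕ => le p.1 p.2) {φ : α → CNF}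
    {π : α → List (Formula F ℕ)} (hφ : PolyTime φ) (hπ : PolyTime π) :
    PolyTime fun a => cnfProofB le (φ a) (π a) := by
  unfold OFPC.cnfProofB
  have hc : PolyTime fun c : Clause => (clauseFormula le c : Formula F ℕ) :=
    litProd.comp (sortClause hle (c := fun c => c) (by fun_prop))
  refine proofB (by fun_prop) (map (h := fun a x => (List.range (OFPC.esize (φ a, π a))).map (le x))
    (map (α := α × ℕ) (h := fun p y => le p.2 y) ?_ (by fun_prop)) (by fun_prop))
    (map (h := fun _ c => clauseFormula le c) ?_ hφ) (by fun_prop) hπ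
  · exact hle.comp (f := fun p : (α × ℕ) × ℕ => (p.1.2, p.2)) (by fun_prop)
  · exact hc.comp (f := fun p : α × Clause => p.2) (by fun_prop)

end PolyTime

theorem IsPolyTimeOrder.exists_le {ord : LinearOrder ℕ} (h : IsPolyTimeOrder ord) :
    ∃ le : ℕ → ℕ → Bool, (PolyTime fun p : ℕ × ℕ => le p.1 p.2) ∧ ∀ i j, le i j = true ↔ ord.le i j := by
  obtain ⟨r, hr, h⟩ := decidableInPolyTime_iff.1 h
  refine ⟨fun i j => r (Enc.code (i, j)), hr.comp (f := fun p : ℕ × ℕ => Enc.code (p.1, p.2))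
    (by fun_prop), fun i j => ?_⟩
  rw [h]
  constructor
  · rintro ⟨i', j', he, hle⟩
    injection he with h1 h2
    obtain rfl : i = i' := ofNat_injective h1
    obtain rfl : j = j' := ofNat_injective h2
    exact hle
  · exact fun hle => ⟨i, j, rfl, hle⟩

variable {F : Type*} [Field F] [Enc F] [EfficientField F]

theorem isProofSystem_cnfRefutations {ord : LinearOrder ℕ} (h : IsPolyTimeOrder ord) :
    IsProofSystem (cnfRefutations (Enc.code : F → Datum) ord) unsatCNF := by
  obtain ⟨le, hle, hord⟩ := h.exists_le
  constructor
  · refine Recognizable.decidable (α := CNF × List (Formula F ℕ))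
      (PolyTime.cnfProofB hle PolyTime.id.fst PolyTime.id.snd) fun v => ?_
    constructor
    · rintro ⟨φ, π, rfl, h⟩
      exact ⟨(φ, π), rfl, (cnfProofB_iff hord).2 h⟩
    · rintro ⟨⟨φ, π⟩, rfl, h⟩
      exact ⟨φ, π, rfl, (cnfProofB_iff hord).1 h⟩
  · intro x
    constructor
    · rintro ⟨_, φ, π, h, hπ⟩
      injection h with h _
      exact ⟨φ, h, (exists_isOFPCRefutation_polys_iff ord φ).1 ⟨π, hπ⟩⟩
    · rintro ⟨φ, rfl, h⟩
      obtain ⟨π, hπ⟩ := (exists_isOFPCRefutation_polys_iff (F := F) ord φ).2 h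
      exact ⟨_, φ, π, rfl, hπ⟩

end

/-! ## The translation of propositional formulas -/

namespace PropForm

/-- The clauses `C` hold under the assignment `a`. -/
def Holds (a : ℕ → Bool) (C : CNF) : Prop := ∀ c ∈ C, ∃ l ∈ c, a l.1 = l.2

theorem holds_cons {a : ℕ → Bool} {c : Clause} {C : CNF} :
    Holds a (c :: C) ↔ (∃ l ∈ c, a l.1 = l.2) ∧ Holds a C := List.forall_mem_cons

theorem holds_append {a : ℕ → Bool} {C D : CNF} : Holds a (C ++ D) ↔ Holds a C ∧ Holds a D :=
  List.forall_mem_append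

theorem val_of_holds {a : ℕ → Bool} (φ : PropForm) {k : ℕ} (h : Holds a (φ.gates k).2.2) :
    a (φ.gates k).1 = φ.val a := by
  induction φ generalizing k with
  | var i => rfl
  | tru => simpa [gates, val, Holds] using h
  | fls => simpa [gates, val, Holds] using h
  | neg φ ih =>
    simp only [gates, holds_cons] at h
    have := ih h.2.2
    simp only [gates, val, ← this]
    have h1 := h.1
    have h2 := h.2.1
    simp only [List.mem_cons, List.not_mem_nil, or_false, exists_eq_or_imp, exists_eq_left] at h1 h2
    revert h1 h2
    cases a (φ.gates k).1 <;> cases a (φ.gates k).2.1 <;> simp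
  | and φ ψ ih ih' =>
    simp only [gates, holds_cons, holds_append] at h
    obtain ⟨h1, h2, h3, h4, h5⟩ := h
    simp only [gates, val, ← ih h4, ← ih' h5]
    simp only [List.mem_cons, List.not_mem_nil, or_false, exists_eq_or_imp, exists_eq_left] at h1 h2 h3
    revert h1 h2 h3
    cases a (φ.gates k).1 <;> cases a (ψ.gates (φ.gates k).2.1).1 <;>
      cases a (ψ.gates (φ.gates k).2.1).2.1 <;> simp
  | or φ ψ ih ih' =>
    simp only [gates, holds_cons, holds_append] at h
    obtain ⟨h1, h2, h3, h4, h5⟩ := h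
    simp only [gates, val, ← ih h4, ← ih' h5]
    simp only [List.mem_cons, List.not_mem_nil, or_false, exists_eq_or_imp, exists_eq_left] at h1 h2 h3
    revert h1 h2 h3
    cases a (φ.gates k).1 <;> cases a (ψ.gates (φ.gates k).2.1).1 <;>
      cases a (ψ.gates (φ.gates k).2.1).2.1 <;> simp

theorem val_congr {a b : ℕ → Bool} (φ : PropForm) (h : ∀ i < φ.bound, a i = b i) :
    φ.val a = φ.val b := by
  induction φ with
  | var i => exact h i (Nat.lt_succ_self i)
  | tru => rfl
  | fls => rfl
  | neg φ ih => rw [val, val, ih h]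
  | and φ ψ ih ih' =>
    rw [val, val, ih fun i hi => h i (lt_max_of_lt_left hi), ih' fun i hi => h i (lt_max_of_lt_right hi)]
  | or φ ψ ih ih' =>
    rw [val, val, ih fun i hi => h i (lt_max_of_lt_left hi), ih' fun i hi => h i (lt_max_of_lt_right hi)]

/-- The new variables receive the values of their nodes. The clauses are claimed for every `b` that
agrees with `a'` below the first unused variable, so that later nodes can still extend the
assignment without disturbing them. The maximum in the second claim covers a formula that is a
variable and creates no new one. -/
theorem exists_holds (φ : PropForm) (a : ℕ → Bool) {k : ℕ} (hk : φ.bound ≤ k) :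
    k ≤ (φ.gates k).2.1 ∧ (φ.gates k).1 < max k (φ.gates k).2.1 ∧ ∃ a' : ℕ → Bool, (∀ i < k, a' i = a i) ∧
      ∀ b : ℕ → Bool, (∀ i < (φ.gates k).2.1, b i = a' i) → Holds b (φ.gates k).2.2 := by
  induction φ generalizing k a with
  | var i =>
    refine ⟨le_rfl, lt_max_of_lt_left hk, a, fun _ _ => rfl, fun b _ c hc => ?_⟩
    cases hc
  | tru =>
    refine ⟨Nat.le_succ k, lt_max_of_lt_right (Nat.lt_succ_self k), Function.update a k true,
      fun i hi => Function.update_of_ne hi.ne _ _, fun b hb => ?_⟩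
    have := hb k (Nat.lt_succ_self k)
    rw [Function.update_self] at this
    simpa [gates, Holds] using this
  | fls =>
    refine ⟨Nat.le_succ k, lt_max_of_lt_right (Nat.lt_succ_self k), Function.update a k false,
      fun i hi => Function.update_of_ne hi.ne _ _, fun b hb => ?_⟩
    have := hb k (Nat.lt_succ_self k)
    rw [Function.update_self] at this
    simpa [gates, Holds] using this
  | neg φ ih =>
    obtain ⟨h1, h2, a', h3, h4⟩ := ih a hk
    simp only [gates]
    set y := (φ.gates k).2.1
    rw [max_eq_right h1] at h2
    refine ⟨h1.trans (Nat.le_succ y), lt_max_of_lt_right (Nat.lt_succ_self y),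
      Function.update a' y (!a' (φ.gates k).1), fun i hi => ?_, fun b hb => ?_⟩
    · rw [Function.update_of_ne (by omega), h3 i hi]
    · have hb' : ∀ i < y, b i = a' i := fun i hi => by
        rw [hb i (by omega), Function.update_of_ne hi.ne]
      have hy := hb y (Nat.lt_succ_self y)
      rw [Function.update_self, ← hb' _ h2] at hy
      rw [holds_cons, holds_cons]
      refine ⟨?_, ?_, h4 b hb'⟩ <;>
        simp only [List.mem_cons, List.not_mem_nil, or_false, exists_eq_or_imp, exists_eq_left, hy] <;>
        cases b (φ.gates k).1 <;> simp
  | and φ ψ ih ih' =>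
    obtain ⟨h1, h2, a', h3, h4⟩ := ih a ((le_max_left _ _).trans hk)
    obtain ⟨h1', h2', a'', h3', h4'⟩ := ih' a' (((le_max_right _ _).trans hk).trans h1)
    simp only [gates]
    set l := (φ.gates k).2.1
    set y := (ψ.gates l).2.1
    rw [max_eq_right h1] at h2
    rw [max_eq_right h1'] at h2'
    refine ⟨(h1.trans h1').trans (Nat.le_succ y), lt_max_of_lt_right (Nat.lt_succ_self y),
      Function.update a'' y (a'' (φ.gates k).1 && a'' (ψ.gates l).1), fun i hi => ?_, fun b hb => ?_⟩
    · rw [Function.update_of_ne (by omega), h3' i (by omega), h3 i hi]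
    · have hb' : ∀ i < y, b i = a'' i := fun i hi => by
        rw [hb i (by omega), Function.update_of_ne hi.ne]
      have hy := hb y (Nat.lt_succ_self y)
      rw [Function.update_self, ← hb' _ h2', ← hb' _ (h2.trans_le h1')] at hy
      rw [holds_cons, holds_cons, holds_cons, holds_append]
      refine ⟨?_, ?_, ?_, h4 b fun i hi => by rw [hb' i (by omega), h3' i hi], h4' b hb'⟩ <;>
        simp only [List.mem_cons, List.not_mem_nil, or_false, exists_eq_or_imp, exists_eq_left, hy] <;>
        cases b (φ.gates k).1 <;> cases b (ψ.gates l).1 <;> simp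
  | or φ ψ ih ih' =>
    obtain ⟨h1, h2, a', h3, h4⟩ := ih a ((le_max_left _ _).trans hk)
    obtain ⟨h1', h2', a'', h3', h4'⟩ := ih' a' (((le_max_right _ _).trans hk).trans h1)
    simp only [gates]
    set l := (φ.gates k).2.1
    set y := (ψ.gates l).2.1
    rw [max_eq_right h1] at h2
    rw [max_eq_right h1'] at h2'
    refine ⟨(h1.trans h1').trans (Nat.le_succ y), lt_max_of_lt_right (Nat.lt_succ_self y),
      Function.update a'' y (a'' (φ.gates k).1 || a'' (ψ.gates l).1), fun i hi => ?_, fun b hb => ?_⟩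
    · rw [Function.update_of_ne (by omega), h3' i (by omega), h3 i hi]
    · have hb' : ∀ i < y, b i = a'' i := fun i hi => by
        rw [hb i (by omega), Function.update_of_ne hi.ne]
      have hy := hb y (Nat.lt_succ_self y)
      rw [Function.update_self, ← hb' _ h2', ← hb' _ (h2.trans_le h1')] at hy
      rw [holds_cons, holds_cons, holds_cons, holds_append]
      refine ⟨?_, ?_, ?_, h4 b fun i hi => by rw [hb' i (by omega), h3' i hi], h4' b hb'⟩ <;>
        simp only [List.mem_cons, List.not_mem_nil, or_false, exists_eq_or_imp, exists_eq_left, hy] <;>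
        cases b (φ.gates k).1 <;> cases b (ψ.gates l).1 <;> simp

theorem satisfiable_toCNF_iff (φ : PropForm) : φ.toCNF.Satisfiable ↔ φ.Satisfiable := by
  have key : ∀ a, (∀ c ∈ φ.toCNF, ∃ l ∈ c, a l.1 = l.2) ↔
      a (φ.gates φ.bound).1 = true ∧ Holds a (φ.gates φ.bound).2.2 := fun a => by
    rw [toCNF, List.forall_mem_cons]
    simp [Holds]
  constructor
  · rintro ⟨a, h⟩
    rw [key] at h
    exact ⟨a, by rw [← val_of_holds φ h.2, h.1]⟩
  · rintro ⟨a, h⟩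
    obtain ⟨-, -, a', h1, h2⟩ := exists_holds φ a le_rfl
    have h2 := h2 a' fun _ _ => rfl
    refine ⟨a', (key a').2 ⟨?_, h2⟩⟩
    rw [val_of_holds φ h2, val_congr φ h1, h]

/-! ### The translation is computable in polynomial time -/

/-- A variable `(false, i)` of the formula or a new variable `(true, j)`. -/
abbrev RelVar := Bool × ℕ

def shiftVar (m : ℕ) (v : RelVar) : RelVar := (v.1, bif v.1 then v.2 + m else v.2)

def shiftClauses (m : ℕ) (C : List (List (RelVar × Bool))) : List (List (RelVar × Bool)) :=
  C.map fun c => c.map fun l => (shiftVar m l.1, l.2)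

def instVar (k : ℕ) (v : RelVar) : ℕ := (shiftVar k v).2

def instClauses (k : ℕ) (C : List (List (RelVar × Bool))) : CNF :=
  C.map fun c => c.map fun l => (instVar k l.1, l.2)

/-- `gates` with the new variables numbered from `0`: the variable for the value, the number of new
variables and the clauses. -/
def relGates : PropForm → RelVar × ℕ × List (List (RelVar × Bool))
  | var i => ((false, i), 0, [])
  | tru => ((true, 0), 1, [[((true, 0), true)]])
  | fls => ((true, 0), 1, [[((true, 0), false)]])
  | neg φ => ((true, φ.relGates.2.1), φ.relGates.2.1 + 1,
      [((true, φ.relGates.2.1), true), (φ.relGates.1, true)] ::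
      [((true, φ.relGates.2.1), false), (φ.relGates.1, false)] :: φ.relGates.2.2)
  | and φ ψ => ((true, ψ.relGates.2.1 + φ.relGates.2.1), ψ.relGates.2.1 + φ.relGates.2.1 + 1,
      [((true, ψ.relGates.2.1 + φ.relGates.2.1), false), (φ.relGates.1, true)] ::
      [((true, ψ.relGates.2.1 + φ.relGates.2.1), false), (shiftVar φ.relGates.2.1 ψ.relGates.1, true)] ::
      [((true, ψ.relGates.2.1 + φ.relGates.2.1), true), (φ.relGates.1, false),
        (shiftVar φ.relGates.2.1 ψ.relGates.1, false)] ::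
      (φ.relGates.2.2 ++ shiftClauses φ.relGates.2.1 ψ.relGates.2.2))
  | or φ ψ => ((true, ψ.relGates.2.1 + φ.relGates.2.1), ψ.relGates.2.1 + φ.relGates.2.1 + 1,
      [((true, ψ.relGates.2.1 + φ.relGates.2.1), true), (φ.relGates.1, false)] ::
      [((true, ψ.relGates.2.1 + φ.relGates.2.1), true), (shiftVar φ.relGates.2.1 ψ.relGates.1, false)] ::
      [((true, ψ.relGates.2.1 + φ.relGates.2.1), false), (φ.relGates.1, true),
        (shiftVar φ.relGates.2.1 ψ.relGates.1, true)] ::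
      (φ.relGates.2.2 ++ shiftClauses φ.relGates.2.1 ψ.relGates.2.2))

theorem instVar_shiftVar (k m : ℕ) (v : RelVar) : instVar k (shiftVar m v) = instVar (m + k) v := by
  rcases v with ⟨b, j⟩
  cases b <;> simp [instVar, shiftVar, add_assoc]

theorem instClauses_shiftClauses (k m : ℕ) (C : List (List (RelVar × Bool))) :
    instClauses k (shiftClauses m C) = instClauses (m + k) C := by
  simp [instClauses, shiftClauses, instVar_shiftVar, Function.comp_def]

/-- The counter in `gates` is handed from the left subformula to the right one, so its value at a
node is not a function of the values at the children. With variables numbered relative to the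
subformula it becomes one: the right part is shifted by the number of new variables on the left, and
at the end everything is shifted by `k`. This is the form needed for recursion on trees. -/
theorem gates_eq (φ : PropForm) (k : ℕ) : φ.gates k =
    (instVar k φ.relGates.1, φ.relGates.2.1 + k, instClauses k φ.relGates.2.2) := by
  have hi : ∀ k j, instVar k (true, j) = j + k := fun _ _ => rfl
  have hc : ∀ k c C, instClauses k (c :: C) = c.map (fun l => (instVar k l.1, l.2)) :: instClauses k C :=
    fun _ _ _ => rfl
  have ha : ∀ k C D, instClauses k (C ++ D) = instClauses k C ++ instClauses k D :=
    fun _ _ _ => List.map_append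
  induction φ generalizing k with
  | var i => simp [gates, relGates, instVar, shiftVar, instClauses]
  | tru => simp [gates, relGates, instVar, shiftVar, instClauses, add_comm]
  | fls => simp [gates, relGates, instVar, shiftVar, instClauses, add_comm]
  | neg φ ih =>
    simp only [gates, relGates, ih, hi, hc, List.map_cons, List.map_nil]
    simp [add_right_comm]
  | and φ ψ ih ih' =>
    simp only [gates, relGates, ih, ih', hi, hc, ha, List.map_cons, List.map_nil, instVar_shiftVar,
      instClauses_shiftClauses, ← add_assoc]
    simp [add_right_comm]
  | or φ ψ ih ih' =>
    simp only [gates, relGates, ih, ih', hi, hc, ha, List.map_cons, List.map_nil, instVar_shiftVar,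
      instClauses_shiftClauses, ← add_assoc]
    simp [add_right_comm]

instance : Enc PropForm := ⟨code⟩

def tag : PropForm → ℕ
  | var _ => 0
  | tru => 1
  | fls => 2
  | neg _ => 3
  | and _ _ => 4
  | or _ _ => 5

def idx : PropForm → ℕ
  | var i => i
  | _ => 0

def children : PropForm → List PropForm
  | neg φ => [φ]
  | and φ ψ => [φ, ψ]
  | or φ ψ => [φ, ψ]
  | _ => []

theorem children_lt (φ : PropForm) : (φ.children.map esize).sum < esize φ := by
  cases φ <;> simp [children, esize, Enc.code, code, Datum.size] <;> omega

instance : LawfulEnc PropForm := ⟨by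
  intro φ
  induction φ with
  | var i => intro ψ h; cases ψ <;> first | (injection h with _ h; rw [ofNat_injective h]) | cases h
  | tru => intro ψ h; cases ψ <;> first | rfl | cases h
  | fls => intro ψ h; cases ψ <;> first | rfl | cases h
  | neg φ ih => intro ψ h; cases ψ <;> first | (injection h with _ h; rw [ih h]) | cases h
  | and φ φ' ih ih' =>
    intro ψ h; cases ψ <;>
      first | (injection h with _ h; injection h with h1 h2; rw [ih h1, ih' h2]; done) | cases h
  | or φ φ' ih ih' =>
    intro ψ h; cases ψ <;>
      first | (injection h with _ h; injection h with h1 h2; rw [ih h1, ih' h2]; done) | cases h⟩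

theorem eqb_ofNat (a b : ℕ) : eqb (Datum.ofNat a) (Datum.ofNat b) = decide (a = b) := by
  rw [Bool.eq_iff_iff, eqb_iff, decide_eq_true_iff, ofNat_injective.eq_iff]

theorem eqb_nil_ofNat (b : ℕ) : eqb Datum.nil (Datum.ofNat (b + 1)) = false :=
  eqb_ofNat 0 (b + 1)

/-- The subtrees of the code of a formula that have to be codes of formulas. -/
def codeChildren (d : Datum) : List Datum :=
  bif eqb d.fst (Datum.ofNat 3) then [d.snd] else
  bif eqb d.fst (Datum.ofNat 4) || eqb d.fst (Datum.ofNat 5) then [d.snd.fst, d.snd.snd] else []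

theorem codeChildren_lt (d : Datum) : ((codeChildren d).map esize).sum < esize d := by
  unfold codeChildren
  rcases d with _ | ⟨t, _ | ⟨x, y⟩⟩
  · simp [Datum.fst, eqb_nil_ofNat, Datum.size]
  · cases eqb (Datum.node t .nil).fst (Datum.ofNat 3) <;>
    cases h : eqb (Datum.node t .nil).fst (Datum.ofNat 4) || eqb (Datum.node t .nil).fst (Datum.ofNat 5) <;>
    simp [Datum.snd, Datum.size, Datum.fst]
    · have : 5 ≤ t.size := by
        simp only [Datum.fst, Bool.or_eq_true, eqb_iff] at h
        rcases h with rfl | rfl <;> decide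
      omega
  · cases eqb (Datum.node t (.node x y)).fst (Datum.ofNat 3) <;>
    cases eqb (Datum.node t (.node x y)).fst (Datum.ofNat 4) ||
      eqb (Datum.node t (.node x y)).fst (Datum.ofNat 5) <;>
    simp [Datum.snd, Datum.size, Datum.fst] <;> omega

theorem polyTime_codeChildren : PolyTime codeChildren := by
  unfold codeChildren
  fun_prop

theorem codeChildren_code (φ : PropForm) : codeChildren φ.code = φ.children.map code := by
  cases φ <;> simp [codeChildren, code, children, eqb_ofNat, Datum.fst, Datum.snd]

theorem polyTime_children : PolyTime children :=
  (polyTime_codeChildren.comp (PolyTime.code (α := PropForm))).of_code_eq fun φ => by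
    change Datum.ofList ((codeChildren φ.code).map fun d => d) = Datum.ofList (φ.children.map code)
    rw [codeChildren_code, List.map_id']

theorem polyTime_tag : PolyTime tag :=
  (show PolyTime fun φ : PropForm => (Enc.code φ).fst by fun_prop).of_code_eq fun φ => by cases φ <;> rfl

theorem polyTime_idx : PolyTime idx :=
  (show PolyTime fun φ : PropForm => bif eqb (Enc.code φ).fst (Datum.ofNat 0) then (Enc.code φ).snd else
    Datum.nil by fun_prop).of_code_eq fun φ => by
    cases φ <;> simp [Enc.code, code, idx, eqb, Datum.fst, Datum.snd, Datum.ofNat]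

instance : Recognizable PropForm := ⟨by
  classical
  obtain ⟨rN, hrN, hN⟩ := Recognizable.exists_rec (α := ℕ)
  let node : Datum → List Bool → Bool := fun d bs =>
    (!d.isNil && eqb d.fst (Datum.ofNat 0) && rN d.snd) ||
    ((eqb d (code tru) || eqb d (code fls)) ||
    ((eqb d.fst (Datum.ofNat 3) || ((eqb d.fst (Datum.ofNat 4) || eqb d.fst (Datum.ofNat 5)) &&
      !d.snd.isNil)) && bs.all fun b => b))
  have hnode : PolyTime fun p : Datum × List Bool => node p.1 p.2 := by
    simp only [node]; fun_prop
  have key : ∀ d : Datum, (∃ φ : PropForm, code φ = d) ↔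
      node d ((codeChildren d).map fun d => decide (∃ φ : PropForm, code φ = d)) = true := by
    intro d
    simp only [node, Bool.or_eq_true, Bool.and_eq_true, eqb_iff, hN]
    constructor
    · rintro ⟨φ, rfl⟩
      rw [codeChildren_code]
      have hch : ((φ.children.map code).map fun d => decide (∃ φ : PropForm, code φ = d)).all (fun b => b) =
          true := by simp
      cases φ with
      | var i => exact Or.inl ⟨⟨rfl, rfl⟩, i, rfl⟩
      | tru => exact Or.inr (Or.inl (Or.inl rfl))
      | fls => exact Or.inr (Or.inl (Or.inr rfl))
      | neg φ => exact Or.inr (Or.inr ⟨Or.inl rfl, hch⟩)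
      | and φ ψ => exact Or.inr (Or.inr ⟨Or.inr ⟨Or.inl rfl, rfl⟩, hch⟩)
      | or φ ψ => exact Or.inr (Or.inr ⟨Or.inr ⟨Or.inr rfl, rfl⟩, hch⟩)
    · rintro (⟨⟨h0, h1⟩, i, h2⟩ | (rfl | rfl) | ⟨h0, h1⟩)
      · rcases d with _ | ⟨t, e⟩
        · cases h0
        · simp only [Datum.fst, Datum.snd] at h1 h2
          subst h1 h2
          exact ⟨var i, rfl⟩
      · exact ⟨tru, rfl⟩
      · exact ⟨fls, rfl⟩
      · rcases h0 with h0 | ⟨h0, h3⟩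
        · rcases d with _ | ⟨t, e⟩
          · cases h0
          · simp only [Datum.fst] at h0
            subst h0
            have : codeChildren (.node (Datum.ofNat 3) e) = [e] := by
              simp [codeChildren, Datum.fst, Datum.snd, eqb_ofNat]
            rw [this] at h1
            simp only [List.map_cons, List.map_nil, List.all_cons, List.all_nil, Bool.and_true,
              decide_eq_true_iff] at h1
            obtain ⟨φ, rfl⟩ := h1
            exact ⟨neg φ, rfl⟩
        · rcases d with _ | ⟨t, _ | ⟨x, y⟩⟩
          · cases h3
          · cases h3
          · simp only [Datum.fst] at h0
            have : codeChildren (.node t (.node x y)) = [x, y] := by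
              rcases h0 with rfl | rfl <;> simp [codeChildren, Datum.fst, Datum.snd, eqb_ofNat]
            rw [this] at h1
            simp only [List.map_cons, List.map_nil, List.all_cons, List.all_nil, Bool.and_true,
              Bool.and_eq_true, decide_eq_true_iff] at h1
            obtain ⟨⟨φ, rfl⟩, ⟨ψ, rfl⟩⟩ := h1
            rcases h0 with rfl | rfl
            · exact ⟨and φ ψ, rfl⟩
            · exact ⟨or φ ψ, rfl⟩
  have h := PolyTime.treeFold (α := Unit) (τ := Datum) polyTime_codeChildren codeChildren_lt
    (node := fun _ d bs => node d bs)
    (hnode.comp (f := fun p : Unit × Datum × List Bool => p.2) (by fun_prop))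
    (val := fun _ d => decide (∃ φ : PropForm, code φ = d))
    (fun _ d => by rw [Bool.eq_iff_iff, decide_eq_true_iff]; exact key d) (PolyTime.bool_bdd _)
  exact ⟨_, h.comp (f := fun d : Datum => ((), d)) (by fun_prop), fun d => by simp [Enc.code]⟩⟩

end PropForm

namespace PolyTime
variable {α : Type u} [Enc α]

@[fun_prop]
theorem natAdd {f g : α → ℕ} (hf : PolyTime f) (hg : PolyTime g) : PolyTime fun a => f a + g a :=
  (show PolyTime fun a => (List.range (f a) ++ List.range (g a)).length by fun_prop).of_code_eq
    fun a => congrArg _ (by simp)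

@[fun_prop]
theorem natMax {f g : α → ℕ} (hf : PolyTime f) (hg : PolyTime g) : PolyTime fun a => max (f a) (g a) :=
  (show PolyTime fun a => f a + ((List.range (g a)).drop (f a)).length by fun_prop).of_code_eq
    fun a => congrArg _ (by simp; omega)

end PolyTime

namespace PropForm

theorem bound_le (φ : PropForm) : φ.bound ≤ esize φ := by
  induction φ with
  | var i =>
    have : esize (var i) = 1 + esize i + 1 := rfl
    rw [esize_nat] at this
    rw [bound]; omega
  | tru => exact Nat.zero_le _
  | fls => exact Nat.zero_le _
  | neg φ ih =>
    have : esize (neg φ) = 7 + esize φ + 1 := rfl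
    rw [bound]; omega
  | and φ ψ ih ih' =>
    have : esize (and φ ψ) = 9 + (esize φ + esize ψ + 1) + 1 := rfl
    rw [bound]; omega
  | or φ ψ ih ih' =>
    have : esize (or φ ψ) = 11 + (esize φ + esize ψ + 1) + 1 := rfl
    rw [bound]; omega

theorem polyTime_bound : PolyTime bound := by
  have h := PolyTime.treeFold (α := Unit) polyTime_children children_lt
    (node := fun _ φ vs => bif eqb φ.tag 0 then φ.idx + 1 else max (vs.headD 0) (vs.tail.headD 0))
    (by
      have h1 := polyTime_tag.comp (f := fun p : Unit × PropForm × List ℕ => p.2.1) (by fun_prop)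
      have h2 := polyTime_idx.comp (f := fun p : Unit × PropForm × List ℕ => p.2.1) (by fun_prop)
      exact PolyTime.cond (h1.eqb (PolyTime.const 0)) (h2.natAdd (PolyTime.const 1)) (by fun_prop))
    (val := fun _ φ => φ.bound) (fun _ φ => by cases φ <;> simp [bound, tag, idx, children, eqb])
    (((PolyBdd.const 2).mul (PolyTime.id.snd.size) |>.add (.const 1)).mono fun p => by
      rw [esize_nat]
      have := bound_le p.2
      omega)
  exact h.comp (f := fun φ => ((), φ)) (by fun_prop)

@[fun_prop]
theorem polyTime_shiftVar {α : Type u} [Enc α] {m : α → ℕ} {v : α → RelVar} (hm : PolyTime m)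
    (hv : PolyTime v) : PolyTime fun a => shiftVar (m a) (v a) := by
  unfold shiftVar
  fun_prop

@[fun_prop]
theorem polyTime_shiftClauses {α : Type u} [Enc α] {m : α → ℕ} {C : α → List (List (RelVar × Bool))}
    (hm : PolyTime m) (hC : PolyTime C) : PolyTime fun a => shiftClauses (m a) (C a) := by
  unfold shiftClauses
  fun_prop

/-- The step of the recursion that computes `relGates`. -/
def relNode (t i : ℕ) (r s : RelVar × ℕ × List (List (RelVar × Bool))) :
    RelVar × ℕ × List (List (RelVar × Bool)) :=
  bif eqb t 0 then ((false, i), 0, []) else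
  bif eqb t 1 then ((true, 0), 1, [[((true, 0), true)]]) else
  bif eqb t 2 then ((true, 0), 1, [[((true, 0), false)]]) else
  bif eqb t 3 then ((true, r.2.1), r.2.1 + 1,
      [((true, r.2.1), true), (r.1, true)] :: [((true, r.2.1), false), (r.1, false)] :: r.2.2) else
  -- Conjunction and disjunction are dual: their clauses differ only by negating all signs, which
  -- are therefore expressed by the test for the tag `4`.
  ((true, s.2.1 + r.2.1), s.2.1 + r.2.1 + 1,
      [((true, s.2.1 + r.2.1), !eqb t 4), (r.1, eqb t 4)] ::
      [((true, s.2.1 + r.2.1), !eqb t 4), (shiftVar r.2.1 s.1, eqb t 4)] ::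
      [((true, s.2.1 + r.2.1), eqb t 4), (r.1, !eqb t 4), (shiftVar r.2.1 s.1, !eqb t 4)] ::
      (r.2.2 ++ shiftClauses r.2.1 s.2.2))

theorem polyTime_relNode {α : Type u} [Enc α] {t i : α → ℕ}
    {r s : α → RelVar × ℕ × List (List (RelVar × Bool))} (ht : PolyTime t) (hi : PolyTime i)
    (hr : PolyTime r) (hs : PolyTime s) : PolyTime fun a => relNode (t a) (i a) (r a) (s a) := by
  unfold relNode
  fun_prop

theorem shiftVar_le (m : ℕ) (v : RelVar) : (shiftVar m v).2 ≤ v.2 + m := by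
  rcases v with ⟨b, j⟩
  cases b <;> simp [shiftVar]

theorem relGates_bounds (φ : PropForm) : φ.relGates.2.1 ≤ esize φ ∧ φ.relGates.1.2 ≤ esize φ ∧
    φ.relGates.2.2.length ≤ 3 * esize φ ∧
    ∀ c ∈ φ.relGates.2.2, c.length ≤ 3 ∧ ∀ l ∈ c, l.1.2 ≤ esize φ := by
  induction φ with
  | var i =>
    have : esize (var i) = 1 + esize i + 1 := rfl
    rw [esize_nat] at this
    refine ⟨Nat.zero_le _, ?_, Nat.zero_le _, fun c hc => by cases hc⟩
    simp only [relGates]; omega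
  | tru => simp [relGates, esize, Enc.code, code, Datum.size, Datum.ofNat]
  | fls => simp [relGates, esize, Enc.code, code, Datum.size, Datum.ofNat]
  | neg φ ih =>
    have : esize (neg φ) = 7 + esize φ + 1 := rfl
    obtain ⟨h1, h2, h3, h4⟩ := ih
    refine ⟨by simp only [relGates]; omega, by simp only [relGates]; omega,
      by simp only [relGates, List.length_cons]; omega, ?_⟩
    simp only [relGates, List.forall_mem_cons, List.length_cons, List.length_nil, List.not_mem_nil,
      false_imp_iff, implies_true, and_true]
    exact ⟨⟨by omega, by omega, by omega⟩, ⟨by omega, by omega, by omega⟩, fun c hc =>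
      ⟨(h4 c hc).1, fun l hl => ((h4 c hc).2 l hl).trans (by omega)⟩⟩
  | and φ ψ ih ih' =>
    have : esize (and φ ψ) = 9 + (esize φ + esize ψ + 1) + 1 := rfl
    obtain ⟨h1, h2, h3, h4⟩ := ih
    obtain ⟨h1', h2', h3', h4'⟩ := ih'
    have hs := shiftVar_le φ.relGates.2.1 ψ.relGates.1
    refine ⟨by simp only [relGates]; omega, by simp only [relGates]; omega,
      by simp only [relGates, shiftClauses, List.length_cons, List.length_append, List.length_map]; omega, ?_⟩
    simp only [relGates, List.forall_mem_cons, List.length_cons, List.length_nil, List.not_mem_nil,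
      false_imp_iff, implies_true, and_true, List.forall_mem_append]
    refine ⟨⟨by omega, by omega, by omega⟩, ⟨by omega, by omega, by omega⟩,
      ⟨by omega, by omega, by omega, by omega⟩, fun c hc =>
        ⟨(h4 c hc).1, fun l hl => ((h4 c hc).2 l hl).trans (by omega)⟩, fun c hc => ?_⟩
    obtain ⟨c', hc', rfl⟩ := List.mem_map.1 hc
    refine ⟨by rw [List.length_map]; exact (h4' c' hc').1, fun l hl => ?_⟩
    obtain ⟨l', hl', rfl⟩ := List.mem_map.1 hl
    have := (h4' c' hc').2 l' hl'
    have := shiftVar_le φ.relGates.2.1 l'.1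
    dsimp only
    omega
  | or φ ψ ih ih' =>
    have : esize (or φ ψ) = 11 + (esize φ + esize ψ + 1) + 1 := rfl
    obtain ⟨h1, h2, h3, h4⟩ := ih
    obtain ⟨h1', h2', h3', h4'⟩ := ih'
    have hs := shiftVar_le φ.relGates.2.1 ψ.relGates.1
    refine ⟨by simp only [relGates]; omega, by simp only [relGates]; omega,
      by simp only [relGates, shiftClauses, List.length_cons, List.length_append, List.length_map]; omega, ?_⟩
    simp only [relGates, List.forall_mem_cons, List.length_cons, List.length_nil, List.not_mem_nil,
      false_imp_iff, implies_true, and_true, List.forall_mem_append]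
    refine ⟨⟨by omega, by omega, by omega⟩, ⟨by omega, by omega, by omega⟩,
      ⟨by omega, by omega, by omega, by omega⟩, fun c hc =>
        ⟨(h4 c hc).1, fun l hl => ((h4 c hc).2 l hl).trans (by omega)⟩, fun c hc => ?_⟩
    obtain ⟨c', hc', rfl⟩ := List.mem_map.1 hc
    refine ⟨by rw [List.length_map]; exact (h4' c' hc').1, fun l hl => ?_⟩
    obtain ⟨l', hl', rfl⟩ := List.mem_map.1 hl
    have := (h4' c' hc').2 l' hl'
    have := shiftVar_le φ.relGates.2.1 l'.1
    dsimp only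
    omega

theorem esize_relVar_le {v : RelVar} {n : ℕ} (h : v.2 ≤ n) : esize v ≤ 2 * n + 5 := by
  have := esize_prod v.1 v.2
  have := esize_bool_le v.1
  have := esize_nat v.2
  have : esize v = esize (v.1, v.2) := rfl
  omega

theorem esize_relGates (φ : PropForm) : esize φ.relGates ≤
    (2 * esize φ + 5) + ((2 * esize φ + 1) + (3 * esize φ * ((3 * ((2 * esize φ + 9) + 1) + 1) + 1) + 1) + 1) +
      1 := by
  obtain ⟨h1, h2, h3, h4⟩ := φ.relGates_bounds
  have e1 := esize_prod φ.relGates.1 φ.relGates.2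
  have e2 := esize_prod φ.relGates.2.1 φ.relGates.2.2
  have e1' : esize (φ.relGates.1, φ.relGates.2) = esize φ.relGates := rfl
  have e2' : esize (φ.relGates.2.1, φ.relGates.2.2) = esize φ.relGates.2 := rfl
  have e3 := esize_relVar_le h2
  have e4 := esize_nat φ.relGates.2.1
  have e5 : esize φ.relGates.2.2 ≤ 3 * esize φ * ((3 * ((2 * esize φ + 9) + 1) + 1) + 1) + 1 := by
    refine esize_list_le h3 fun c hc => esize_list_le (h4 c hc).1 fun l hl => ?_
    have := esize_relVar_le ((h4 c hc).2 l hl)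
    have := esize_prod l.1 l.2
    have := esize_bool_le l.2
    have : esize l = esize (l.1, l.2) := rfl
    omega
  omega

theorem polyTime_relGates : PolyTime relGates := by
  have hsz : PolyBdd fun p : Unit × PropForm => esize p.2 := PolyTime.id.snd.size
  have h := PolyTime.treeFold (α := Unit) polyTime_children children_lt
    -- The default `tru.relGates` stands for missing children, which `relNode` ignores for the tags
    -- in question.
    (node := fun _ φ vs => relNode φ.tag φ.idx (vs.headD tru.relGates) (vs.tail.headD tru.relGates))
    (polyTime_relNode
      (polyTime_tag.comp (f := fun p : Unit × PropForm × List _ => p.2.1) (by fun_prop))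
      (polyTime_idx.comp (f := fun p : Unit × PropForm × List _ => p.2.1) (by fun_prop))
      (by fun_prop) (by fun_prop))
    (val := fun _ φ => φ.relGates)
    (fun _ φ => by cases φ <;> simp [relNode, tag, idx, children, relGates, eqb])
    (PolyBdd.mono (((((PolyBdd.const 2).mul hsz).add (.const 5)).add (((((PolyBdd.const 2).mul hsz).add
      (.const 1)).add ((((PolyBdd.const 3).mul hsz).mul ((((PolyBdd.const 3).mul ((((PolyBdd.const 2).mul
        hsz).add (.const 9)).add (.const 1))).add (.const 1)).add (.const 1))).add (.const 1))).add
          (.const 1))).add (.const 1)) fun p => esize_relGates p.2)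
  exact h.comp (f := fun φ => ((), φ)) (by fun_prop)

theorem polyTime_toCNF : PolyTime toCNF := by
  have hb := polyTime_bound
  have hr := polyTime_relGates
  have hi : ∀ {α : Type} [Enc α] {k : α → ℕ} {v : α → RelVar}, PolyTime k → PolyTime v →
      PolyTime fun a => instVar (k a) (v a) := fun hk hv => (polyTime_shiftVar hk hv).snd
  have h : PolyTime fun φ : PropForm => ([(instVar φ.bound φ.relGates.1, true)] ::
      instClauses φ.bound φ.relGates.2.2 : CNF) := by
    refine PolyTime.cons (PolyTime.cons ((hi hb hr.fst).prodMk (PolyTime.const true)) (PolyTime.const []))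
      ?_
    unfold instClauses
    refine PolyTime.map (h := fun φ c => c.map fun l : RelVar × Bool => (instVar φ.bound l.1, l.2)) ?_
      hr.snd.snd
    refine PolyTime.map (α := PropForm × List (RelVar × Bool))
      (h := fun p l => (instVar p.1.bound l.1, l.2)) ?_ PolyTime.id.snd
    exact (hi (hb.comp (f := fun p : (PropForm × List (RelVar × Bool)) × RelVar × Bool => p.1.1)
      (by fun_prop)) (by fun_prop)).prodMk (by fun_prop)
  refine h.of_code_eq fun φ => congrArg _ ?_
  rw [toCNF, gates_eq]

end PropForm

/-! ### The proof system for propositional formulas -/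

section
variable {F : Type*} [Field F] [Enc F] [EfficientField F]

theorem isProofSystem_propRefutations {ord : LinearOrder ℕ} (h : IsPolyTimeOrder ord) :
    IsProofSystem (propRefutations (Enc.code : F → Datum) ord) unsatProp := by
  obtain ⟨le, hle, hord⟩ := h.exists_le
  constructor
  · refine Recognizable.decidable (α := PropForm × List (Formula F ℕ))
      (PolyTime.cnfProofB hle (φ := fun a => a.1.toCNF)
        (PropForm.polyTime_toCNF.comp PolyTime.id.fst) PolyTime.id.snd) fun v => ?_
    constructor
    · rintro ⟨φ, π, rfl, h⟩
      exact ⟨(φ, π), rfl, (cnfProofB_iff hord).2 h⟩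
    · rintro ⟨⟨φ, π⟩, rfl, h⟩
      exact ⟨φ, π, rfl, (cnfProofB_iff hord).1 h⟩
  · intro x
    constructor
    · rintro ⟨_, φ, π, h, hπ⟩
      injection h with h _
      refine ⟨φ, h, ?_⟩
      rw [← φ.satisfiable_toCNF_iff]
      exact (exists_isOFPCRefutation_polys_iff ord φ.toCNF).1 ⟨π, hπ⟩
    · rintro ⟨φ, rfl, h⟩
      rw [← φ.satisfiable_toCNF_iff] at h
      obtain ⟨π, hπ⟩ := (exists_isOFPCRefutation_polys_iff (F := F) ord φ.toCNF).2 h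
      exact ⟨_, φ, π, rfl, hπ⟩

end
end OFPC
end

theorem proposition4p6 {F : Type*} [Field F] :
    (∀ (n : ℕ) (ord : LinearOrder (Fin n)) (Q : List (MvPolynomial (Fin n) F)),
      (∃ π : List (OFPC.Formula F (Fin n)), OFPC.IsOFPCRefutation ord Q π) ↔
        ¬ OFPC.HasZeroOneSolution Q) ∧
    ∀ enc : F → OFPC.Datum, OFPC.IsEfficientEncoding enc →
      OFPC.DecidableInPolyTime (OFPC.ofpcProofs enc) ∧
      OFPC.IsProofSystem (OFPC.ofpcRefutations enc) (OFPC.unsolvableSystems enc) ∧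
      ∀ ord : LinearOrder ℕ, OFPC.IsPolyTimeOrder ord →
        OFPC.IsProofSystem (OFPC.cnfRefutations enc ord) OFPC.unsatCNF ∧
        OFPC.IsProofSystem (OFPC.propRefutations enc ord) OFPC.unsatProp := by
  refine ⟨fun n ord Q => OFPC.exists_isOFPCRefutation_iff ord Q, fun enc henc => ?_⟩
  let _ : OFPC.Enc F := ⟨enc⟩
  have _ : OFPC.EfficientField F := ⟨henc⟩
  exact ⟨OFPC.decidable_ofpcProofs, OFPC.isProofSystem_ofpcRefutations, fun ord h =>
    ⟨OFPC.isProofSystem_cnfRefutations h, OFPC.isProofSystem_propRefutations h⟩⟩
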